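/- **Theorem (Complexity bound).** An *instance* consists of a finite list of first-order clauses (a clause is a finite list of literals), some of which are marked as start clauses, and a size limit $d\in\mathbb N$. For each input clause $C$ take $d$ copies $C^1,\dots,C^d$; the variables of all copies (of all clauses) are renamed apart. Two literals are *connected* if they have the same atom and opposite polarity; write $L\bowtie K$ if $\rho(L)$ and $\rho(K)$ are connected for some substitution $\rho$. The encoding $\mathcal E_M$ of the instance has a propositional selector variable $S_C^k$ for every copy $C^k$ and a propositional variable $\langle L\sim K\rangle$ for every unordered pair of literals of the copies. A propositional assignment is a *model* of $\mathcal E_M$ if 1. $S_C^1$ is true for at least one start clause $C$; 2. at most $d$ selectors are true (or, in the strengthened form of the encoding, exactly $d$); 3. for every selected copy $C^i$ (i.e. $S_C^i$ is true) and every literal $L$ of $C^i$, there are a different selected copy $D^k$ and a literal $K$ of $D^k$ with $K\bowtie L$ such that $\langle L\sim K\rangle$ is true; 4. for every path $U$ through the selected copies, i.e. every set $U$ of literals containing exactly one literal of each selected copy and nothing else, $\langle L\sim K\rangle$ is true for some two literals $L,K\in U$; 5. there is one substitution $\sigma$ such that $\sigma(L)$ and $\sigma(K)$ are connected for all $L,K$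 for which $\langle L\sim K\rangle$ is true. Then the problem of solving $\mathcal E_M$, that is, of deciding for a given instance whether its encoding has a model, is in $\Sigma_2^P$, with respect to the size of the input clauses and the matrix proof size $d$: if the clauses are written as words over a finite alphabet and $d$ is written in unary, then the set of words that represent an instance whose encoding has a model is a language in $\Sigma_2^P$. This holds for both forms of the size constraint. -/

import Mathlib

namespace MatrixEncoding

/-! ## The second level of the polynomial hierarchy

Polynomial time is polynomial time on Mathlib's finite multi-stack Turing machines. -/

/-- An input word followed by two certificates, as one word over the disjoint union of the
three alphabets. -/
def tripleWord {Γ Δ : Type} (t : List Γ × List Δ × List Δ) : List (Γ ⊕ Δ ⊕ Δ) :=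
  t.1.map Sum.inl ++ t.2.1.map (fun a => Sum.inr (Sum.inl a)) ++
    t.2.2.map (fun a => Sum.inr (Sum.inr a))

/-- `L ∈ Σ₂ᵖ`: there are a finite certificate alphabet, a polynomial `p` and a polynomial-time
decidable ternary relation `V` such that `w ∈ L` if and only if there is a certificate `y` of
length at most `p |w|` such that `V w y z` for all `z` of length at most `p |w|`. -/
def SigmaTwoP {Γ : Type} (L : Language Γ) : Prop :=
  ∃ (Δ : Type) (_ : Fintype Δ) (p : Polynomial ℕ) (V : List Γ × List Δ × List Δ → Bool),
    Nonempty (Turing.TM2ComputableInPolyTime tripleWord Computability.encodeBool V) ∧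
      ∀ w : List Γ, w ∈ L ↔
        ∃ y : List Δ, y.length ≤ p.eval w.length ∧
          ∀ z : List Δ, z.length ≤ p.eval w.length → V (w, y, z) = true

/-! ## First-order literals and clauses -/

/-- Names of variables, function symbols and predicate symbols are binary words. -/
abbrev Name : Type := List Bool

/-- The first-order language with, for every arity, one function symbol and one predicate symbol
per name. -/
def sig : FirstOrder.Language := ⟨fun _ => Name, fun _ => Name⟩

/-- Terms with variables in `V`. -/
abbrev Tm (V : Type) : Type := sig.Term V

/-- Literals `P(t₁, …, tₙ)` (`positive = true`) and `¬ P(t₁, …, tₙ)` (`positive = false`). -/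
structure Literal (V : Type) where
  positive : Bool
  {arity : ℕ}
  pred : sig.Relations arity
  args : Fin arity → Tm V

namespace Literal

/-- Applying a substitution to a literal. -/
def subst {V W : Type} (σ : V → Tm W) (L : Literal V) : Literal W :=
  ⟨L.positive, L.pred, fun i => (L.args i).subst σ⟩

/-- Renaming the variables of a literal. -/
def rename {V W : Type} (g : V → W) (L : Literal V) : Literal W :=
  ⟨L.positive, L.pred, fun i => (L.args i).relabel g⟩

/-- The literal with the same atom and the opposite polarity. -/
def compl {V : Type} (L : Literal V) : Literal V :=
  ⟨!L.positive, L.pred, L.args⟩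

/-- Two literals are connected if they have the same atom and opposite polarity. -/
def Connected {V : Type} (L K : Literal V) : Prop := K = L.compl

/-- `L ⋈ K`: some substitution makes the two literals connected. -/
def Connectable {V : Type} (L K : Literal V) : Prop :=
  ∃ ρ : V → Tm V, (L.subst ρ).Connected (K.subst ρ)

end Literal

/-- An input clause: its literals, and whether it is one of the start clauses. -/
structure InputClause where
  isStart : Bool
  lits : List (Literal Name)

/-- An instance: the input clauses and the size limit `d`. -/
structure Instance where
  clauses : List InputClause
  limit : ℕ

/-! ## The matrix encoding -/

namespace Instance

/-- The clause copies: the `d` copies of every input clause. -/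
abbrev Copy (I : Instance) : Type := Fin I.clauses.length × Fin I.limit

/-- The input clause of which `c` is a copy. -/
def clauseOf (I : Instance) (c : I.Copy) : InputClause := I.clauses.get c.1

/-- The literals of the clause copies, given by a copy and a position in it. -/
abbrev Occ (I : Instance) : Type := Σ c : I.Copy, Fin (I.clauseOf c).lits.length

/-- The rigid variables: every clause copy has its own variables. -/
abbrev RigidVar (I : Instance) : Type := I.Copy × Name

/-- The literal at an occurrence, with its variables renamed apart from all other copies. -/
def litAt (I : Instance) (o : I.Occ) : Literal I.RigidVar :=
  ((I.clauseOf o.1).lits.get o.2).rename (fun x => (o.1, x))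

/-- The propositional variables: the selectors `S_C^k`, and the connection variables
`⟨L ∼ K⟩`, one for every unordered pair of literals. -/
inductive SATVar (I : Instance) : Type
  | sel (c : I.Copy) : SATVar I
  | conn (e : Sym2 I.Occ) : SATVar I

/-- The matrix represented by an assignment: the set of selected clause copies. -/
def matrix (I : Instance) (v : I.SATVar → Bool) : Set I.Copy := {c | v (.sel c) = true}

/-- A path through a matrix contains exactly one literal of every clause copy in the matrix,
and no other literal. -/
def IsPath (I : Instance) (M : Set I.Copy) (U : Set I.Occ) : Prop :=
  (∀ o ∈ U, o.1 ∈ M) ∧ ∀ c ∈ M, ∃! o : I.Occ, o ∈ U ∧ o.1 = c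

/-- The two forms of the size constraint: at most `d`, or exactly `d`, selected copies. -/
inductive LimitMode
  | atMost
  | exactly

/-- The size constraint on the number `n` of selected copies. -/
def LimitMode.Holds : LimitMode → ℕ → ℕ → Prop
  | .atMost, n, d => n ≤ d
  | .exactly, n, d => n = d

/-- `v` is a propositional model of the encoding of the instance. -/
structure IsModel (I : Instance) (m : LimitMode) (v : I.SATVar → Bool) : Prop where
  /-- The first copy of some start clause is selected. -/
  start : ∃ c : I.Copy, (I.clauseOf c).isStart = true ∧ c.2.val = 0 ∧ v (.sel c) = true
  /-- The size constraint on the selectors. -/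
  size : m.Holds (I.matrix v).ncard I.limit
  /-- Every literal of a selected copy is connected to a literal of another selected copy. -/
  fullyConnected : ∀ L : I.Occ, v (.sel L.1) = true →
    ∃ K : I.Occ, K.1 ≠ L.1 ∧ (I.litAt L).Connectable (I.litAt K) ∧
      v (.sel K.1) = true ∧ v (.conn s(L, K)) = true
  /-- Every path through the selected copies contains two literals that are connected. -/
  spanning : ∀ U : Set I.Occ, I.IsPath (I.matrix v) U →
    ∃ L ∈ U, ∃ K ∈ U, L ≠ K ∧ v (.conn s(L, K)) = true
  /-- One global substitution realizes all connections. -/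
  unification : ∃ σ : I.RigidVar → Tm I.RigidVar, ∀ L K : I.Occ,
    v (.conn s(L, K)) = true → ((I.litAt L).subst σ).Connected ((I.litAt K).subst σ)

/-- The encoding of the instance has a model. -/
def Solvable (I : Instance) (m : LimitMode) : Prop :=
  ∃ v : I.SATVar → Bool, I.IsModel m v

end Instance

/-! ## Instances as words over a finite alphabet -/

/-- The input alphabet. -/
inductive Sym : Type
  | tick
  | clause (isStart : Bool)
  | lit (positive : Bool)
  | var
  | fn
  | bit (b : Bool)
  | close

/-- A variable is written as `var` and its name; `f(t₁, …, tₙ)` as `fn`, the name of `f`, the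
terms `t₁, …, tₙ`, and `close`. -/
def writeTerm : Tm Name → List Sym
  | .var x => Sym.var :: x.map Sym.bit
  | @FirstOrder.Language.Term.func _ _ _ f ts =>
      Sym.fn :: (List.map Sym.bit f ++ (List.ofFn fun i => writeTerm (ts i)).flatten ++ [Sym.close])

/-- A literal is written as `lit`, with its polarity, the name of the predicate, the arguments,
and `close`. -/
def writeLiteral (L : Literal Name) : List Sym :=
  Sym.lit L.positive ::
    (List.map Sym.bit L.pred ++ (List.ofFn fun i => writeTerm (L.args i)).flatten ++ [Sym.close])

/-- A clause is written as `clause`, marked as start clause or not, and its literals. -/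
def writeClause (C : InputClause) : List Sym :=
  Sym.clause C.isStart :: (C.lits.map writeLiteral).flatten

/-- An instance is written as `d` ticks (the size limit in unary), followed by its clauses. -/
def writeInstance (I : Instance) : List Sym :=
  List.replicate I.limit Sym.tick ++ (I.clauses.map writeClause).flatten

/-- The problem of solving the encoding: the set of all words that represent an instance
whose encoding has a model. -/
def solvingLanguage (m : Instance.LimitMode) : Language Sym :=
  {w | ∃ I : Instance, writeInstance I = w ∧ I.Solvable m}

end MatrixEncoding

/-! The certificates never contain the unifying substitution, whose terms may be exponentially
large; they contain a numbering of its effect. Give every atom and every subterm of the clause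
copies a number, its class, where the same class means the same instance. Such a numbering is
consistent if nonvariable nodes of one class have the same symbol and the same classes of arguments,
if all occurrences of a variable within one copy have one class, and if the class of a node is
smaller than the classes of its arguments. Consistency suffices: evaluating the classes from the
largest down gives each of them a term (`Verified.exists_value`), and sending every variable to the
term of its class makes complementary literals of one class connected. Conversely, a unifier yields
a consistent numbering when its finitely many instances are numbered by decreasing size
(`exists_numbering`).

The existential certificate consists of the `d` copies of the clauses, with selection marks and with
the class of every node in unary. The universal certificate consists of a truth value for every
class and a word `R`. Each remaining condition is a statement about all such choices (`Passes`). If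
the classes are read as propositional atoms, every path contains two complementary literals of one
class if and only if every truth assignment falsifies some selected copy: given a path, make the
classes of its positive literals true; given an assignment that falsifies no selected copy, a true
literal from each of them forms a path. Assignments with a single true class serve to compare the
nodes of that class with `R`, to find a node with a child of its own class, and to find a literal
that has no partner in another selected copy. Assignments whose true classes form an initial segment
test the order between a node and its children. `Verified.solvable` and `passes_of_model` are the
two directions of this translation.

The checks need one pass over the input and the certificates, from right to left, with finitely many
stacks and flags. The pass is a stack program, and `computableInPolyTime` compiles stack programs to
Turing machines. Its behaviour is described by a partial parser (`encode_step`, `encode_stepInput`,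
`verifier_eq_true`). The invariant `Parser.Valid` shows that an accepted certificate consists of
annotated copies of the input clauses, and `read_copies` with `readInput_eq` shows that the intended
certificates are read. `mem_solvingLanguage_of_verifier` and `exists_certificate` combine these
facts. -/

namespace StackProgram

/-! ### Stack programs and their compilation to polynomial-time Turing machines -/

open StateTransition

/-- Pop the top symbol of `src`, update the control with it, and push it on `dst` if there is one. -/
structure Move (K G Q : Type) where
  src : K
  dst : Option K
  upd : Q → Option G → Q

/-- Commands for a machine with finite control `Q` and stacks indexed by `K`. A loop repeats its
moves as long as the top symbol of the stack `k` satisfies `cont`. -/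
inductive Cmd (K G Q : Type)
  | push (k : K) (f : Q → G)
  | upd (f : Q → Q)
  | move (m : Move K G Q)
  | loop (k : K) (cont : G → Bool) (body : List (Move K G Q))

variable {K G Q I : Type} [DecidableEq K]

/-- A control state and the contents of the stacks. -/
abbrev State (K G Q : Type) := Q × (K → List G)

namespace Move

def run (m : Move K G Q) (s : State K G Q) : State K G Q :=
  (m.upd s.1 (s.2 m.src).head?,
    match m.dst, (s.2 m.src).head? with
    | some k, some g =>
      Function.update (Function.update s.2 m.src (s.2 m.src).tail) k
        (g :: (Function.update s.2 m.src (s.2 m.src).tail) k)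
    | _, _ => Function.update s.2 m.src (s.2 m.src).tail)

end Move

def runMoves (l : List (Move K G Q)) (s : State K G Q) : State K G Q :=
  l.foldl (fun s m => m.run s) s

/-- The natural number is fuel. `Cmd.run` supplies the height of the stack `k`, which is enough for
a well-formed loop because every round lowers that height. -/
def loopRun (k : K) (cont : G → Bool) (body : List (Move K G Q)) :
    ℕ → State K G Q → State K G Q
  | 0, s => s
  | n + 1, s =>
    if (s.2 k).head?.any cont then loopRun k cont body n (runMoves body s) else s

namespace Cmd

def run : Cmd K G Q → State K G Q → State K G Q
  | push k f, s => (s.1, Function.update s.2 k (f s.1 :: s.2 k))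
  | upd f, s => (f s.1, s.2)
  | move m, s => m.run s
  | loop k cont body, s => loopRun k cont body (s.2 k).length s

/-- The loop stack is popped first in every round and never pushed on. -/
def WellFormed : Cmd K G Q → Prop
  | loop k _ body => body.head?.any (fun m => m.src = k) = true ∧ ∀ m ∈ body, m.dst ≠ some k
  | _ => True

end Cmd

def runCmds (l : List (Cmd K G Q)) (s : State K G Q) : State K G Q :=
  l.foldl (fun s c => c.run s) s

/-- Run the program of every symbol of `w`, from right to left, and then the final program. -/
def exec (prog : Option I → List (Cmd K G Q)) (q₀ : Q) (w : List I) : State K G Q :=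
  runCmds (prog none) (w.foldr (fun a s => runCmds (prog (some a)) s) (q₀, fun _ => []))

/-! ### Invariants of the control -/

/-- A property of the control that no command destroys. -/
def Cmd.Keeps (P : Q → Prop) : Cmd K G Q → Prop
  | .push _ _ => True
  | .upd f => ∀ q, P q → P (f q)
  | .move m => ∀ q x, P q → P (m.upd q x)
  | .loop _ _ body => ∀ m ∈ body, ∀ q x, P q → P (m.upd q x)

theorem runMoves_keeps {P : Q → Prop} {l : List (Move K G Q)}
    (h : ∀ m ∈ l, ∀ q x, P q → P (m.upd q x)) (s : State K G Q) (hs : P s.1) :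
    P (runMoves l s).1 := by
  induction l generalizing s with
  | nil => exact hs
  | cons m l ih =>
    exact ih (fun m' hm' => h m' (List.mem_cons_of_mem _ hm')) _
      (h m List.mem_cons_self _ _ hs)

theorem loopRun_keeps {P : Q → Prop} {k : K} {cont : G → Bool} {l : List (Move K G Q)}
    (h : ∀ m ∈ l, ∀ q x, P q → P (m.upd q x)) (n : ℕ) (s : State K G Q) (hs : P s.1) :
    P (loopRun k cont l n s).1 := by
  induction n generalizing s with
  | zero => exact hs
  | succ n ih =>
    unfold loopRun
    split
    · exact ih _ (runMoves_keeps h s hs)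
    · exact hs

theorem runCmds_keeps {P : Q → Prop} {l : List (Cmd K G Q)} (h : ∀ c ∈ l, c.Keeps P)
    (s : State K G Q) (hs : P s.1) : P (runCmds l s).1 := by
  induction l generalizing s with
  | nil => exact hs
  | cons c l ih =>
    refine ih (fun c' hc' => h c' (List.mem_cons_of_mem _ hc')) _ ?_
    have hc := h c List.mem_cons_self
    cases c with
    | push k f => exact hs
    | upd f => exact hc _ hs
    | move m => exact hc _ _ hs
    | loop k cont body => exact loopRun_keeps hc _ _ hs

/-! ### Sizes -/

section Size

variable [Fintype K]

/-- The total length of all stacks. -/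
def size (S : K → List G) : ℕ := ∑ k, (S k).length

/-- The additive form avoids truncated subtraction. -/
theorem size_update (S : K → List G) (k : K) (l : List G) :
    size (Function.update S k l) + (S k).length = size S + l.length := by
  unfold size
  have h1 := Finset.add_sum_erase Finset.univ (fun j => (S j).length) (Finset.mem_univ k)
  have h2 := Finset.add_sum_erase Finset.univ
    (fun j => (Function.update S k l j).length) (Finset.mem_univ k)
  have h3 : ∑ j ∈ Finset.univ.erase k, (Function.update S k l j).length =
      ∑ j ∈ Finset.univ.erase k, (S j).length := by
    refine Finset.sum_congr rfl fun j hj => ?_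
    rw [Function.update_of_ne (Finset.ne_of_mem_erase hj)]
  simp only [Function.update_self] at h2
  omega

theorem size_update_tail (S : K → List G) (k : K) :
    size (Function.update S k (S k).tail) + ((S k).head?.toList).length = size S := by
  have := size_update S k (S k).tail
  cases h : S k <;> simp [h] at this ⊢ <;> omega

theorem size_move_le (m : Move K G Q) (s : State K G Q) : size (m.run s).2 ≤ size s.2 := by
  have h1 := size_update_tail s.2 m.src
  unfold Move.run
  rcases hd : m.dst with _ | k
  · simp only; omega
  · rcases hh : (s.2 m.src).head? with _ | g
    · simp only; omega
    · have h2 := size_update (Function.update s.2 m.src (s.2 m.src).tail) k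
        (g :: (Function.update s.2 m.src (s.2 m.src).tail) k)
      simp only [hh, Option.toList_some, List.length_cons] at h1 h2 ⊢
      omega

theorem size_runMoves_le (l : List (Move K G Q)) (s : State K G Q) :
    size (runMoves l s).2 ≤ size s.2 := by
  induction l generalizing s with
  | nil => exact le_rfl
  | cons m l ih => exact (ih _).trans (size_move_le m s)

theorem size_loopRun_le (k : K) (cont : G → Bool) (body : List (Move K G Q)) (n : ℕ)
    (s : State K G Q) : size (loopRun k cont body n s).2 ≤ size s.2 := by
  induction n generalizing s with
  | zero => exact le_rfl
  | succ n ih =>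
    unfold loopRun
    split
    · exact (ih _).trans (size_runMoves_le _ s)
    · exact le_rfl

/-- A move pushes only a symbol that it has just popped, so loops never increase the total size and
only `push` adds a cell. This linear growth is what keeps the running time polynomial. -/
theorem size_cmd_le (c : Cmd K G Q) (s : State K G Q) : size (c.run s).2 ≤ size s.2 + 1 := by
  cases c with
  | push k f =>
    have := size_update s.2 k (f s.1 :: s.2 k)
    simp only [List.length_cons] at this
    simp only [Cmd.run]
    omega
  | upd f => exact Nat.le_succ _
  | move m => exact (size_move_le m s).trans (Nat.le_succ _)
  | loop k cont body => exact (size_loopRun_le _ _ _ _ s).trans (Nat.le_succ _)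

theorem size_runCmds_le (l : List (Cmd K G Q)) (s : State K G Q) :
    size (runCmds l s).2 ≤ size s.2 + l.length := by
  induction l generalizing s with
  | nil => exact le_rfl
  | cons c l ih =>
    have h1 := ih (c.run s)
    have h2 := size_cmd_le c s
    simp only [List.length_cons]
    change size (runCmds l (c.run s)).2 ≤ _
    omega

omit [DecidableEq K] in
theorem length_le_size (S : K → List G) (k : K) : (S k).length ≤ size S :=
  Finset.single_le_sum (f := fun k => (S k).length) (fun _ _ => Nat.zero_le _) (Finset.mem_univ k)

end Size

theorem length_move_le {k : K} {m : Move K G Q} (hm : m.dst ≠ some k) (s : State K G Q) :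
    ((m.run s).2 k).length ≤ (s.2 k).length := by
  have key : ∀ S : K → List G, ((Function.update S m.src (S m.src).tail) k).length ≤
      (S k).length := by
    intro S
    by_cases hk : k = m.src
    · subst hk; simp
    · rw [Function.update_of_ne hk]
  unfold Move.run
  rcases hd : m.dst with _ | j
  · exact key _
  · have hj : k ≠ j := fun e => hm (by rw [hd, e])
    rcases (s.2 m.src).head? with _ | g
    · exact key _
    · simp only
      rw [Function.update_of_ne hj]
      exact key _

theorem length_runMoves_le {k : K} {l : List (Move K G Q)} (h : ∀ m ∈ l, m.dst ≠ some k)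
    (s : State K G Q) : ((runMoves l s).2 k).length ≤ (s.2 k).length := by
  induction l generalizing s with
  | nil => exact le_rfl
  | cons m l ih =>
    exact (ih (fun m' hm' => h m' (List.mem_cons_of_mem _ hm')) _).trans
      (length_move_le (h m List.mem_cons_self) s)

/-- The first move pops the loop stack, which is nonempty by the loop condition, and no move of the
body pushes on it. -/
theorem length_loop_body_lt {k : K} {cont : G → Bool} {body : List (Move K G Q)}
    (h : (Cmd.loop k cont body).WellFormed) (s : State K G Q) (hs : (s.2 k).head?.any cont) :
    ((runMoves body s).2 k).length < (s.2 k).length := by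
  obtain ⟨h1, h2⟩ := h
  cases body with
  | nil => simp at h1
  | cons m l =>
    simp only [List.head?_cons, Option.any_some, decide_eq_true_eq] at h1
    refine lt_of_le_of_lt
      (length_runMoves_le (fun m' hm' => h2 m' (List.mem_cons_of_mem _ hm')) (m.run s)) ?_
    have hm := h2 m List.mem_cons_self
    subst h1
    cases hsk : s.2 m.src with
    | nil => simp [hsk] at hs
    | cons g t =>
      unfold Move.run
      rcases hd : m.dst with _ | j
      · simp [hsk]
      · have hj : m.src ≠ j := fun e => hm (by rw [hd, e])
        simp [hsk, Function.update_of_ne hj]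

/-! ### The Turing machine -/

/-- The stacks of the machine. -/
inductive Port (K : Type)
  | input
  | rev
  | out
  | work (k : K)
  deriving DecidableEq, Fintype

/-- The stack alphabets of the machine. -/
abbrev Port.Alphabet (I G : Type) : Port K → Type
  | input => I
  | rev => I
  | out => Bool
  | work _ => G

/-- The labels of the machine; `L` bounds the lengths of the programs. -/
inductive Lab (I : Type) (L : ℕ)
  | pour
  | fetch
  | cmd (a : Option I) (i : Fin (L + 1))
  | clear
  deriving Fintype

/-- The label that follows the program of a symbol. -/
def Lab.after {I : Type} (L : ℕ) : Option I → Lab I L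
  | some _ => .fetch
  | none => .clear

/-- The local variables: control state, symbol in transit, current input symbol. -/
abbrev Var (G Q I : Type) := Q × Option G × Option I

abbrev TMStmt (K G Q I : Type) (L : ℕ) :=
  Turing.TM2.Stmt (Port.Alphabet (K := K) I G) (Lab I L) (Var G Q I)

section Machine

variable [Inhabited G] [Inhabited I] {L : ℕ}

/-- The popped symbol waits in the second local variable until it is pushed. This slot is `none`
again at the end, so that commands can be composed. -/
def moveStmt (m : Move K G Q) (next : TMStmt K G Q I L) : TMStmt K G Q I L :=
  match m.dst with
  | none => .pop (.work m.src) (fun v (x : Option G) => (m.upd v.1 x, none, v.2.2)) next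
  | some k => .pop (.work m.src) (fun v (x : Option G) => (m.upd v.1 x, x, v.2.2)) <|
      .branch (fun v => v.2.1.isSome)
        (.push (.work k) (fun v => (v.2.1.getD default : G)) <|
          .load (fun v => (v.1, none, v.2.2)) next)
        (.load (fun v => (v.1, none, v.2.2)) next)

def movesStmt (l : List (Move K G Q)) (next : TMStmt K G Q I L) : TMStmt K G Q I L :=
  l.foldr moveStmt next

def cmdStmt (c : Cmd K G Q) (self next : Lab I L) : TMStmt K G Q I L :=
  match c with
  | .push k f => .push (.work k) (fun v => (f v.1 : G)) <| .goto fun _ => next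
  | .upd f => .load (fun v => (f v.1, v.2)) <| .goto fun _ => next
  | .move m => moveStmt m <| .goto fun _ => next
  | .loop k cont body =>
    .peek (.work k) (fun v (x : Option G) => (v.1, x, v.2.2)) <|
      .branch (fun v => v.2.1.any cont)
        (.load (fun v => (v.1, none, v.2.2)) <| movesStmt body <| .goto fun _ => self)
        (.load (fun v => (v.1, none, v.2.2)) <| .goto fun _ => next)

/-- Pop all stacks of the list, remembering whether a symbol was found. -/
def popAll (l : List K) (next : TMStmt K G Q I L) : TMStmt K G Q I L :=
  l.foldr (fun k st =>
    .pop (.work k) (fun v (x : Option G) => (v.1, v.2.1.or x, v.2.2)) st) next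

/-- `pour` reverses the input because `exec` consumes it from the right. `clear` is needed because
the halting configuration has every stack except the output empty and the local variables reset. -/
noncomputable def machine [Fintype K] (prog : Option I → List (Cmd K G Q)) (q₀ : Q)
    (out : Q → Bool) : Lab I L → TMStmt K G Q I L
  | .pour => .pop .input (fun v (x : Option I) => (v.1, v.2.1, x)) <|
      .branch (fun v => v.2.2.isSome)
        (.push .rev (fun v => (v.2.2.getD default : I)) <| .goto fun _ => .pour)
        (.goto fun _ => .fetch)
  | .fetch => .pop .rev (fun v (x : Option I) => (v.1, v.2.1, x)) <|
      .goto fun v => .cmd v.2.2 0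
  | .cmd a i => match (prog a)[i.1]? with
    | some c => cmdStmt c (.cmd a i) (.cmd a (Fin.ofNat (L + 1) (i.1 + 1)))
    | none => .goto fun _ => .after L a
  | .clear => popAll Finset.univ.toList <|
      .branch (fun v => v.2.1.isSome)
        (.load (fun v => (v.1, none, v.2.2)) <| .goto fun _ => .clear)
        (.push .out (fun v => (out v.1 : Bool)) <| .load (fun _ => (q₀, none, none)) .halt)

/-- The contents of all stacks of the machine. -/
def contents (inp rev : List I) (out : List Bool) (S : K → List G) :
    ∀ p : Port K, List (Port.Alphabet I G p)
  | .input => inp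
  | .rev => rev
  | .out => out
  | .work k => S k

theorem update_stacks_work (inp rev : List I) (out : List Bool) (S : K → List G) (k : K)
    (l : List G) :
    Function.update (contents inp rev out S) (.work k) l =
      contents inp rev out (Function.update S k l) := by
  funext p
  cases p with
  | work j =>
    by_cases h : j = k
    · subst h; simp [contents]
    · rw [Function.update_of_ne (by simpa using h)]
      simp [contents, Function.update_of_ne h]
  | _ => rw [Function.update_of_ne (by simp)]; rfl

omit [Inhabited G] [Inhabited I] in
theorem update_stacks_input (inp inp' rev : List I) (out : List Bool) (S : K → List G) :
    Function.update (contents inp rev out S) .input inp' = contents inp' rev out S := by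
  funext p
  cases p with
  | input => rw [Function.update_self]; rfl
  | _ => rw [Function.update_of_ne (by simp)]; rfl

omit [Inhabited G] [Inhabited I] in
theorem update_stacks_rev (inp rev rev' : List I) (out : List Bool) (S : K → List G) :
    Function.update (contents inp rev out S) .rev rev' = contents inp rev' out S := by
  funext p
  cases p with
  | rev => rw [Function.update_self]; rfl
  | _ => rw [Function.update_of_ne (by simp)]; rfl

omit [Inhabited G] [Inhabited I] in
theorem update_stacks_out (inp rev : List I) (out out' : List Bool) (S : K → List G) :
    Function.update (contents inp rev out S) .out out' = contents inp rev out' S := by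
  funext p
  cases p with
  | out => rw [Function.update_self]; rfl
  | _ => rw [Function.update_of_ne (by simp)]; rfl

open Turing.TM2 in
theorem stepAux_moveStmt (m : Move K G Q) (next : TMStmt K G Q I L) (s : State K G Q)
    (tok : Option I) (inp rev : List I) (out : List Bool) :
    stepAux (moveStmt m next) (s.1, none, tok) (contents inp rev out s.2) =
      stepAux next ((m.run s).1, none, tok) (contents inp rev out (m.run s).2) := by
  unfold moveStmt Move.run
  rcases m.dst with _ | k
  · simp only [stepAux, update_stacks_work]
    rfl
  · simp only [stepAux, update_stacks_work]
    cases h : s.2 m.src with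
    | nil => simp [contents, h]
    | cons g t =>
      simp only [contents, h, List.head?_cons, Option.isSome_some, cond_true, Option.getD_some,
        List.tail_cons, update_stacks_work]

open Turing.TM2 in
theorem stepAux_movesStmt (l : List (Move K G Q)) (next : TMStmt K G Q I L) (s : State K G Q)
    (tok : Option I) (inp rev : List I) (out : List Bool) :
    stepAux (movesStmt l next) (s.1, none, tok) (contents inp rev out s.2) =
      stepAux next ((runMoves l s).1, none, tok) (contents inp rev out (runMoves l s).2) := by
  induction l generalizing s with
  | nil => rfl
  | cons m l ih =>
    rw [movesStmt, List.foldr_cons, stepAux_moveStmt]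
    exact ih _

/-! ### Reachability with a bound on the number of steps -/

/-- `b` is reached from `a` in at most `t` steps. -/
def ReachIn {C : Type*} (f : C → Option C) (t : ℕ) (a b : C) : Prop :=
  ∃ n ≤ t, (flip bind f)^[n] (some a) = some b

theorem ReachIn.refl {C : Type*} {f : C → Option C} (a : C) : ReachIn f 0 a a := ⟨0, le_rfl, rfl⟩

theorem ReachIn.single {C : Type*} {f : C → Option C} {a b : C} (h : f a = some b) :
    ReachIn f 1 a b := ⟨1, le_rfl, h⟩

theorem ReachIn.trans {C : Type*} {f : C → Option C} {t u : ℕ} {a b c : C}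
    (h₁ : ReachIn f t a b) (h₂ : ReachIn f u b c) : ReachIn f (t + u) a c := by
  obtain ⟨n, hn, h₁⟩ := h₁
  obtain ⟨m, hm, h₂⟩ := h₂
  exact ⟨m + n, by omega, by rw [Function.iterate_add_apply, h₁, h₂]⟩

theorem ReachIn.mono {C : Type*} {f : C → Option C} {t u : ℕ} {a b : C}
    (h : ReachIn f t a b) (htu : t ≤ u) : ReachIn f u a b := by
  obtain ⟨n, hn, h⟩ := h
  exact ⟨n, hn.trans htu, h⟩

variable [Fintype K] (prog : Option I → List (Cmd K G Q)) (q₀ : Q) (out : Q → Bool)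

/-- The configurations of the machine between two commands. -/
abbrev cfg (l : Lab I L) (s : State K G Q) (tok : Option I) (inp rev : List I) :
    Turing.TM2.Cfg (Port.Alphabet (K := K) I G) (Lab I L) (Var G Q I) :=
  ⟨some l, (s.1, none, tok), contents inp rev [] s.2⟩

noncomputable abbrev mstep : Turing.TM2.Cfg (Port.Alphabet (K := K) I G) (Lab I L) (Var G Q I) →
    Option (Turing.TM2.Cfg (Port.Alphabet (K := K) I G) (Lab I L) (Var G Q I)) :=
  Turing.TM2.step (machine (L := L) prog q₀ out)

open Turing.TM2

/-- All moves of a round belong to one statement, hence to one machine step; one more step leaves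
the loop. -/
theorem reach_loop {k : K} {cont : G → Bool} {body : List (Move K G Q)}
    (hwf : (Cmd.loop k cont body).WellFormed) {l next : Lab I L} {tok : Option I}
    (hl : machine prog q₀ out l = cmdStmt (.loop k cont body) l next) (rev : List I) :
    ∀ (n : ℕ) (s : State K G Q), (s.2 k).length ≤ n →
      ReachIn (mstep (L := L) prog q₀ out) (n + 1) (cfg l s tok [] rev)
        (cfg next (loopRun k cont body n s) tok [] rev) := by
  intro n
  have hstep : ∀ s : State K G Q, mstep prog q₀ out (cfg l s tok [] rev) =
      some (if (s.2 k).head?.any cont then cfg l (runMoves body s) tok [] rev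
        else cfg next s tok [] rev) := by
    intro s
    simp only [mstep, step, hl, cmdStmt, stepAux]
    have : (contents [] rev [] s.2 (.work k) : List G) = s.2 k := rfl
    split_ifs with h
    · simp only [contents, h, cond_true]
      congr 1
      exact stepAux_movesStmt body _ s tok [] rev []
    · simp only [contents, h, cond_false]
  induction n with
  | zero =>
    intro s hs
    have hk : s.2 k = [] := List.length_eq_zero_iff.1 (Nat.le_zero.1 hs)
    refine ReachIn.single ?_
    rw [hstep, if_neg (by simp [hk])]
    rfl
  | succ n ih =>
    intro s hs
    unfold loopRun
    by_cases h : (s.2 k).head?.any cont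
    · rw [if_pos h]
      have hlt := length_loop_body_lt hwf s h
      refine ((ReachIn.single ?_).trans (ih (runMoves body s) (by omega))).mono (by omega)
      rw [hstep, if_pos h]
    · rw [if_neg h]
      refine (ReachIn.single ?_).mono (by omega)
      rw [hstep, if_neg h]

theorem reach_cmd {c : Cmd K G Q} (hwf : c.WellFormed) {l next : Lab I L} {tok : Option I}
    (hl : machine prog q₀ out l = cmdStmt c l next) (rev : List I) (s : State K G Q) :
    ReachIn (mstep (L := L) prog q₀ out) (size s.2 + 1) (cfg l s tok [] rev)
      (cfg next (c.run s) tok [] rev) := by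
  cases c with
  | push k f =>
    refine (ReachIn.single ?_).mono (by omega)
    simp only [mstep, step, hl, cmdStmt, stepAux, update_stacks_work]
    rfl
  | upd f =>
    refine (ReachIn.single ?_).mono (by omega)
    simp only [mstep, step, hl, cmdStmt, stepAux]
    rfl
  | move m =>
    refine (ReachIn.single ?_).mono (by omega)
    simp only [mstep, step, hl, cmdStmt, stepAux_moveStmt, stepAux]
    rfl
  | loop k cont body =>
    exact (reach_loop prog q₀ out hwf hl rev _ s le_rfl).mono
      (Nat.succ_le_succ (length_le_size s.2 k))

variable {prog}

/-- Each of the `n` remaining commands costs at most one more than the current size, and the size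
grows by at most one per command. -/
theorem reach_cmds (hwf : ∀ a, ∀ c ∈ prog a, c.WellFormed) (hL : ∀ a, (prog a).length ≤ L)
    (a : Option I) (rev : List I) (n : ℕ) :
    ∀ (i : ℕ) (s : State K G Q), i + n = (prog a).length →
      ReachIn (mstep (L := L) prog q₀ out) (n * (size s.2 + n))
        (cfg (.cmd a (Fin.ofNat (L + 1) i)) s a [] rev)
        (cfg (.cmd a (Fin.ofNat (L + 1) (prog a).length))
          (runCmds ((prog a).drop i) s) a [] rev) := by
  induction n with
  | zero =>
    intro i s hi
    rw [Nat.add_zero] at hi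
    subst hi
    rw [List.drop_length]
    exact (ReachIn.refl _).mono (by omega)
  | succ n ih =>
    intro i s hi
    have hlt : i < (prog a).length := by omega
    have hiL := hL a
    have hi' : (Fin.ofNat (L + 1) i).1 = i := by
      simp only [Fin.ofNat]; exact Nat.mod_eq_of_lt (by omega)
    rw [List.drop_eq_getElem_cons hlt]
    have h1 := reach_cmd prog q₀ out (tok := a) (rev := rev) (s := s)
      (hwf a _ (List.getElem_mem hlt))
      (l := .cmd a (Fin.ofNat (L + 1) i)) (next := .cmd a (Fin.ofNat (L + 1) (i + 1)))
      (by simp only [machine, hi']; rw [List.getElem?_eq_getElem hlt])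
    have h2 := ih (i + 1) ((prog a)[i].run s) (by omega)
    have h3 := size_cmd_le (prog a)[i] s
    refine (h1.trans h2).mono ?_
    nlinarith

theorem reach_token (hwf : ∀ a, ∀ c ∈ prog a, c.WellFormed) (hL : ∀ a, (prog a).length ≤ L)
    (a : Option I) (rev : List I) (s : State K G Q) :
    ReachIn (mstep (L := L) prog q₀ out) (L * (size s.2 + L) + 1)
      (cfg (.cmd a 0) s a [] rev)
      (cfg (Lab.after L a) (runCmds (prog a) s) a [] rev) := by
  have h := reach_cmds q₀ out hwf hL a rev (prog a).length 0 s (by omega)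
  have hlen := hL a
  have h2 : ReachIn (mstep (L := L) prog q₀ out) 1
      (cfg (.cmd a (Fin.ofNat (L + 1) (prog a).length)) (runCmds (prog a) s) a [] rev)
      (cfg (Lab.after L a) (runCmds (prog a) s) a [] rev) := by
    refine ReachIn.single ?_
    have hi' : (Fin.ofNat (L + 1) (prog a).length).1 = (prog a).length := by
      simp only [Fin.ofNat]; exact Nat.mod_eq_of_lt (by omega)
    simp only [mstep, step, machine, hi']
    rw [List.getElem?_eq_none le_rfl]
    rfl
  rw [List.drop_zero] at h
  refine (h.trans h2).mono ?_
  have : (prog a).length * (size s.2 + (prog a).length) ≤ L * (size s.2 + L) := by gcongr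
  omega

/-- `B` bounds the size of the stacks whenever a symbol is fetched. The summand `2` pays for
fetching the symbol and for leaving its program. -/
theorem reach_fold (hwf : ∀ a, ∀ c ∈ prog a, c.WellFormed) (hL : ∀ a, (prog a).length ≤ L)
    (w : List I) (B : ℕ) (s : State K G Q) (tok : Option I) (hB : size s.2 + w.length * L ≤ B) :
    ReachIn (mstep (L := L) prog q₀ out) ((w.length + 1) * (L * (B + L) + 2))
      (cfg .fetch s tok [] w)
      (cfg .clear (runCmds (prog none) (w.foldl (fun s a => runCmds (prog (some a)) s) s))
        none [] []) := by
  have hfetch : ∀ (s : State K G Q) (tok : Option I) (w : List I),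
      ReachIn (mstep (L := L) prog q₀ out) 1 (cfg .fetch s tok [] w)
        (cfg (.cmd w.head? 0) s w.head? [] w.tail) := by
    intro s tok w
    refine ReachIn.single ?_
    simp only [mstep, step, machine, stepAux, update_stacks_rev]
    rfl
  induction w generalizing s tok with
  | nil =>
    have h := (hfetch s tok []).trans (reach_token q₀ out hwf hL none [] s)
    refine h.mono ?_
    have : L * (size s.2 + L) ≤ L * (B + L) := by
      have : size s.2 ≤ B := by omega
      gcongr
    simp only [List.length_nil]
    omega
  | cons a w ih =>
    have h := (hfetch s tok (a :: w)).trans (reach_token q₀ out hwf hL (some a) w s)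
    have hsz := size_runCmds_le (prog (some a)) s
    have hl := hL (some a)
    have h2 := ih (runCmds (prog (some a)) s) (some a) (by
      simp only [List.length_cons, Nat.succ_mul] at hB; omega)
    refine (h.trans h2).mono ?_
    have : L * (size s.2 + L) ≤ L * (B + L) := by
      have : size s.2 ≤ B := by omega
      gcongr
    simp only [List.length_cons]
    rw [Nat.succ_mul (w.length + 1)]
    omega

theorem reach_pour (w r : List I) (s : State K G Q) (tok : Option I) :
    ∃ tok', ReachIn (mstep (L := L) prog q₀ out) (w.length + 1)
      (cfg .pour s tok w r) (cfg .fetch s tok' [] (w.reverse ++ r)) := by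
  induction w generalizing r tok with
  | nil =>
    refine ⟨none, ReachIn.single ?_⟩
    simp only [mstep, step, machine, stepAux, update_stacks_input]
    simp [contents]
  | cons a w ih =>
    obtain ⟨tok', h⟩ := ih (a :: r) (some a)
    refine ⟨tok', ?_⟩
    rw [List.reverse_cons, List.append_assoc]
    refine ((ReachIn.single ?_).trans h).mono (by simp; omega)
    simp only [mstep, step, machine, stepAux, update_stacks_input]
    simp only [contents, List.head?_cons, Option.isSome_some, cond_true, update_stacks_rev,
      List.tail_cons, Option.getD_some]

/-- The slot `x'` is filled exactly when something was found, which tells `clear` whether another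
round is needed. -/
theorem stepAux_popAll (next : TMStmt K G Q I L) (l : List K) (hl : l.Nodup) (q : Q)
    (x : Option G) (tok : Option I) (S : K → List G) :
    ∃ x' : Option G, (x'.isSome ↔ x.isSome ∨ ∃ k ∈ l, S k ≠ []) ∧
      stepAux (popAll l next) (q, x, tok) (contents [] [] [] S) =
        stepAux next (q, x', tok)
          (contents [] [] [] fun k => if k ∈ l then (S k).tail else S k) := by
  induction l generalizing x S with
  | nil => exact ⟨x, by simp, by simp [popAll]⟩
  | cons k l ih =>
    obtain ⟨hk, hl⟩ := List.nodup_cons.1 hl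
    obtain ⟨x', h1, h2⟩ := ih hl (x.or (S k).head?) (Function.update S k (S k).tail)
    refine ⟨x', h1.trans ?_, ?_⟩
    · rw [Option.isSome_or, Bool.or_eq_true, or_assoc]
      refine or_congr_right ?_
      have h3 : ∀ j ∈ l, (Function.update S k (S k).tail j ≠ [] ↔ S j ≠ []) := by
        intro j hj
        rw [Function.update_of_ne (fun e => hk (by rw [← e]; exact hj))]
      have h4 : (S k).head?.isSome ↔ S k ≠ [] := by cases S k <;> simp
      rw [h4]
      constructor
      · rintro (h | ⟨j, hj, h⟩)
        · exact ⟨k, List.mem_cons_self, h⟩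
        · exact ⟨j, List.mem_cons_of_mem _ hj, (h3 j hj).1 h⟩
      · rintro ⟨j, hj, h⟩
        rcases List.mem_cons.1 hj with rfl | hj
        · exact Or.inl h
        · exact Or.inr ⟨j, hj, (h3 j hj).2 h⟩
    · simp only [popAll, List.foldr_cons, stepAux, update_stacks_work]
      refine h2.trans ?_
      congr 2
      funext j
      by_cases hj : j = k
      · subst hj; simp [hk]
      · simp [hj, Function.update_of_ne hj]

theorem reach_clear (q : Q) (n : ℕ) (S : K → List G) (hS : ∀ k, (S k).length ≤ n)
    (tok : Option I) :
    ReachIn (mstep (L := L) prog q₀ out) (n + 1) (cfg .clear (q, S) tok [] [])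
      ⟨none, (q₀, none, none), contents [] [] [out q] fun _ => []⟩ := by
  induction n generalizing S with
  | zero =>
    obtain rfl : S = fun _ => [] := funext fun k => by simpa using hS k
    refine ReachIn.single ?_
    obtain ⟨x', h1, h2⟩ := stepAux_popAll (K := K) (G := G) (Q := Q) (I := I) (L := L)
      (.branch (fun v => v.2.1.isSome)
        (.load (fun v => (v.1, none, v.2.2)) <| .goto fun _ => .clear)
        (.push .out (fun v => (out v.1 : Bool)) <| .load (fun _ => (q₀, none, none)) .halt))
      (Finset.univ : Finset K).toList (Finset.nodup_toList _) q none tok (fun _ => [])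
    have hx : x' = none := by
      rw [← Option.not_isSome_iff_eq_none, h1]; simp
    subst hx
    simp only [mstep, step, machine, h2]
    simp only [stepAux, Option.isSome_none, cond_false, update_stacks_out]
    simp [contents]
  | succ n ih =>
    obtain ⟨x', h1, h2⟩ := stepAux_popAll (K := K) (G := G) (Q := Q) (I := I) (L := L)
      (.branch (fun v => v.2.1.isSome)
        (.load (fun v => (v.1, none, v.2.2)) <| .goto fun _ => .clear)
        (.push .out (fun v => (out v.1 : Bool)) <| .load (fun _ => (q₀, none, none)) .halt))
      (Finset.univ : Finset K).toList (Finset.nodup_toList _) q none tok S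
    have htail : (fun k => if k ∈ (Finset.univ : Finset K).toList then (S k).tail else S k) =
        fun k => (S k).tail := by simp
    rw [htail] at h2
    by_cases hx : x'.isSome
    · refine ((ReachIn.single ?_).trans (ih (fun k => (S k).tail) fun k => ?_)).mono
        (by omega : 1 + (n + 1) ≤ n + 1 + 1)
      · simp only [mstep, step, machine, h2, stepAux, hx, cond_true]
      · have := hS k
        simp only [List.length_tail]
        omega
    · have hS' : S = fun _ => [] := by
        funext k
        by_contra hk
        exact hx (h1.2 (Or.inr ⟨k, by simp, hk⟩))
      refine (ReachIn.single ?_).mono (by omega : 1 ≤ n + 1 + 1)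
      subst hS'
      simp only [mstep, step, machine, h2, Bool.not_eq_true] at hx ⊢
      simp only [stepAux, hx, cond_false, update_stacks_out]
      simp [contents]

end Machine

/-- The decision procedure given by a stack program runs in polynomial time. -/
theorem computableInPolyTime [Fintype K] [Fintype G] [Fintype Q] [Fintype I] [Inhabited G]
    [Inhabited I] {α : Type} (ea : α → List I) (prog : Option I → List (Cmd K G Q)) (q₀ : Q)
    (out : Q → Bool) (hwf : ∀ a, ∀ c ∈ prog a, c.WellFormed) :
    Nonempty (Turing.TM2ComputableInPolyTime ea Computability.encodeBool
      fun x => out (exec prog q₀ (ea x)).1) := by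
  obtain ⟨L, hL⟩ : ∃ L, ∀ a, (prog a).length ≤ L :=
    ⟨Finset.univ.sup fun a => (prog a).length, fun a =>
      Finset.le_sup (f := fun a => (prog a).length) (Finset.mem_univ a)⟩
  let tm : Turing.FinTM2 :=
    { K := Port K, k₀ := .input, k₁ := .out, Γ := Port.Alphabet I G, Λ := Lab I L,
      main := .pour, σ := Var G Q I, initialState := (q₀, none, none),
      Γk₀Fin := inferInstanceAs (Fintype I), m := machine prog q₀ out }
  -- The three summands bound pouring, the programs of all symbols together with the final one, and
  -- clearing. The size never exceeds `L` times the number of programs run.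
  let bound : Polynomial ℕ :=
    (.X + 1) + (.X + 1) * (.C L * (.X * .C L + .C L) + 2) + (.X * .C L + .C L + 1)
  have key : ∀ w : List I, ReachIn (mstep (L := L) prog q₀ out) (bound.eval w.length)
      (cfg .pour (q₀, fun _ => []) none w [])
      ⟨none, (q₀, none, none), contents [] [] [out (exec prog q₀ w).1] fun _ => []⟩ := by
    intro w
    obtain ⟨tok, h1⟩ := reach_pour (L := L) (prog := prog) q₀ out w [] (q₀, fun _ => []) none
    have hfold : ∀ (l : List I) (s : State K G Q),
        size (l.foldl (fun s a => runCmds (prog (some a)) s) s).2 ≤ size s.2 + l.length * L := by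
      intro l
      induction l with
      | nil => intro s; simp
      | cons a l ih =>
        intro s
        have h := ih (runCmds (prog (some a)) s)
        have h' := size_runCmds_le (prog (some a)) s
        have h'' := hL (some a)
        rw [List.foldl_cons, List.length_cons, Nat.succ_mul]
        omega
    have hinit : size (fun _ : K => ([] : List G)) = 0 := by simp [size]
    have h2 := reach_fold (L := L) q₀ out hwf hL (w.reverse ++ []) (w.length * L)
      (q₀, fun _ => []) tok (by simp [hinit])
    rw [List.append_nil, List.foldl_reverse] at h2
    have h3 := reach_clear (L := L) (prog := prog) q₀ out (exec prog q₀ w).1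
      (w.length * L + L) (exec prog q₀ w).2 (fun k => by
        refine (length_le_size _ k).trans ?_
        refine (size_runCmds_le _ _).trans (add_le_add ?_ (hL none))
        have := hfold w.reverse (q₀, fun _ => [])
        rw [List.foldl_reverse, List.length_reverse, hinit, zero_add] at this
        exact this) none
    rw [List.append_nil] at h1
    refine ((h1.trans h2).trans h3).mono ?_
    simp [bound]
  refine ⟨{ tm := tm, inputAlphabet := Equiv.refl I, outputAlphabet := Equiv.refl Bool,
            time := bound, outputsFun := fun x => ?_ }⟩
  have hkey := key (ea x)
  have hin : Turing.initList tm (List.map (Equiv.refl I).invFun (ea x)) =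
      cfg (L := L) (K := K) (G := G) .pour (q₀, fun _ => []) none (ea x) [] := by
    have : List.map (Equiv.refl I).invFun (ea x) = ea x := List.map_id _
    rw [this]
    unfold Turing.initList
    refine congrArg (Turing.TM2.Cfg.mk _ _) ?_
    funext p
    cases p <;> rfl
  have hout : Turing.haltList tm (List.map (Equiv.refl Bool).invFun
      (Computability.encodeBool (out (exec prog q₀ (ea x)).1))) =
      ⟨none, (q₀, none, none), contents [] [] [out (exec prog q₀ (ea x)).1] fun _ => []⟩ := by
    unfold Turing.haltList
    refine congrArg (Turing.TM2.Cfg.mk _ _) ?_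
    funext p
    cases p <;> rfl
  have hlen : (bound.eval (ea x).length) = bound.eval (ea x).length := rfl
  exact
    { steps := hkey.choose
      evals_in_steps := by
        rw [hin]
        refine hkey.choose_spec.2.trans ?_
        exact congrArg some hout.symm
      steps_le_m := hkey.choose_spec.1 }

end StackProgram

namespace MatrixEncoding

open StackProgram

/-! ## The verifier -/

/-- Kinds of syntax nodes; literals carry their polarity. -/
inductive NodeKind : Type
  | lit (positive : Bool)
  | fn
  | var
  deriving DecidableEq

/-- Kinds of stack frames. -/
inductive FrameKind : Type
  | lit
  | fn
  | var
  deriving DecidableEq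

instance : Fintype FrameKind := ⟨{.lit, .fn, .var}, fun x => by cases x <;> simp⟩

namespace NodeKind

def frame : NodeKind → FrameKind
  | lit _ => .lit
  | fn => .fn
  | var => .var

/-- The input symbol that opens a node. -/
def sym : NodeKind → Sym
  | lit p => .lit p
  | fn => .fn
  | var => .var

/-- The first symbol of the word of a node, in which the polarity of literals is ignored. -/
def opener : NodeKind → Sym
  | lit _ => .lit true
  | fn => .fn
  | var => .var

end NodeKind

/-- The alphabet of the work stacks. -/
inductive Cell : Type
  | sym (a : Sym)
  | unit
  | child (b : Bool)
  | frame (k : FrameKind) (b : Bool)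
  | truth (b : Bool)
  | tick

/-- The alphabet of the certificates. -/
inductive Cert : Type
  | sym (a : Sym)
  | unit
  | vclose
  | clause (isStart selected : Bool)
  | copy
  | entry (b : Bool) (x : Option Cell)

noncomputable instance Sym.decidableEq : DecidableEq Sym := Classical.decEq _
noncomputable instance Cell.decidableEq : DecidableEq Cell := Classical.decEq _

def Sym.code : Sym → Fin 7 × Bool
  | tick => (0, true)
  | clause b => (1, b)
  | lit b => (2, b)
  | var => (3, true)
  | fn => (4, true)
  | bit b => (5, b)
  | close => (6, true)

theorem Sym.code_injective : Function.Injective Sym.code := by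
  intro a b h
  cases a <;> cases b <;> simp_all [Sym.code]

noncomputable instance : Fintype Sym := Fintype.ofInjective _ Sym.code_injective

def Cell.code : Cell → Option (Sym ⊕ Bool ⊕ (FrameKind × Bool) ⊕ Bool ⊕ Bool)
  | sym a => some (.inl a)
  | unit => none
  | child b => some (.inr (.inl b))
  | frame k b => some (.inr (.inr (.inl (k, b))))
  | truth b => some (.inr (.inr (.inr (.inl b))))
  | tick => some (.inr (.inr (.inr (.inr true))))

theorem Cell.code_injective : Function.Injective Cell.code := by
  intro a b h
  cases a <;> cases b <;> simp_all [Cell.code]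

noncomputable instance : Fintype Cell := Fintype.ofInjective _ Cell.code_injective

def Cert.code : Cert → Option (Sym ⊕ Bool ⊕ (Bool × Bool) ⊕ Bool × Option Cell)
  | sym a => some (.inl a)
  | unit => none
  | vclose => some (.inr (.inl false))
  | copy => some (.inr (.inl true))
  | clause s t => some (.inr (.inr (.inl (s, t))))
  | entry b x => some (.inr (.inr (.inr (b, x))))

theorem Cert.code_injective : Function.Injective Cert.code := by
  intro a b h
  cases a <;> cases b <;> simp_all [Cert.code]

noncomputable instance : Fintype Cert := Fintype.ofInjective _ Cert.code_injective

instance : Inhabited Cell := ⟨.unit⟩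
instance : Inhabited (Sym ⊕ Cert ⊕ Cert) := ⟨.inl .tick⟩

/-- The work stacks. -/
inductive Stk : Type
  | bits
  | bitsRev
  | main
  | word
  | wordRev
  | text
  | textRev
  | copies
  | sels
  deriving DecidableEq

instance : Fintype Stk :=
  ⟨{.bits, .bitsRev, .main, .word, .wordRev, .text, .textRev, .copies, .sels},
    fun x => by cases x <;> simp⟩

/-- What the verifier expects next; certificates are read from right to left. -/
inductive Mode : Type
  | top
  | utop
  | args
  | uargs
  | name
  | vname
  | stuck
  deriving DecidableEq

instance : Fintype Mode :=
  ⟨{.top, .utop, .args, .uargs, .name, .vname, .stuck}, fun x => by cases x <;> simp⟩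

/-! ### Flags of the verifier -/

/-- What the verifier remembers about the nodes of the current clause. -/
structure BlockMonitor : Type where
  eq : Bool
  neq : Bool
  inverted : Bool
  looped : Bool
  varT : Bool
  varF : Bool
  pos : Bool
  neg : Bool
  sat : Bool

/-- What the verifier remembers about the clauses that it has read. -/
structure Monitor : Type where
  eq : Bool
  neq : Bool
  inverted : Bool
  looped : Bool
  viol : Bool
  seenP : Bool
  seenN : Bool
  needP : Bool
  needN : Bool
  falsified : Bool
  startHere : Bool
  start : Bool

namespace BlockMonitor

def init : BlockMonitor := ⟨false, false, false, false, false, false, false, false, false⟩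

/-- Function and literal nodes are treated alike. `eq` and `neq` expose two different words in one
true class, `looped` a true class with a true child, and `inverted` a false class with a true child.
-/
def updShared (b childT eq : Bool) (m : BlockMonitor) : BlockMonitor :=
  { m with
    eq := m.eq || (b && eq)
    neq := m.neq || (b && !eq)
    inverted := m.inverted || (!b && childT)
    looped := m.looped || (b && childT) }

/-- Account for a node whose class has truth value `b`; `childT` tells whether one of its children
has a true class, and `eq` whether its word is the guessed one. -/
def upd (b childT eq : Bool) : NodeKind → BlockMonitor → BlockMonitor
  | .var, m => { m with varT := m.varT || (eq && b), varF := m.varF || (eq && !b) }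
  | .fn, m => m.updShared b childT eq
  | .lit p, m =>
    { m.updShared b childT eq with
      pos := m.pos || (b && p)
      neg := m.neg || (b && !p)
      sat := m.sat || (b == p) }

def code (m : BlockMonitor) : Fin 9 → Bool :=
  ![m.eq, m.neq, m.inverted, m.looped, m.varT, m.varF, m.pos, m.neg, m.sat]

theorem code_injective : Function.Injective code := by
  rintro ⟨⟩ ⟨⟩ h
  have h' := fun i => congrFun h i
  simp only [Fin.forall_fin_succ, code] at h'
  simp at h'
  simp [h']

noncomputable instance : Fintype BlockMonitor := Fintype.ofInjective _ code_injective

end BlockMonitor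

namespace Monitor

def init : Monitor :=
  ⟨false, false, false, false, false, false, false, false, false, false, false, false⟩

/-- Account for a clause. -/
def upd (isStart selected : Bool) (m : BlockMonitor) (g : Monitor) : Monitor where
  eq := g.eq || m.eq
  neq := g.neq || m.neq
  inverted := g.inverted || m.inverted
  looped := g.looped || m.looped
  viol := g.viol || (m.varT && m.varF)
  seenP := g.seenP || (selected && m.pos)
  seenN := g.seenN || (selected && m.neg)
  -- A positive true literal of this clause serves every earlier request, since those come from
  -- other copies. Its own negative true literals may use only the copies read before or those still
  -- to come, so `seenP` is consulted in its old value.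
  needP := if selected then (g.needP && !m.pos) || (m.neg && !g.seenP) else g.needP
  needN := if selected then (g.needN && !m.neg) || (m.pos && !g.seenN) else g.needN
  falsified := g.falsified || (selected && !m.sat)
  startHere := g.startHere || (isStart && selected)
  start := g.start

/-- Account for the beginning of a copy. -/
def copy (g : Monitor) : Monitor := { g with start := g.startHere, startHere := false }

/-- Acceptance; `single` tells whether exactly one class is true, and `mono` whether the true
classes form an initial segment. -/
def ok (single mono : Bool) (g : Monitor) : Bool :=
  !(single && g.eq && g.neq) && !(single && g.looped) && !(mono && g.inverted) && !g.viol &&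
    !g.needP && !g.needN && g.falsified && g.start

def code (m : Monitor) : Fin 12 → Bool :=
  ![m.eq, m.neq, m.inverted, m.looped, m.viol, m.seenP, m.seenN, m.needP, m.needN, m.falsified,
    m.startHere, m.start]

theorem code_injective : Function.Injective code := by
  rintro ⟨⟩ ⟨⟩ h
  have h' := fun i => congrFun h i
  simp only [Fin.forall_fin_succ, code] at h'
  simp at h'
  simp [h']

noncomputable instance : Fintype Monitor := Fintype.ofInjective _ code_injective

end Monitor

/-- The finite control. -/
structure Ctl : Type where
  bad : Bool
  one : Bool
  many : Bool
  mono : Bool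
  mode : Mode
  first : Bool
  pend : Bool
  bit : Bool
  mism : Bool
  childT : Bool
  cur : Option Cell
  blk : BlockMonitor
  glb : Monitor

namespace Ctl

def code (q : Ctl) : (Fin 9 → Bool) × Mode × Option Cell × BlockMonitor × Monitor :=
  (![q.bad, q.one, q.many, q.mono, q.first, q.pend, q.bit, q.mism, q.childT], q.mode, q.cur, q.blk, q.glb)

theorem code_injective : Function.Injective code := by
  rintro ⟨⟩ ⟨⟩ h
  simp only [code, Prod.mk.injEq] at h
  obtain ⟨h1, h2⟩ := h
  have h' := fun i => congrFun h1 i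
  simp only [Fin.forall_fin_succ] at h'
  simp at h'
  simp [h', h2]

noncomputable instance : Fintype Ctl := Fintype.ofInjective _ code_injective

def init : Ctl :=
  ⟨false, false, false, true, .top, true, false, false, false, false, none, .init, .init⟩

def check (c : Bool) (q : Ctl) : Ctl := { q with bad := q.bad || !c }

def goto (f : Mode → Option Mode) (q : Ctl) : Ctl :=
  match f q.mode with
  | some m => { q with mode := m }
  | none => { q with bad := true }

end Ctl

namespace Mode

def unitStep : Mode → Option Mode
  | top => some utop
  | utop => some utop
  | args => some uargs
  | uargs => some uargs
  | _ => none

def closeStep : Mode → Option Mode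
  | top => some args
  | utop => some args
  | args => some args
  | uargs => some args
  | _ => none

def vcloseStep : Mode → Option Mode
  | args => some vname
  | uargs => some vname
  | _ => none

def bitStep : Mode → Option Mode
  | args => some name
  | name => some name
  | vname => some vname
  | _ => none

def isTop : Mode → Bool
  | top => true
  | utop => true
  | _ => false

/-- Whether a node may be opened. -/
def allows : NodeKind → Mode → Bool
  | .var, vname => true
  | .fn, args => true
  | .fn, name => true
  | .lit _, args => true
  | .lit _, name => true
  | _, _ => false

def after : NodeKind → Mode
  | .lit _ => top
  | _ => args

end Mode

def Cell.notFrame : Cell → Bool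
  | frame _ _ => false
  | _ => true

/-! ### The programs of the verifier -/

abbrev VCmd := Cmd Stk Cell Ctl

/-- Pop a symbol from `src` and check it. -/
def VCmd.test (src : Stk) (c : Ctl → Option Cell → Bool) : VCmd :=
  .move ⟨src, none, fun q x => q.check (c q x)⟩

/-- Move a whole stack. -/
def VCmd.drain (src : Stk) (dst : Option Stk) : VCmd :=
  .loop src (fun _ => true) [⟨src, dst, fun q _ => q⟩]

/-- `textRev` holds the unread rest of the previously read copy, rightmost symbol on top; `text`
collects the current copy, to be reversed onto `textRev` at its end. The first copy has nothing to
be compared with. -/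
noncomputable def compareProg (a : Sym) : List VCmd :=
  [.test .textRev fun q x => q.first || decide (x = some (.sym a)), .push .text fun _ => .sym a]

/-- Every unit of a class number has moved one truth value from `bits` to `bitsRev`, so the truth
value of the class is now on top of `bits`. It is stored in a frame mark and `bits` is restored. The
units stay on the main stack, below the mark. -/
noncomputable def lookupProg (frame : Ctl → FrameKind) (f : Mode → Option Mode) : List VCmd :=
  [.move ⟨.bits, some .bitsRev, fun q x => { q with bit := decide (x = some (.truth true)) }⟩,
    .drain .bitsRev (some .bits), .push .main fun q => .frame (frame q) q.bit,
    .upd fun q => { q.goto f with bit := false }]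

/-- Pop the frame on the main stack and compare its content with the guessed word. -/
noncomputable def popFrame : VCmd :=
  .loop .main Cell.notFrame
    [⟨.main, none, fun q x =>
        { q with cur := x, childT := q.childT || decide (x = some (.child true)) }⟩,
      ⟨.word, some .wordRev, fun q y =>
        { q with mism := q.mism || decide (y ≠ q.cur), cur := none }⟩]

def popMark (k : FrameKind) : VCmd :=
  .move ⟨.main, none, fun q x => match x with
    | some (.frame f b) => { q.check (decide (f = k)) with bit := b }
    | _ => { q with bad := true }⟩

def finishNode (k : NodeKind) (q : Ctl) : Ctl :=
  { q with
    blk := q.blk.upd q.bit q.childT (!q.mism) k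
    bit := false
    mism := false
    childT := false
    mode := .after k
    pend := q.pend || decide (k.frame = .lit) }

/-- Once the opener is pushed, the cells above the frame mark are exactly the word of the node.
After the comparison, one more pop from `word` detects a guessed word that is too long. The new
`child` cell lands on the units of the node, and together they form its entry in the frame of the
parent. A literal has no parent, so its units are discarded. -/
noncomputable def openProg (k : NodeKind) : List VCmd :=
  [.upd fun q => q.check (q.mode.allows k), .push .main fun _ => .sym k.opener, popFrame,
    popMark k.frame,
    .move ⟨.word, some .wordRev, fun q y => { q with mism := q.mism || y.isSome }⟩,
    .drain .wordRev (some .word),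
    if k.frame = .lit then .drain .main none else .push .main fun q => .child q.bit,
    .upd (finishNode k)]

noncomputable def certPre : Cert → List VCmd
  | .unit => [.upd fun q => q.goto Mode.unitStep, .push .main fun _ => .unit,
      .move ⟨.bits, some .bitsRev, fun q _ => q⟩]
  | .vclose => lookupProg (fun _ => .var) Mode.vcloseStep
  | .clause st sel =>
      (.upd fun q => { q.check (decide (q.mode = .top)) with
        glb := q.glb.upd st sel q.blk, blk := .init, pend := false }) ::
      if sel then [.push .sels fun _ => .tick] else []
  | .copy => [.upd fun q => { q.check (decide (q.mode = .top) && !q.pend) with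
        glb := q.glb.copy, first := false },
      .test .textRev fun _ x => x.isNone, .drain .text (some .textRev),
      .push .copies fun _ => .tick]
  | .sym .close =>
      lookupProg (fun q => if q.mode.isTop then .lit else .fn) Mode.closeStep
  | .sym (.bit b) => [.upd fun q => q.goto Mode.bitStep, .push .main fun _ => .sym (.bit b)]
  | .sym (.lit p) => openProg (.lit p)
  | .sym .fn => openProg .fn
  | .sym .var => openProg .var
  | _ => [.upd fun q => { q with bad := true }]

/-- The input symbol to which a certificate symbol corresponds. -/
def Cert.text : Cert → Option Sym
  | sym a => some a
  | clause st _ => some (.clause st)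
  | _ => none

/-- Each tick pays for one copy and for one selected clause; with `exactly`, the selected clause
must be present. The final program requires both counters to be empty, which gives `d` copies and
the size constraint. -/
noncomputable def inputProg (m : Instance.LimitMode) : Sym → List VCmd
  | .tick => [.test .text fun _ x => x.isNone, .test .textRev fun _ x => x.isNone,
      .test .copies fun _ x => x.isSome,
      .test .sels fun _ x => match m with
        | .atMost => true
        | .exactly => x.isSome]
  | a => [.test .text fun _ x => x.isNone,
      .test .textRev fun _ x => decide (x = some (.sym a))]

/-- An entry carries a truth value and optionally a cell of the guessed word, so that a certificate
of length `N` can supply `N` truth values together with any word of length at most `N`. Other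
symbols are ignored. As reading goes from right to left, `one` tells whether a larger class is true.
-/
noncomputable def entryProg : Cert → List VCmd
  | .entry b x =>
      [.upd fun q => { q with
          many := q.many || (b && q.one), mono := q.mono && (b || !q.one), one := q.one || b },
        .push .bits fun _ => .truth b] ++
      match x with
      | some x => [.push .word fun _ => x]
      | none => []
  | _ => []

noncomputable def verifierProg (m : Instance.LimitMode) : Option (Sym ⊕ Cert ⊕ Cert) → List VCmd
  | none => [.test .copies fun _ x => x.isNone, .test .sels fun _ x => x.isNone]
  | some (.inl a) => inputProg m a
  | some (.inr (.inl t)) => certPre t ++ (t.text.elim [] compareProg)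
  | some (.inr (.inr t)) => entryProg t

def Ctl.accepts (q : Ctl) : Bool := !q.bad && q.glb.ok (q.one && !q.many) q.mono

noncomputable def verifier (m : Instance.LimitMode) (x : List Sym × List Cert × List Cert) :
    Bool :=
  Ctl.accepts (exec (verifierProg m) Ctl.init (tripleWord x)).1

/-! ### Well-formedness, running time and persistence of failure -/

theorem verifierProg_wellFormed (m : Instance.LimitMode) (a : Option (Sym ⊕ Cert ⊕ Cert)) :
    ∀ c ∈ verifierProg m a, c.WellFormed := by
  have hl : ∀ f g, ∀ c ∈ lookupProg f g, c.WellFormed := by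
    simp [lookupProg, VCmd.drain, Cmd.WellFormed]
  have ho : ∀ k, ∀ c ∈ openProg k, c.WellFormed := by
    intro k
    cases k <;> simp [openProg, popFrame, popMark, VCmd.drain, Cmd.WellFormed, NodeKind.frame]
  have hc : ∀ a, ∀ c ∈ compareProg a, c.WellFormed := by
    simp [compareProg, VCmd.test, Cmd.WellFormed]
  rcases a with _ | a | t | t
  · simp [verifierProg, VCmd.test, Cmd.WellFormed]
  · cases a <;> simp [verifierProg, inputProg, VCmd.test, Cmd.WellFormed]
  · intro c hc'
    rcases List.mem_append.1 hc' with h | h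
    · rcases t with a | _ | _ | ⟨_, _ | _⟩ | _ | _
      · cases a
        case close => exact hl _ _ c h
        case lit => exact ho _ c h
        case fn => exact ho _ c h
        case var => exact ho _ c h
        all_goals clear hc'; revert c; simp [certPre, Cmd.WellFormed]
      case vclose => exact hl _ _ c h
      all_goals clear hc'; revert c; simp [certPre, Cmd.WellFormed, VCmd.test, VCmd.drain]
    · rcases ht : t.text with _ | a
      · simp [ht] at h
      · rw [ht] at h; exact hc a c h
  · rcases t with _ | _ | _ | _ | _ | ⟨_, _ | _⟩ <;> simp [verifierProg, entryProg, Cmd.WellFormed]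

theorem verifier_polyTime (m : Instance.LimitMode) :
    Nonempty (Turing.TM2ComputableInPolyTime tripleWord Computability.encodeBool (verifier m)) :=
  computableInPolyTime tripleWord (verifierProg m) Ctl.init Ctl.accepts
    (verifierProg_wellFormed m)

/-- Failure is never revoked. -/
theorem verifierProg_keeps_bad (m : Instance.LimitMode) (a : Option (Sym ⊕ Cert ⊕ Cert)) :
    ∀ c ∈ verifierProg m a, c.Keeps fun q => q.bad = true := by
  have hg : ∀ (q : Ctl) f, q.bad = true → (q.goto f).bad = true := by
    intro q f h
    unfold Ctl.goto
    split <;> simp [h]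
  have hl : ∀ f g, ∀ c ∈ lookupProg f g, c.Keeps fun q => q.bad = true := by
    intro f g
    simp only [lookupProg, VCmd.drain, Cmd.Keeps, List.mem_cons, List.not_mem_nil, or_false,
      forall_eq_or_imp, forall_eq]
    exact ⟨fun _ _ h => h, fun _ _ h => h, trivial, fun q h => hg q g h⟩
  have ho : ∀ k, ∀ c ∈ openProg k, c.Keeps fun q => q.bad = true := by
    intro k
    cases k <;>
    · simp only [openProg, popFrame, popMark, VCmd.drain, Cmd.Keeps, NodeKind.frame,
        List.mem_cons, List.not_mem_nil, or_false, forall_eq_or_imp, forall_eq]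
      simp +contextual [Ctl.check, finishNode, Cmd.Keeps]
      intro q x h
      split <;> simp [h]
  have hc : ∀ a, ∀ c ∈ compareProg a, c.Keeps fun q => q.bad = true := by
    simp +contextual [compareProg, VCmd.test, Cmd.Keeps, Ctl.check]
  rcases a with _ | a | t | t
  · simp +contextual [verifierProg, VCmd.test, Cmd.Keeps, Ctl.check]
  · cases a <;> simp +contextual [verifierProg, inputProg, VCmd.test, Cmd.Keeps, Ctl.check]
  · intro c hc'
    rcases List.mem_append.1 hc' with h | h
    · rcases t with a | _ | _ | ⟨_, _ | _⟩ | _ | _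
      · cases a
        case close => exact hl _ _ c h
        case lit => exact ho _ c h
        case fn => exact ho _ c h
        case var => exact ho _ c h
        all_goals clear hc'; revert c; simp +contextual [certPre, Cmd.Keeps, hg]
      case vclose => exact hl _ _ c h
      all_goals
        clear hc'
        revert c
        simp +contextual [certPre, Cmd.Keeps, VCmd.test, VCmd.drain, hg, Ctl.check]
    · rcases ht : t.text with _ | a
      · simp [ht] at h
      · rw [ht] at h; exact hc a c h
  · rcases t with _ | _ | _ | _ | _ | ⟨_, _ | _⟩ <;>
      simp +contextual [verifierProg, entryProg, Cmd.Keeps]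

noncomputable section

/-! ## The parser that the verifier simulates -/

/-- The term `f(t₁, …, tₙ)` with its arguments given as a list. -/
def mkFn {V : Type} (f : Name) (l : List (Tm V)) : Tm V :=
  FirstOrder.Language.Term.func (L := sig) (l := l.length) f l.get

/-- A literal with its arguments given as a list. -/
def Literal.ofList {V : Type} (p : Bool) (f : Name) (l : List (Tm V)) : Literal V :=
  ⟨p, (f : sig.Relations l.length), l.get⟩

/-- A syntax node: kind, name, classes of the children, class. -/
structure Node : Type where
  kind : NodeKind
  name : List Bool
  args : List ℕ
  cls : ℕ

/-- A clause copy in a certificate, with the classes of its literals and all its nodes. -/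
structure Block : Type where
  isStart : Bool
  selected : Bool
  lits : List (Literal Name × ℕ)
  nodes : List Node

/-- The nodes that are currently open, with their classes and the arguments already read. -/
inductive Ctx : Type
  | top
  | frame (parent : Ctx) (c : ℕ) (args : List (Tm Name × ℕ))

/-- The position between two nodes, or within the name of a node. -/
inductive Phase : Type
  | ready (units : ℕ)
  | name (bits : List Bool)
  | vname (c : ℕ) (bits : List Bool)

/-- The state of the parser. -/
structure Parser : Type where
  ctx : Ctx
  phase : Phase
  lits : List (Literal Name × ℕ)
  nodes : List Node
  blocks : List Block
  copies : List (List Block)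
  text : List Sym
  rest : Option (List Sym)
  copyCount : ℕ
  selCount : ℕ

namespace Parser

def init : Parser := ⟨.top, .ready 0, [], [], [], [], [], none, 0, 0⟩

/-- Compare a symbol with the text of the previous copy. -/
def compare (a : Sym) (g : Parser) : Option Parser :=
  match g.rest with
  | none => some { g with text := a :: g.text }
  | some (x :: xs) => if x = a then some { g with text := a :: g.text, rest := some xs } else none
  | some [] => none

end Parser

/-- The name read before an opening symbol. -/
def Phase.name? : Phase → Option (List Bool)
  | ready 0 => some []
  | name bs => some bs
  | _ => none

namespace Parser

/-- The shape of the context does the work of the frame marks: a function node must lie in an inner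
frame, a literal in the outermost one. -/
def openNode (k : NodeKind) (g : Parser) : Option Parser :=
  match k, g.ctx with
  | .var, .frame p c' args' =>
    match g.phase with
    | .vname c bs => some { g with
        ctx := .frame p c' ((.var bs, c) :: args')
        phase := .ready 0
        nodes := ⟨.var, bs, [], c⟩ :: g.nodes }
    | _ => none
  | .fn, .frame (.frame p c' args') c args =>
    g.phase.name?.map fun nm => { g with
      ctx := .frame p c' ((mkFn nm (args.map Prod.fst), c) :: args')
      phase := .ready 0
      nodes := ⟨.fn, nm, args.map Prod.snd, c⟩ :: g.nodes }
  | .lit s, .frame .top c args =>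
    g.phase.name?.map fun nm => { g with
      ctx := .top
      phase := .ready 0
      lits := (Literal.ofList s nm (args.map Prod.fst), c) :: g.lits
      nodes := ⟨.lit s, nm, args.map Prod.snd, c⟩ :: g.nodes }
  | _, _ => none

def pre (t : Cert) (g : Parser) : Option Parser :=
  match t with
  | .unit => match g.phase with
    | .ready n => some { g with phase := .ready (n + 1) }
    | _ => none
  | .vclose => match g.ctx, g.phase with
    | .frame _ _ _, .ready n => some { g with phase := .vname n [] }
    | _, _ => none
  | .clause st sel => match g.ctx, g.phase with
    | .top, .ready 0 => some { g with
        blocks := ⟨st, sel, g.lits, g.nodes⟩ :: g.blocks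
        lits := []
        nodes := []
        selCount := g.selCount + sel.toNat }
    | _, _ => none
  | .copy => match g.ctx, g.phase, g.lits, g.rest.getD [] with
    | .top, .ready 0, [], [] => some { g with
        blocks := []
        copies := g.blocks :: g.copies
        rest := some g.text.reverse
        text := []
        copyCount := g.copyCount + 1 }
    | _, _, _, _ => none
  | .sym .close => match g.phase with
    | .ready n => some { g with ctx := .frame g.ctx n [], phase := .ready 0 }
    | _ => none
  | .sym (.bit b) => match g.ctx, g.phase with
    | .frame _ _ _, .ready 0 => some { g with phase := .name [b] }
    | .frame _ _ _, .name bs => some { g with phase := .name (b :: bs) }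
    | .frame _ _ _, .vname c bs => some { g with phase := .vname c (b :: bs) }
    | _, _ => none
  | .sym (.lit p) => g.openNode (.lit p)
  | .sym .fn => g.openNode .fn
  | .sym .var => g.openNode .var
  | _ => none

/-- Read a symbol of a certificate. -/
def step (t : Cert) (g : Parser) : Option Parser :=
  (g.pre t).bind fun g' => t.text.elim (some g') fun a => g'.compare a

/-- Read a symbol of the input. -/
def stepInput (m : Instance.LimitMode) (a : Sym) (g : Parser) : Option Parser :=
  match a with
  | .tick => match g.text, g.rest.getD [], g.copyCount, g.selCount, m with
    | [], [], n + 1, s + 1, _ => some { g with copyCount := n, selCount := s }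
    | [], [], n + 1, 0, .atMost => some { g with copyCount := n }
    | _, _, _, _, _ => none
  | a => match g.text, g.rest with
    | [], some (x :: xs) => if x = a then some { g with rest := some xs } else none
    | _, _ => none

end Parser

/-! ## The encoding of parser states by machine states -/

section Encoding

/-- The classes that a list of truth values makes true. -/
def truth (zs : List Bool) (c : ℕ) : Bool := zs.getD c false

/-- Whether the true classes form an initial segment. -/
def initial : List Bool → Bool
  | [] => true
  | b :: zs => initial zs && (b || !zs.any id)

variable (τ : ℕ → Bool) (R : List Cell)

def bitsWord (bs : List Bool) : List Cell := bs.map fun b => .sym (.bit b)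

def unitsWord (n : ℕ) : List Cell := List.replicate n .unit

/-- The truth value is stored with the child so that popping the frame reveals a true child without
another lookup. Words are compared only under one and the same `τ`, so this dependence does no harm.
-/
def argsWord (cs : List ℕ) : List Cell := cs.flatMap fun c => .child (τ c) :: unitsWord c

def Node.word (n : Node) : List Cell :=
  .sym n.kind.opener :: (bitsWord n.name ++ argsWord τ n.args)

def blockMonitor (ns : List Node) : BlockMonitor :=
  ns.foldr (fun n m => m.upd (τ n.cls) (n.args.any τ) (decide (n.word τ = R)) n.kind) .init

def blocksMonitor (g : Monitor) (bs : List Block) : Monitor :=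
  bs.foldr (fun b g => g.upd b.isStart b.selected (blockMonitor τ R b.nodes)) g

def copiesMonitor : List (List Block) → Monitor
  | [] => .init
  | bs :: cs => (blocksMonitor τ R (copiesMonitor cs) bs).copy

def Ctx.frameKind : Ctx → FrameKind
  | top => .lit
  | frame _ _ _ => .fn

def Ctx.word : Ctx → List Cell
  | top => []
  | frame p c args =>
    argsWord τ (args.map Prod.snd) ++ .frame p.frameKind (τ c) :: (unitsWord c ++ p.word)

def Phase.word : Phase → List Cell
  | ready n => unitsWord n
  | name bs => bitsWord bs
  | vname c bs => bitsWord bs ++ .frame .var (τ c) :: unitsWord c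

def Phase.units : Phase → ℕ
  | ready n => n
  | _ => 0

def modeOf : Ctx → Phase → Mode
  | .top, .ready 0 => .top
  | .top, .ready (_ + 1) => .utop
  | .top, _ => .stuck
  | .frame _ _ _, .ready 0 => .args
  | .frame _ _ _, .ready (_ + 1) => .uargs
  | .frame _ _ _, .name _ => .name
  | .frame _ _ _, .vname _ _ => .vname

end Encoding

/-- The contents of the work stacks. -/
def stk (bits bitsRev main word wordRev text textRev copies sels : List Cell) :
    Stk → List Cell
  | .bits => bits
  | .bitsRev => bitsRev
  | .main => main
  | .word => word
  | .wordRev => wordRev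
  | .text => text
  | .textRev => textRev
  | .copies => copies
  | .sels => sels

section Updates

variable (s₁ s₂ s₃ s₄ s₅ s₆ s₇ s₈ s₉ l : List Cell)

theorem update_bits : Function.update (stk s₁ s₂ s₃ s₄ s₅ s₆ s₇ s₈ s₉) .bits l =
    stk l s₂ s₃ s₄ s₅ s₆ s₇ s₈ s₉ := by funext k; cases k <;> rfl
theorem update_bitsRev : Function.update (stk s₁ s₂ s₃ s₄ s₅ s₆ s₇ s₈ s₉) .bitsRev l =
    stk s₁ l s₃ s₄ s₅ s₆ s₇ s₈ s₉ := by funext k; cases k <;> rfl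
theorem update_main : Function.update (stk s₁ s₂ s₃ s₄ s₅ s₆ s₇ s₈ s₉) .main l =
    stk s₁ s₂ l s₄ s₅ s₆ s₇ s₈ s₉ := by funext k; cases k <;> rfl
theorem update_word : Function.update (stk s₁ s₂ s₃ s₄ s₅ s₆ s₇ s₈ s₉) .word l =
    stk s₁ s₂ s₃ l s₅ s₆ s₇ s₈ s₉ := by funext k; cases k <;> rfl
theorem update_wordRev : Function.update (stk s₁ s₂ s₃ s₄ s₅ s₆ s₇ s₈ s₉) .wordRev l =
    stk s₁ s₂ s₃ s₄ l s₆ s₇ s₈ s₉ := by funext k; cases k <;> rfl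
theorem update_text : Function.update (stk s₁ s₂ s₃ s₄ s₅ s₆ s₇ s₈ s₉) .text l =
    stk s₁ s₂ s₃ s₄ s₅ l s₇ s₈ s₉ := by funext k; cases k <;> rfl
theorem update_textRev : Function.update (stk s₁ s₂ s₃ s₄ s₅ s₆ s₇ s₈ s₉) .textRev l =
    stk s₁ s₂ s₃ s₄ s₅ s₆ l s₈ s₉ := by funext k; cases k <;> rfl
theorem update_copies : Function.update (stk s₁ s₂ s₃ s₄ s₅ s₆ s₇ s₈ s₉) .copies l =
    stk s₁ s₂ s₃ s₄ s₅ s₆ s₇ l s₉ := by funext k; cases k <;> rfl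
theorem update_sels : Function.update (stk s₁ s₂ s₃ s₄ s₅ s₆ s₇ s₈ s₉) .sels l =
    stk s₁ s₂ s₃ s₄ s₅ s₆ s₇ s₈ l := by funext k; cases k <;> rfl

end Updates

section Simulation

variable (zs : List Bool) (R : List Cell)

def truthWord : List Cell := zs.map .truth

def symWord (l : List Sym) : List Cell := l.map .sym

def Parser.ctl (g : Parser) : Ctl where
  bad := false
  one := zs.any id
  many := decide (1 < zs.count true)
  mono := initial zs
  mode := modeOf g.ctx g.phase
  first := g.rest.isNone
  pend := !g.lits.isEmpty
  bit := false
  mism := false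
  childT := false
  cur := none
  blk := blockMonitor (truth zs) R g.nodes
  glb := blocksMonitor (truth zs) R (copiesMonitor (truth zs) R g.copies) g.blocks

/-- The machine state that encodes a state of the parser. -/
def Parser.encode (g : Parser) : State Stk Cell Ctl :=
  (g.ctl zs R,
    stk ((truthWord zs).drop g.phase.units) ((truthWord zs).take g.phase.units).reverse
      (g.phase.word (truth zs) ++ g.ctx.word (truth zs)) R [] (symWord g.text)
      (symWord (g.rest.getD [])) (List.replicate g.copyCount .tick)
      (List.replicate g.selCount .tick))

/-! ### Loops -/

theorem loopRun_transfer {src dst : Stk} (h : src ≠ dst) (n : ℕ) :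
    ∀ (q : Ctl) (S : Stk → List Cell), (S src).length = n →
      loopRun src (fun _ => true) [⟨src, some dst, fun q _ => q⟩] n (q, S) =
        (q, Function.update (Function.update S src []) dst ((S src).reverse ++ S dst)) := by
  induction n with
  | zero =>
    intro q S hS
    have h0 : S src = [] := List.length_eq_zero_iff.1 hS
    simp only [loopRun, h0, List.reverse_nil, List.nil_append]
    rw [← h0, Function.update_eq_self, Function.update_eq_self]
  | succ n ih =>
    intro q S hS
    obtain ⟨x, l, hx⟩ := List.exists_cons_of_length_eq_add_one hS
    have h1 : (runMoves [⟨src, some dst, fun q _ => q⟩] (q, S)) =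
        (q, Function.update (Function.update S src l) dst (x :: S dst)) := by
      simp [runMoves, Move.run, hx, Function.update_of_ne h.symm]
    have h2 : (Option.any (fun _ : Cell => true) (S src).head?) = true := by simp [hx]
    rw [loopRun, if_pos h2, h1, ih]
    · congr 1
      funext k
      by_cases hk : k = dst
      · subst hk
        simp [Function.update_of_ne h, hx]
      · by_cases hk' : k = src
        · subst hk'
          simp [Function.update_of_ne h]
        · simp [Function.update_of_ne hk, Function.update_of_ne hk']
    · rw [Function.update_of_ne h, Function.update_self]
      rw [hx] at hS
      simpa using hS

theorem loopRun_discard {src : Stk} (n : ℕ) :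
    ∀ (q : Ctl) (S : Stk → List Cell), (S src).length = n →
      loopRun src (fun _ => true) [⟨src, none, fun q _ => q⟩] n (q, S) =
        (q, Function.update S src []) := by
  induction n with
  | zero =>
    intro q S hS
    have h0 : S src = [] := List.length_eq_zero_iff.1 hS
    simp only [loopRun]
    rw [← h0, Function.update_eq_self]
  | succ n ih =>
    intro q S hS
    obtain ⟨x, l, hx⟩ := List.exists_cons_of_length_eq_add_one hS
    have h1 : (runMoves [⟨src, none, fun q _ => q⟩] (q, S)) =
        (q, Function.update S src l) := by
      simp [runMoves, Move.run, hx]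
    have h2 : (Option.any (fun _ : Cell => true) (S src).head?) = true := by simp [hx]
    rw [loopRun, if_pos h2, h1, ih]
    · simp
    · rw [Function.update_self]
      rw [hx] at hS
      simpa using hS

theorem run_drain_some {src dst : Stk} (h : src ≠ dst) (q : Ctl) (S : Stk → List Cell) :
    Cmd.run (VCmd.drain src (some dst)) (q, S) =
      (q, Function.update (Function.update S src []) dst ((S src).reverse ++ S dst)) :=
  loopRun_transfer h _ q S rfl

theorem run_drain_none {src : Stk} (q : Ctl) (S : Stk → List Cell) :
    Cmd.run (VCmd.drain src none) (q, S) = (q, Function.update S src []) :=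
  loopRun_discard _ q S rfl

theorem run_test (src : Stk) (c : Ctl → Option Cell → Bool) (q : Ctl) (S : Stk → List Cell) :
    Cmd.run (VCmd.test src c) (q, S) =
      (q.check (c q (S src).head?), Function.update S src (S src).tail) := by
  simp [VCmd.test, Cmd.run, Move.run]

/-! ### Comparing a frame with the guessed word -/

/-- Whether the frame content `F` disagrees with an initial segment of `R`. -/
def disagree : List Cell → List Cell → Bool
  | [], _ => false
  | x :: F, R => decide (R.head? ≠ some x) || disagree F R.tail

/-- The words differ if and only if a cell of `F` disagrees, which includes the case that `R` is
exhausted, or something of `R` is left over. -/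
theorem disagree_or (F R : List Cell) :
    (disagree F R || (R.drop F.length).head?.isSome) = !decide (F = R) := by
  induction F generalizing R with
  | nil => cases R <;> simp [disagree]
  | cons x F ih =>
    cases R with
    | nil => simp [disagree]
    | cons y R =>
      have := ih R
      simp only [disagree, List.head?_cons, List.tail_cons, List.length_cons, List.drop_succ_cons]
      by_cases h : y = x
      · subst h
        simp only [ne_eq, not_true_eq_false, decide_false, Bool.false_or, List.cons.injEq, true_and]
        exact this
      · simp [h, Ne.symm h]

theorem loopRun_popFrame (f : FrameKind) (b : Bool) (s₁ s₂ s₆ s₇ s₈ s₉ rest : List Cell) :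
    ∀ (F : List Cell) (n : ℕ) (_ : ∀ x ∈ F, x.notFrame = true) (_ : F.length ≤ n)
      (q : Ctl) (_ : q.cur = none) (W W' : List Cell),
      loopRun .main Cell.notFrame
        [⟨.main, none, fun q x =>
          { q with cur := x, childT := q.childT || decide (x = some (.child true)) }⟩,
        ⟨.word, some .wordRev, fun q y =>
          { q with mism := q.mism || decide (y ≠ q.cur), cur := none }⟩] n
        (q, stk s₁ s₂ (F ++ .frame f b :: rest) W W' s₆ s₇ s₈ s₉) =
      ({ q with
          childT := q.childT || F.any fun x => decide (x = .child true)
          mism := q.mism || disagree F W },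
        stk s₁ s₂ (.frame f b :: rest) (W.drop F.length) ((W.take F.length).reverse ++ W')
          s₆ s₇ s₈ s₉) := by
  intro F
  induction F with
  | nil =>
    intro n _ _ q _ W W'
    have : ∀ s : State Stk Cell Ctl, s.2 .main = .frame f b :: rest → ∀ body,
        loopRun Stk.main Cell.notFrame body n s = s := by
      intro s hs body
      cases n with
      | zero => rfl
      | succ n => rw [loopRun, if_neg]; simp [hs, Cell.notFrame]
    rw [this _ rfl]
    simp [disagree]
  | cons x F ih =>
    intro n hF hn q hq W W'
    obtain ⟨n, rfl⟩ : ∃ k, n = k + 1 := ⟨n - 1, by simp at hn; omega⟩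
    have hx : x.notFrame = true := hF x List.mem_cons_self
    rw [loopRun, if_pos (by simp [stk, hx])]
    have h1 : runMoves
        [⟨.main, none, fun q x =>
          { q with cur := x, childT := q.childT || decide (x = some (.child true)) }⟩,
        ⟨.word, some .wordRev, fun q y =>
          { q with mism := q.mism || decide (y ≠ q.cur), cur := none }⟩]
        ((q, stk s₁ s₂ (x :: F ++ .frame f b :: rest) W W' s₆ s₇ s₈ s₉) : State Stk Cell Ctl) =
        ({ q with
          childT := q.childT || decide (x = .child true)
          mism := q.mism || decide (W.head? ≠ some x) },
        stk s₁ s₂ (F ++ .frame f b :: rest) W.tail (W.head?.toList ++ W') s₆ s₇ s₈ s₉) := by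
      cases W <;> simp [runMoves, Move.run, stk, update_main, update_word, update_wordRev, hq]
    rw [h1]
    refine (ih n (fun y hy => hF y (List.mem_cons_of_mem _ hy)) (by simpa using hn) _
      (by exact hq) _ _).trans ?_
    cases W <;> simp [disagree, Bool.or_assoc]

theorem run_popFrame (f : FrameKind) (b : Bool) (s₁ s₂ s₆ s₇ s₈ s₉ rest F : List Cell)
    (hF : ∀ x ∈ F, x.notFrame = true) (q : Ctl) (hq : q.cur = none) (W W' : List Cell) :
    Cmd.run popFrame (q, stk s₁ s₂ (F ++ .frame f b :: rest) W W' s₆ s₇ s₈ s₉) =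
      ({ q with
          childT := q.childT || F.any fun x => decide (x = .child true)
          mism := q.mism || disagree F W },
        stk s₁ s₂ (.frame f b :: rest) (W.drop F.length) ((W.take F.length).reverse ++ W')
          s₆ s₇ s₈ s₉) :=
  loopRun_popFrame f b s₁ s₂ s₆ s₇ s₈ s₉ rest F _ hF (by simp [stk]) q hq W W'

/-- The guessed word must survive the comparison, because later nodes are compared with it as well.
-/
theorem run_openProg (k : NodeKind) (q : Ctl) (hcur : q.cur = none) (hchild : q.childT = false)
    (hmism : q.mism = false) (f : FrameKind) (b : Bool) (s₁ s₂ s₆ s₇ s₈ s₉ rest F R : List Cell)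
    (hF : ∀ x ∈ F, x.notFrame = true) :
    runCmds (openProg k) (q, stk s₁ s₂ (F ++ .frame f b :: rest) R [] s₆ s₇ s₈ s₉) =
      ({ q with
          bad := (q.bad || !q.mode.allows k) || !decide (f = k.frame)
          bit := false
          mode := .after k
          pend := q.pend || decide (k.frame = .lit)
          blk := q.blk.upd b (F.any fun x => decide (x = .child true))
            (decide (.sym k.opener :: F = R)) k },
        stk s₁ s₂ (if k.frame = .lit then [] else .child b :: rest) R [] s₆ s₇ s₈ s₉) := by
  have h := run_popFrame f b s₁ s₂ s₆ s₇ s₈ s₉ rest (.sym k.opener :: F)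
    (by
      intro x hx
      rcases List.mem_cons.1 hx with rfl | hx
      · rfl
      · exact hF x hx) (q.check (q.mode.allows k)) hcur R []
  have hd := disagree_or (.sym k.opener :: F) R
  -- The cells compared, the cell of the additional pop and the untouched rest reassemble to `R`
  -- when `wordRev` is drained.
  have hR : ((R.drop (F.length + 1)).head?.toList ++
      ((R.take (F.length + 1)).reverse)).reverse ++ (R.drop (F.length + 1)).tail = R := by
    conv_rhs => rw [← List.take_append_drop (F.length + 1) R]
    cases R.drop (F.length + 1) <;> simp
  have hR' : ∀ (x : List Cell) (l : List Cell), x = R.drop (F.length + 1) →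
      l = (match x.head? with
        | some g => g :: (R.take (F.length + 1)).reverse
        | none => (R.take (F.length + 1)).reverse) →
      l.reverse ++ x.tail = R := by
    rintro x l rfl rfl
    refine Eq.trans ?_ hR
    cases (R.drop (F.length + 1)).head? <;> simp
  simp only [runCmds, openProg, List.foldl_cons, List.foldl_nil]
  have h0 : Cmd.run (.push .main fun _ => .sym k.opener)
      (Cmd.run (.upd fun q => q.check (q.mode.allows k))
        (q, stk s₁ s₂ (F ++ .frame f b :: rest) R [] s₆ s₇ s₈ s₉)) =
      (q.check (q.mode.allows k),
        stk s₁ s₂ ((.sym k.opener :: F) ++ .frame f b :: rest) R [] s₆ s₇ s₈ s₉) := by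
    simp [Cmd.run, stk, update_main]
  rw [h0, h]
  have h1 : ∀ (q' : Ctl) (W W' : List Cell),
      Cmd.run (popMark k.frame) (q', stk s₁ s₂ (.frame f b :: rest) W W' s₆ s₇ s₈ s₉) =
      ({ q'.check (decide (f = k.frame)) with bit := b },
        stk s₁ s₂ rest W W' s₆ s₇ s₈ s₉) := by
    intro q' W W'
    simp [popMark, Cmd.run, Move.run, stk, update_main]
  rw [h1]
  have h2 : ∀ (q' : Ctl) (main W W' : List Cell),
      Cmd.run (.move ⟨.word, some .wordRev, fun q y => { q with mism := q.mism || y.isSome }⟩)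
        (q', stk s₁ s₂ main W W' s₆ s₇ s₈ s₉) =
      ({ q' with mism := q'.mism || W.head?.isSome },
        stk s₁ s₂ main W.tail (match W.head? with
          | some g => g :: W'
          | none => W') s₆ s₇ s₈ s₉) := by
    intro q' main W W'
    cases W <;> simp [Cmd.run, Move.run, stk, update_word, update_wordRev]
  rw [h2, run_drain_some (by simp)]
  simp only [update_wordRev, update_word, stk]
  rw [List.length_cons, hR' (List.drop (F.length + 1) R) _ rfl (by rw [List.append_nil])]
  have h3 : (!disagree (.sym k.opener :: F) R && R[F.length + 1]?.isNone) =
      decide (.sym k.opener :: F = R) := by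
    have := congrArg not hd
    simpa using this
  by_cases hk : k.frame = .lit
  · rw [if_pos hk, if_pos hk, run_drain_none]
    simp [Cmd.run, finishNode, update_main, Ctl.check, hchild, hmism, h3, hk]
  · rw [if_neg hk, if_neg hk]
    simp [Cmd.run, finishNode, update_main, Ctl.check, hchild, hmism, h3, hk, stk]

/-! ### Simulation of single symbols -/

theorem bad_runCmds_of_bad (m : Instance.LimitMode) (a : Option (Sym ⊕ Cert ⊕ Cert))
    {l : List VCmd} (hl : l ⊆ verifierProg m a) {s : State Stk Cell Ctl} (hs : s.1.bad = true) :
    (runCmds l s).1.bad = true :=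
  runCmds_keeps (P := fun q => q.bad = true)
    (fun c hc => verifierProg_keeps_bad m a c (hl hc)) s hs

theorem runCmds_append {K G Q : Type} [DecidableEq K] (l₁ l₂ : List (Cmd K G Q))
    (s : State K G Q) : runCmds (l₁ ++ l₂) s = runCmds l₂ (runCmds l₁ s) :=
  List.foldl_append

theorem bad_compare_of_bad (a : Sym) {s : State Stk Cell Ctl} (hs : s.1.bad = true) :
    (runCmds (compareProg a) s).1.bad = true :=
  bad_runCmds_of_bad .atMost (some (.inr (.inl (.sym a)))) (by
    simp [verifierProg, Cert.text]) hs

theorem run_compareProg (a : Sym) (g : Parser) :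
    runCmds (compareProg a) (g.encode zs R) =
      ((g.ctl zs R).check (g.rest.isNone || decide ((symWord (g.rest.getD [])).head? =
        some (.sym a))),
      stk ((truthWord zs).drop g.phase.units) ((truthWord zs).take g.phase.units).reverse
        (g.phase.word (truth zs) ++ g.ctx.word (truth zs)) R [] (symWord (a :: g.text))
        (symWord (g.rest.getD [])).tail (List.replicate g.copyCount .tick)
        (List.replicate g.selCount .tick)) := by
  simp only [runCmds, compareProg, List.foldl_cons, List.foldl_nil, Parser.encode, run_test,
    update_textRev, stk]
  simp only [Cmd.run, stk, update_text]
  rfl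

theorem encode_compare_some {a : Sym} {g g' : Parser} (h : g.compare a = some g') :
    runCmds (compareProg a) (g.encode zs R) = g'.encode zs R := by
  rw [run_compareProg]
  unfold Parser.compare at h
  split at h
  · next hr =>
    obtain rfl := Option.some.inj h
    simp [Parser.encode, Parser.ctl, hr, Ctl.check, symWord]
  · next x xs hr =>
    split_ifs at h with hx
    obtain rfl := Option.some.inj h
    subst hx
    simp [Parser.encode, Parser.ctl, hr, Ctl.check, symWord]
  · simp at h

theorem encode_compare_none {a : Sym} {g : Parser} (h : g.compare a = none) :
    (runCmds (compareProg a) (g.encode zs R)).1.bad = true := by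
  rw [run_compareProg]
  unfold Parser.compare at h
  split at h
  · simp at h
  · next x xs hr =>
    split_ifs at h with hx
    simp [hr, Ctl.check, symWord, Parser.ctl, hx]
  · next hr => simp [hr, Ctl.check, symWord, Parser.ctl]

/-- A class beyond the supplied truth values finds an empty stack and counts as false, as in the
default of `truth`. -/
theorem lookup_truthWord (n : ℕ) :
    decide (((truthWord zs).drop n).head? = some (.truth true)) = truth zs n := by
  rw [List.head?_drop, truthWord, List.getElem?_map, truth, List.getD_eq_getElem?_getD]
  cases zs[n]? with
  | none => simp
  | some b => cases b <;> simp

theorem run_lookupProg (frame : Ctl → FrameKind) (hframe : ∀ q b, frame { q with bit := b } = frame q)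
    (f : Mode → Option Mode) (q : Ctl) (hq : q.bit = false) (n : ℕ)
    (s₃ s₄ s₅ s₆ s₇ s₈ s₉ : List Cell) :
    runCmds (lookupProg frame f) (q, stk ((truthWord zs).drop n) ((truthWord zs).take n).reverse
      s₃ s₄ s₅ s₆ s₇ s₈ s₉) =
      (q.goto f, stk (truthWord zs) [] (.frame (frame q) (truth zs n) :: s₃)
        s₄ s₅ s₆ s₇ s₈ s₉) := by
  have h1 : Cmd.run (.move ⟨.bits, some .bitsRev, fun q x =>
        { q with bit := decide (x = some (.truth true)) }⟩)
      (q, stk ((truthWord zs).drop n) ((truthWord zs).take n).reverse s₃ s₄ s₅ s₆ s₇ s₈ s₉) =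
      ({ q with bit := truth zs n },
        stk ((truthWord zs).drop (n + 1)) ((truthWord zs).take (n + 1)).reverse
          s₃ s₄ s₅ s₆ s₇ s₈ s₉) := by
    rw [← lookup_truthWord]
    simp only [Cmd.run, Move.run, stk, update_bits]
    rw [List.tail_drop, List.take_add_one]
    simp only [List.head?_drop]
    cases (truthWord zs)[n]? <;> simp [update_bitsRev]
  simp only [runCmds, lookupProg, List.foldl_cons, List.foldl_nil]
  rw [h1, run_drain_some (by simp)]
  simp only [update_bits, update_bitsRev, stk, List.reverse_reverse, List.take_append_drop]
  simp only [Cmd.run, stk, update_main, hframe]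
  unfold Ctl.goto
  cases hf : f q.mode <;> simp [← hq]

theorem notFrame_bitsWord (bs : List Bool) : ∀ x ∈ bitsWord bs, x.notFrame = true := by
  intro x hx
  obtain ⟨b, -, rfl⟩ := List.mem_map.1 hx
  rfl

theorem notFrame_argsWord (τ : ℕ → Bool) (cs : List ℕ) :
    ∀ x ∈ argsWord τ cs, x.notFrame = true := by
  intro x hx
  simp only [argsWord, unitsWord, List.mem_flatMap, List.mem_cons, List.mem_replicate] at hx
  obtain ⟨c, -, rfl | ⟨-, rfl⟩⟩ := hx <;> rfl

theorem any_child_word (τ : ℕ → Bool) (bs : List Bool) (cs : List ℕ) :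
    ((bitsWord bs ++ argsWord τ cs).any fun x => decide (x = .child true)) = cs.any τ := by
  have h1 : ((bitsWord bs).any fun x => decide (x = .child true)) = false := by
    simp [bitsWord]
  rw [List.any_append, h1, Bool.false_or]
  induction cs with
  | nil => rfl
  | cons c cs ih =>
    have h2 : ((unitsWord c).any fun x => decide (x = .child true)) = false := by
      simp [unitsWord]
    rw [argsWord] at ih
    rw [argsWord, List.flatMap_cons, List.cons_append, List.any_cons, List.any_append, h2, ih]
    cases h : τ c <;> simp [h]

/-- Opening a node when the main stack starts with the content of a frame. -/
theorem run_openProg_encode (k : NodeKind) (g : Parser) (f : FrameKind) (b : Bool)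
    (nm : List Bool) (cs : List ℕ) (n : ℕ) (rest : List Cell)
    (hw : g.phase.word (truth zs) ++ g.ctx.word (truth zs) =
      (bitsWord nm ++ argsWord (truth zs) cs) ++ .frame f b :: rest) (hu : g.phase.units = 0) :
    runCmds (openProg k) (g.encode zs R) =
      ({ g.ctl zs R with
          bad := !(modeOf g.ctx g.phase).allows k || !decide (f = k.frame)
          mode := .after k
          pend := !g.lits.isEmpty || decide (k.frame = .lit)
          blk := (blockMonitor (truth zs) R g.nodes).upd b (cs.any (truth zs))
            (decide (Node.word (truth zs) ⟨k, nm, cs, n⟩ = R)) k },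
        stk (truthWord zs) [] (if k.frame = .lit then [] else .child b :: rest) R []
          (symWord g.text) (symWord (g.rest.getD [])) (List.replicate g.copyCount .tick)
          (List.replicate g.selCount .tick)) := by
  unfold Parser.encode
  rw [hw, hu, run_openProg k _ rfl rfl rfl, any_child_word]
  · simp only [Parser.ctl, Node.word, Bool.false_or]
    congr
  · intro x hx
    rcases List.mem_append.1 hx with h | h
    · exact notFrame_bitsWord _ x h
    · exact notFrame_argsWord _ _ x h

theorem openProg_bad_of_not_allows {k : NodeKind} (hk : ∃ a, openProg k = certPre (.sym a))
    {s : State Stk Cell Ctl} (h : s.1.mode.allows k = false) :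
    (runCmds (openProg k) s).1.bad = true := by
  obtain ⟨a, ha⟩ := hk
  change (runCmds (openProg k).tail (Cmd.run (.upd fun q => q.check (q.mode.allows k)) s)).1.bad
    = true
  refine bad_runCmds_of_bad .atMost (some (.inr (.inl (.sym a)))) ?_ ?_
  · intro c hc
    refine List.mem_append_left _ ?_
    rw [← ha]
    exact List.mem_of_mem_tail hc
  · simp [Cmd.run, Ctl.check, h]

/-- Two guards reproduce the failures of the parser: the mode rejects a node that is opened in the
wrong phase, and the kind of the frame mark rejects a node at the wrong depth. -/
theorem encode_openNode (k : NodeKind) (hk : ∃ a, openProg k = certPre (.sym a)) (g : Parser) :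
    match g.openNode k with
    | some g' => runCmds (openProg k) (g.encode zs R) = g'.encode zs R
    | none => (runCmds (openProg k) (g.encode zs R)).1.bad = true := by
  have hbad : (modeOf g.ctx g.phase).allows k = false →
      (runCmds (openProg k) (g.encode zs R)).1.bad = true := fun h =>
    openProg_bad_of_not_allows hk h
  rcases g with ⟨ctx, phase, lits, nodes, blocks, copies, text, rest, cc, sc⟩
  rcases ctx with _ | ⟨p, c, args⟩
  · have : (modeOf Ctx.top phase).allows k = false := by
      rcases phase with (_ | n) | bs | ⟨c, bs⟩ <;> cases k <;> rfl
    cases k <;> exact hbad this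
  · rcases hnm : phase.name? with _ | nm
    · have hlf : ∀ k' ≠ .var, (modeOf (.frame p c args) phase).allows k' = false := by
        intro k' hk'
        rcases phase with (_ | n) | bs | ⟨c', bs⟩
        · simp [Phase.name?] at hnm
        · cases k' <;> rfl
        · simp [Phase.name?] at hnm
        · cases k' <;> simp_all [modeOf, Mode.allows]
      cases k with
      | lit s => cases p <;> simpa [Parser.openNode, hnm] using hbad (hlf _ (by simp))
      | fn => cases p <;> simpa [Parser.openNode, hnm] using hbad (hlf _ (by simp))
      | var =>
        rcases phase with (_ | n) | bs | ⟨c', bs⟩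
        · exact hbad rfl
        · exact hbad rfl
        · exact hbad rfl
        · have h := run_openProg_encode zs R .var
            ⟨.frame p c args, .vname c' bs, lits, nodes, blocks, copies, text, rest, cc, sc⟩ .var
            (truth zs c') bs [] c' (unitsWord c' ++ (Ctx.frame p c args).word (truth zs))
            (by simp [Phase.word, argsWord]) rfl
          simp only [Parser.openNode]
          rw [h]
          simp [Parser.encode, Parser.ctl, modeOf, Mode.allows, NodeKind.frame, Mode.after,
            blockMonitor, Phase.units, Phase.word, Ctx.word, argsWord, unitsWord]
    · have hlf : ∀ k' ≠ .var, (modeOf (.frame p c args) phase).allows k' = true := by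
        intro k' hk'
        rcases phase with (_ | n) | bs | ⟨c', bs⟩
        · cases k' <;> simp_all [modeOf, Mode.allows]
        · simp [Phase.name?] at hnm
        · cases k' <;> simp_all [modeOf, Mode.allows]
        · simp [Phase.name?] at hnm
      have hmode : modeOf .top (.ready 0) = .top := rfl
      have hmode' : ∀ p c args, modeOf (.frame p c args) (.ready 0) = .args := fun _ _ _ => rfl
      have hw : phase.word (truth zs) = bitsWord nm := by
        rcases phase with (_ | n) | bs | ⟨c', bs⟩ <;> simp_all [Phase.name?, Phase.word, bitsWord,
          unitsWord]
      have hu : phase.units = 0 := by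
        rcases phase with (_ | n) | bs | ⟨c', bs⟩ <;> simp_all [Phase.name?, Phase.units]
      have h := fun k => run_openProg_encode zs R k
        ⟨.frame p c args, phase, lits, nodes, blocks, copies, text, rest, cc, sc⟩ p.frameKind
        (truth zs c) nm (args.map Prod.snd) c (unitsWord c ++ p.word (truth zs))
        (by simp [hw, Ctx.word]) hu
      cases k with
      | lit s =>
        cases p with
        | top =>
          simp only [Parser.openNode, hnm, Option.map_some]
          rw [h]
          simp [Parser.encode, Parser.ctl, hlf, NodeKind.frame, Mode.after, Ctx.frameKind,
            blockMonitor, Phase.units, Phase.word, Ctx.word, unitsWord, hmode]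
        | frame p c' args' =>
          simp only [Parser.openNode]
          rw [h]
          simp [NodeKind.frame, Ctx.frameKind]
      | fn =>
        cases p with
        | top =>
          simp only [Parser.openNode]
          rw [h]
          simp [NodeKind.frame, Ctx.frameKind]
        | frame p c' args' =>
          simp only [Parser.openNode, hnm, Option.map_some]
          rw [h]
          simp [Parser.encode, Parser.ctl, hlf, NodeKind.frame, Mode.after, Ctx.frameKind,
            blockMonitor, Phase.units, Phase.word, Ctx.word, unitsWord, hmode',
            argsWord]
      | var =>
        rcases phase with (_ | n) | bs | ⟨c', bs⟩
        · exact hbad rfl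
        · exact hbad rfl
        · exact hbad rfl
        · simp [Phase.name?] at hnm

theorem encode_pre (t : Cert) (g : Parser) :
    match g.pre t with
    | some g' => runCmds (certPre t) (g.encode zs R) = g'.encode zs R
    | none => (runCmds (certPre t) (g.encode zs R)).1.bad = true := by
  have hfail : ∀ s : State Stk Cell Ctl,
      (runCmds [(.upd fun q => { q with bad := true } : VCmd)] s).1.bad = true := fun s => rfl
  rcases t with a | _ | _ | ⟨st, sel⟩ | _ | ⟨b, x⟩
  · cases a with
    | tick => exact hfail _
    | clause => exact hfail _
    | lit p => exact encode_openNode zs R (.lit p) ⟨.lit p, rfl⟩ g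
    | fn => exact encode_openNode zs R .fn ⟨.fn, rfl⟩ g
    | var => exact encode_openNode zs R .var ⟨.var, rfl⟩ g
    | bit b =>
      have h1 : ∀ q : Ctl, ∀ S, runCmds (certPre (.sym (.bit b))) (q, S) =
          (q.goto Mode.bitStep, Function.update S .main (.sym (.bit b) :: S .main)) := by
        intro q S
        rfl
      unfold Parser.encode
      rw [h1]
      rcases g with ⟨_ | ⟨p, c, args⟩, (_ | n) | bs | ⟨c, bs⟩, lits, nodes, blocks, copies, text,
        rest, cc, sc⟩ <;>
      simp [Parser.pre, Ctl.goto, Parser.ctl, modeOf, Mode.bitStep, update_main, Phase.units,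
        stk, Phase.word, bitsWord, unitsWord]
    | close =>
      have h1 := fun q hq => run_lookupProg zs (fun q => if q.mode.isTop then .lit else .fn)
        (fun _ _ => rfl) Mode.closeStep q hq
      rcases g with ⟨_ | ⟨p, c, args⟩, (_ | n) | bs | ⟨c, bs⟩, lits, nodes, blocks, copies, text,
        rest, cc, sc⟩ <;>
      simp only [Parser.pre, certPre, Parser.encode] <;>
      rw [h1 _ rfl] <;>
      simp [Ctl.goto, Parser.ctl, modeOf, Mode.closeStep, Phase.units,
        Phase.word, unitsWord, Ctx.word, argsWord, Mode.isTop, Ctx.frameKind]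
  · have hu : ∀ (q : Ctl) (n : ℕ) (s₃ s₄ s₅ s₆ s₇ s₈ s₉ : List Cell),
        runCmds (certPre .unit) (q, stk ((truthWord zs).drop n) ((truthWord zs).take n).reverse
          s₃ s₄ s₅ s₆ s₇ s₈ s₉) =
        (q.goto Mode.unitStep, stk ((truthWord zs).drop (n + 1))
          ((truthWord zs).take (n + 1)).reverse (.unit :: s₃) s₄ s₅ s₆ s₇ s₈ s₉) := by
      intro q n s₃ s₄ s₅ s₆ s₇ s₈ s₉
      simp only [certPre, runCmds, List.foldl_cons, List.foldl_nil, Cmd.run, Move.run, stk,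
        update_main, update_bits]
      rw [List.tail_drop, List.take_add_one]
      simp only [List.head?_drop]
      cases (truthWord zs)[n]? <;> simp [update_bitsRev]
    unfold Parser.encode
    rw [hu]
    rcases g with ⟨_ | ⟨p, c, args⟩, (_ | n) | bs | ⟨c, bs⟩, lits, nodes, blocks, copies, text,
      rest, cc, sc⟩ <;>
    simp [Parser.pre, Ctl.goto, Parser.ctl, modeOf, Mode.unitStep, Phase.units, Phase.word,
      unitsWord, List.replicate_succ]
  · have h1 := fun q hq => run_lookupProg zs (fun _ => .var)
      (fun _ _ => rfl) Mode.vcloseStep q hq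
    rcases g with ⟨_ | ⟨p, c, args⟩, (_ | n) | bs | ⟨c, bs⟩, lits, nodes, blocks, copies, text,
      rest, cc, sc⟩ <;>
    simp only [Parser.pre, certPre, Parser.encode] <;>
    rw [h1 _ rfl] <;>
    simp [Ctl.goto, Parser.ctl, modeOf, Mode.vcloseStep, Phase.units, Phase.word, unitsWord,
      bitsWord]
  · have h1 : ∀ (q : Ctl) S, runCmds (certPre (.clause st sel)) (q, S) =
        ({ q.check (decide (q.mode = .top)) with
          glb := q.glb.upd st sel q.blk, blk := .init, pend := false },
        if sel then Function.update S .sels (.tick :: S .sels) else S) := by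
      intro q S
      cases sel <;> rfl
    unfold Parser.encode
    rw [h1]
    rcases g with ⟨_ | ⟨p, c, args⟩, (_ | n) | bs | ⟨c, bs⟩, lits, nodes, blocks, copies, text,
      rest, cc, sc⟩ <;>
    simp [Parser.pre, Ctl.check, Parser.ctl, modeOf, Phase.units, Phase.word]
    cases sel <;> simp [blockMonitor, blocksMonitor, update_sels, stk, List.replicate_succ]
  · have h1 : ∀ (q : Ctl) (s₁ s₂ s₃ s₄ s₅ s₆ s₇ s₈ s₉ : List Cell),
        runCmds (certPre .copy) (q, stk s₁ s₂ s₃ s₄ s₅ s₆ s₇ s₈ s₉) =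
        ({ q with
          bad := (q.bad || !(decide (q.mode = .top) && !q.pend)) || !s₇.head?.isNone
          glb := q.glb.copy
          first := false }, stk s₁ s₂ s₃ s₄ s₅ [] (s₆.reverse ++ s₇.tail) (.tick :: s₈) s₉) := by
      intro q s₁ s₂ s₃ s₄ s₅ s₆ s₇ s₈ s₉
      simp only [certPre, runCmds, List.foldl_cons, List.foldl_nil]
      rw [Cmd.run, run_test, run_drain_some (by simp)]
      simp only [stk, update_textRev, update_text, Cmd.run, update_copies]
      rfl
    unfold Parser.encode
    rw [h1]
    rcases g with ⟨_ | ⟨p, c, args⟩, (_ | n) | bs | ⟨c, bs⟩, _ | ⟨l, lits⟩, nodes, blocks, copies,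
      text, rest, cc, sc⟩ <;>
    try simp [Parser.pre, Parser.ctl, modeOf]
    rcases rest with _ | _ | ⟨x, xs⟩ <;>
      simp [Parser.pre, Parser.ctl, modeOf, symWord, Phase.units, Phase.word, List.replicate_succ,
        blocksMonitor, copiesMonitor]
  · exact hfail _

/-- The simulation is exact as long as the parser succeeds. After a failure only the flag `bad`
matters; it is permanent, so the stacks need not be described any more. -/
theorem encode_step (m : Instance.LimitMode) (t : Cert) (g : Parser) :
    match g.step t with
    | some g' =>
      runCmds (verifierProg m (some (.inr (.inl t)))) (g.encode zs R) = g'.encode zs R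
    | none => (runCmds (verifierProg m (some (.inr (.inl t)))) (g.encode zs R)).1.bad = true := by
  have hpre := encode_pre zs R t g
  simp only [verifierProg, runCmds_append, Parser.step]
  rcases hp : g.pre t with _ | g'
  · rw [hp] at hpre
    rcases ht : t.text with _ | a
    · exact hpre
    · exact bad_compare_of_bad a hpre
  · rw [hp] at hpre
    simp only at hpre
    rw [hpre, Option.bind_some]
    rcases ht : t.text with _ | a
    · rfl
    · simp only [Option.elim_some]
      rcases hc : g'.compare a with _ | g''
      · exact encode_compare_none zs R hc
      · exact encode_compare_some zs R hc

theorem encode_stepInput (m : Instance.LimitMode) (a : Sym) (g : Parser) :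
    match g.stepInput m a with
    | some g' => runCmds (verifierProg m (some (.inl a))) (g.encode zs R) = g'.encode zs R
    | none => (runCmds (verifierProg m (some (.inl a))) (g.encode zs R)).1.bad = true := by
  rcases g with ⟨ctx, phase, lits, nodes, blocks, copies, text, rest, cc, sc⟩
  have hbody : ∀ (_ : a ≠ .tick),
      runCmds (inputProg m a)
        ((⟨ctx, phase, lits, nodes, blocks, copies, text, rest, cc, sc⟩ : Parser).encode zs R) =
      (((⟨ctx, phase, lits, nodes, blocks, copies, text, rest, cc, sc⟩ : Parser).ctl zs R).check
        ((symWord text).head?.isNone) |>.check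
          (decide ((symWord (rest.getD [])).head? = some (.sym a))),
        stk ((truthWord zs).drop phase.units) ((truthWord zs).take phase.units).reverse
          (phase.word (truth zs) ++ ctx.word (truth zs)) R [] (symWord text).tail
          (symWord (rest.getD [])).tail (List.replicate cc .tick) (List.replicate sc .tick)) := by
    intro ha
    cases a <;> first
    | exact absurd rfl ha
    | (simp only [inputProg, runCmds, List.foldl_cons, List.foldl_nil, run_test, Parser.encode,
        stk, update_text, update_textRev]; rfl)
  by_cases ha : a = .tick
  · subst ha
    simp only [verifierProg, inputProg, runCmds, List.foldl_cons, List.foldl_nil, run_test,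
      Parser.encode, stk, update_text, update_textRev, update_copies, update_sels]
    rcases text with _ | ⟨y, text⟩
    · rcases rest with _ | _ | ⟨x, xs⟩ <;> rcases cc with _ | cc <;> rcases sc with _ | sc <;>
        cases m <;>
        simp [Parser.stepInput, Ctl.check, symWord, List.replicate_succ, Parser.ctl]
    · simp [Parser.stepInput, Ctl.check, symWord]
  · have hs : (⟨ctx, phase, lits, nodes, blocks, copies, text, rest, cc, sc⟩ :
        Parser).stepInput m a = (match text, rest with
        | [], some (x :: xs) =>
          if x = a then some ⟨ctx, phase, lits, nodes, blocks, copies, text, some xs, cc, sc⟩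
          else none
        | _, _ => none) := by
      cases a <;> first
      | exact absurd rfl ha
      | (rcases text with _ | ⟨y, t⟩ <;> rcases rest with _ | _ | ⟨x, xs⟩ <;> rfl)
    rw [hs]
    simp only [verifierProg]
    rw [hbody ha]
    rcases text with _ | ⟨y, text⟩
    · rcases rest with _ | _ | ⟨x, xs⟩
      · simp [Ctl.check, symWord]
      · simp [Ctl.check, symWord]
      · by_cases hx : x = a
        · simp [Ctl.check, symWord, hx, Parser.encode, Parser.ctl]
        · simp [Ctl.check, symWord, hx]
    · simp [Ctl.check, symWord]

end Simulation

/-! ## Acceptance in terms of the parser -/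

def Cert.truth? : Cert → Option Bool
  | entry b _ => some b
  | _ => none

def Cert.cell? : Cert → Option Cell
  | entry _ x => x
  | _ => none

def Parser.read (y : List Cert) (g : Parser) : Option Parser :=
  y.foldr (fun t g => g.bind fun g => g.step t) (some g)

def Parser.readInput (m : Instance.LimitMode) (w : List Sym) (g : Parser) : Option Parser :=
  w.foldr (fun a g => g.bind fun g => g.stepInput m a) (some g)

/-- The universal certificate is read first and only fixes the two parameters of the encoding; the
parser is still in its initial state. -/
theorem fold_entries (m : Instance.LimitMode) (z : List Cert) :
    z.foldr (fun t s => runCmds (verifierProg m (some (.inr (.inr t)))) s)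
        ((Ctl.init, fun _ => []) : State Stk Cell Ctl) =
      Parser.init.encode (z.filterMap Cert.truth?) (z.filterMap Cert.cell?) := by
  induction z with
  | nil =>
    simp only [List.foldr_nil, List.filterMap_nil, Parser.encode]
    congr 1
    funext k
    cases k <;> rfl
  | cons t z ih =>
    rw [List.foldr_cons, ih]
    have h0 : ∀ t : Cert, t.truth? = none → t.cell? = none → entryProg t = [] →
        runCmds (verifierProg m (some (.inr (.inr t))))
          (Parser.init.encode (z.filterMap Cert.truth?) (z.filterMap Cert.cell?)) =
        Parser.init.encode ((t :: z).filterMap Cert.truth?) ((t :: z).filterMap Cert.cell?) := by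
      intro t h1 h2 h3
      rw [List.filterMap_cons_none h1, List.filterMap_cons_none h2]
      simp [verifierProg, h3, runCmds]
    rcases t with _ | _ | _ | _ | _ | ⟨b, x⟩
    any_goals exact h0 _ rfl rfl rfl
    have hb : (⟨b, x⟩ : Bool × Option Cell).1 = b := rfl
    rw [List.filterMap_cons_some (b := b) (by rfl)]
    generalize List.filterMap Cert.truth? z = zs
    have hm : (decide (1 < zs.count true) || (b && zs.any id)) =
        decide (1 < (b :: zs).count true) := by
      cases b
      · simp
      · have : zs.any id = decide (0 < zs.count true) := by
          rw [Bool.eq_iff_iff]; simp [List.count_pos_iff]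
        simp only [this, Bool.true_and, List.count_cons_self]
        rw [Bool.eq_iff_iff]
        simp only [Bool.or_eq_true, decide_eq_true_eq]
        omega
    rcases x with _ | x
    · rw [List.filterMap_cons_none (by rfl)]
      simp only [verifierProg, entryProg, List.append_nil, runCmds, List.foldl_cons,
        List.foldl_nil, Cmd.run, Parser.encode, update_bits]
      simp only [Parser.ctl, hm]
      simp [Parser.init, modeOf, blockMonitor, blocksMonitor, copiesMonitor, Phase.units,
        truthWord, stk, initial, Bool.or_comm, Phase.word, Ctx.word, unitsWord]
    · rw [List.filterMap_cons_some (b := x) (by rfl)]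
      simp only [verifierProg, entryProg, runCmds, List.foldl_cons, List.cons_append,
        List.foldl_nil, Cmd.run, Parser.encode, update_bits, List.nil_append, update_word]
      simp only [Parser.ctl, hm]
      simp [Parser.init, modeOf, blockMonitor, blocksMonitor, copiesMonitor, Phase.units,
        truthWord, stk, initial, Bool.or_comm, update_word, Phase.word, Ctx.word, unitsWord]

theorem bad_runCmds (m : Instance.LimitMode) (a : Option (Sym ⊕ Cert ⊕ Cert))
    {s : State Stk Cell Ctl} (h : s.1.bad = true) :
    (runCmds (verifierProg m a) s).1.bad = true :=
  bad_runCmds_of_bad m a (fun _ hc => hc) h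

theorem fold_cert (m : Instance.LimitMode) (zs : List Bool) (R : List Cell) (g : Parser)
    (y : List Cert) :
    match g.read y with
    | some g' => y.foldr (fun t s => runCmds (verifierProg m (some (.inr (.inl t)))) s)
        (g.encode zs R) = g'.encode zs R
    | none => (y.foldr (fun t s => runCmds (verifierProg m (some (.inr (.inl t)))) s)
        (g.encode zs R)).1.bad = true := by
  induction y with
  | nil => rfl
  | cons t y ih =>
    have hr : g.read (t :: y) = (g.read y).bind fun g => g.step t := rfl
    rw [hr]
    rcases hg : g.read y with _ | g'
    · rw [hg] at ih
      exact bad_runCmds m _ ih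
    · rw [hg] at ih
      simp only at ih
      rw [Option.bind_some, List.foldr_cons, ih]
      exact encode_step zs R m t g'

theorem fold_input (m : Instance.LimitMode) (zs : List Bool) (R : List Cell) (g : Parser)
    (w : List Sym) :
    match g.readInput m w with
    | some g' => w.foldr (fun t s => runCmds (verifierProg m (some (.inl t))) s)
        (g.encode zs R) = g'.encode zs R
    | none => (w.foldr (fun t s => runCmds (verifierProg m (some (.inl t))) s)
        (g.encode zs R)).1.bad = true := by
  induction w with
  | nil => rfl
  | cons t w ih =>
    have hr : g.readInput m (t :: w) = (g.readInput m w).bind fun g => g.stepInput m t := rfl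
    rw [hr]
    rcases hg : g.readInput m w with _ | g'
    · rw [hg] at ih
      exact bad_runCmds m _ ih
    · rw [hg] at ih
      simp only at ih
      rw [Option.bind_some, List.foldr_cons, ih]
      exact encode_stepInput zs R m t g'

def Parser.accepts (zs : List Bool) (R : List Cell) (g : Parser) : Prop :=
  g.copyCount = 0 ∧ g.selCount = 0 ∧
    (g.ctl zs R).glb.ok (decide (zs.count true = 1)) (initial zs) = true

/-- The run of the parser does not depend on `z`, which enters only through the final test.
Soundness needs this: one and the same parse result is tested against all `z`. -/
theorem verifier_eq_true (m : Instance.LimitMode) (w : List Sym) (y z : List Cert) :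
    verifier m (w, y, z) = true ↔
      ∃ g, (Parser.init.read y).bind (fun g => g.readInput m w) = some g ∧
        g.accepts (z.filterMap Cert.truth?) (z.filterMap Cert.cell?) := by
  have hexec : exec (verifierProg m) Ctl.init (tripleWord (w, y, z)) =
      runCmds (verifierProg m none)
        (w.foldr (fun t s => runCmds (verifierProg m (some (.inl t))) s)
          (y.foldr (fun t s => runCmds (verifierProg m (some (.inr (.inl t)))) s)
            (z.foldr (fun t s => runCmds (verifierProg m (some (.inr (.inr t)))) s)
              ((Ctl.init, fun _ => []) : State Stk Cell Ctl)))) := by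
    simp only [exec, tripleWord, List.foldr_append, List.foldr_map]
  unfold verifier
  rw [hexec, fold_entries]
  generalize List.filterMap Cert.truth? z = zs
  generalize List.filterMap Cert.cell? z = R
  have hbad : ∀ s : State Stk Cell Ctl, s.1.bad = true →
      (runCmds (verifierProg m none) s).1.accepts = false := by
    intro s hs
    simp [Ctl.accepts, bad_runCmds m none hs]
  have hy := fold_cert m zs R Parser.init y
  rcases hg : Parser.init.read y with _ | g
  · rw [hg] at hy
    rw [hbad]
    · simp
    · have : ∀ (w : List Sym) (s : State Stk Cell Ctl), s.1.bad = true →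
          (w.foldr (fun t s => runCmds (verifierProg m (some (.inl t))) s) s).1.bad = true := by
        intro w s hs
        induction w with
        | nil => exact hs
        | cons t w ih => exact bad_runCmds m _ ih
      exact this w _ hy
  · rw [hg] at hy
    simp only at hy
    rw [hy, Option.bind_some]
    have hw := fold_input m zs R g w
    rcases hg' : g.readInput m w with _ | g'
    · rw [hg'] at hw
      rw [hbad _ hw]
      simp
    · rw [hg'] at hw
      simp only at hw
      rw [hw]
      have hone : (zs.any id && !decide (1 < zs.count true)) = decide (zs.count true = 1) := by
        have : zs.any id = decide (0 < zs.count true) := by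
          rw [Bool.eq_iff_iff]; simp [List.count_pos_iff]
        rw [this, Bool.eq_iff_iff]
        simp only [Bool.and_eq_true, Bool.not_eq_true', decide_eq_true_eq,
          decide_eq_false_iff_not]
        omega
      simp only [verifierProg, runCmds, List.foldl_cons, List.foldl_nil, run_test, Parser.encode,
        stk, update_copies, update_sels]
      simp only [Option.some.injEq, exists_eq_left', Parser.accepts, Ctl.accepts, Ctl.check]
      rw [show ((g'.ctl zs R).one && !(g'.ctl zs R).many) = decide (zs.count true = 1) from hone]
      rw [show (g'.ctl zs R).mono = initial zs from rfl]
      rw [show (g'.ctl zs R).bad = false from rfl]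
      rcases g'.copyCount with _ | n <;> rcases g'.selCount with _ | k <;>
        simp [List.replicate_succ]

/-! ## The conditions that the monitors check -/

section Monitor

variable (τ : ℕ → Bool) (R : List Cell)

/-- Every flag of a clause is a disjunction accumulated over its nodes. -/
theorem blockMonitor_field (f : BlockMonitor → Bool) {P : Node → Prop}
    (h0 : f .init = false)
    (h1 : ∀ n m, f (m.upd (τ n.cls) (n.args.any τ) (decide (n.word τ = R)) n.kind) = true ↔
      P n ∨ f m = true) (ns : List Node) :
    f (blockMonitor τ R ns) = true ↔ ∃ n ∈ ns, P n := by
  induction ns with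
  | nil => simp [blockMonitor, h0]
  | cons n ns ih =>
    rw [List.exists_mem_cons_iff, ← ih]
    exact h1 n _

theorem blockMonitor_eq (ns : List Node) : (blockMonitor τ R ns).eq = true ↔
    ∃ n ∈ ns, n.kind ≠ .var ∧ τ n.cls = true ∧ n.word τ = R :=
  blockMonitor_field τ R BlockMonitor.eq rfl (by
    rintro ⟨p | _ | _, nm, as, c⟩ m <;>
      simp [BlockMonitor.upd, BlockMonitor.updShared, or_comm]) ns

theorem blockMonitor_neq (ns : List Node) : (blockMonitor τ R ns).neq = true ↔
    ∃ n ∈ ns, n.kind ≠ .var ∧ τ n.cls = true ∧ n.word τ ≠ R :=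
  blockMonitor_field τ R BlockMonitor.neq rfl (by
    rintro ⟨p | _ | _, nm, as, c⟩ m <;>
      simp [BlockMonitor.upd, BlockMonitor.updShared, or_comm]) ns

theorem blockMonitor_inverted (ns : List Node) : (blockMonitor τ R ns).inverted = true ↔
    ∃ n ∈ ns, n.kind ≠ .var ∧ τ n.cls = false ∧ ∃ c ∈ n.args, τ c = true :=
  blockMonitor_field τ R BlockMonitor.inverted rfl (by
    rintro ⟨p | _ | _, nm, as, c⟩ m <;>
      simp [BlockMonitor.upd, BlockMonitor.updShared, or_comm]) ns

theorem blockMonitor_looped (ns : List Node) : (blockMonitor τ R ns).looped = true ↔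
    ∃ n ∈ ns, n.kind ≠ .var ∧ τ n.cls = true ∧ ∃ c ∈ n.args, τ c = true :=
  blockMonitor_field τ R BlockMonitor.looped rfl (by
    rintro ⟨p | _ | _, nm, as, c⟩ m <;>
      simp [BlockMonitor.upd, BlockMonitor.updShared, or_comm]) ns

theorem blockMonitor_varT (ns : List Node) : (blockMonitor τ R ns).varT = true ↔
    ∃ n ∈ ns, n.kind = .var ∧ n.word τ = R ∧ τ n.cls = true :=
  blockMonitor_field τ R BlockMonitor.varT rfl (by
    rintro ⟨p | _ | _, nm, as, c⟩ m <;>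
      simp [BlockMonitor.upd, BlockMonitor.updShared, or_comm]) ns

theorem blockMonitor_varF (ns : List Node) : (blockMonitor τ R ns).varF = true ↔
    ∃ n ∈ ns, n.kind = .var ∧ n.word τ = R ∧ τ n.cls = false :=
  blockMonitor_field τ R BlockMonitor.varF rfl (by
    rintro ⟨p | _ | _, nm, as, c⟩ m <;>
      simp [BlockMonitor.upd, BlockMonitor.updShared, or_comm]) ns

theorem blockMonitor_pos (ns : List Node) : (blockMonitor τ R ns).pos = true ↔
    ∃ n ∈ ns, n.kind = .lit true ∧ τ n.cls = true :=
  blockMonitor_field τ R BlockMonitor.pos rfl (by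
    rintro ⟨p | _ | _, nm, as, c⟩ m <;>
      simp [BlockMonitor.upd, BlockMonitor.updShared, or_comm, and_comm]) ns

theorem blockMonitor_neg (ns : List Node) : (blockMonitor τ R ns).neg = true ↔
    ∃ n ∈ ns, n.kind = .lit false ∧ τ n.cls = true :=
  blockMonitor_field τ R BlockMonitor.neg rfl (by
    rintro ⟨p | _ | _, nm, as, c⟩ m <;>
      simp [BlockMonitor.upd, BlockMonitor.updShared, or_comm, and_comm]) ns

theorem blockMonitor_sat (ns : List Node) : (blockMonitor τ R ns).sat = true ↔
    ∃ n ∈ ns, n.kind = .lit (τ n.cls) :=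
  blockMonitor_field τ R BlockMonitor.sat rfl (by
    rintro ⟨p | _ | _, nm, as, c⟩ m <;>
      simp [BlockMonitor.upd, BlockMonitor.updShared]
    grind) ns

/-- The part of a monitor that does not depend on the division into copies. -/
def Monitor.core (g : Monitor) : Monitor := { g with start := false, startHere := false }

/-- Apart from the two start flags, the update never looks at copy boundaries, so the copies may be
concatenated before the other flags are computed. -/
theorem core_blocksMonitor (bs : List Block) (g : Monitor) :
    (blocksMonitor τ R g bs).core = (blocksMonitor τ R g.core bs).core := by
  induction bs with
  | nil => rfl
  | cons b bs ih =>
    have h : ∀ s t m (g g' : Monitor), g.core = g'.core →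
        (g.upd s t m).core = (g'.upd s t m).core := by
      rintro s t m ⟨⟩ ⟨⟩ h
      simp only [Monitor.core, Monitor.mk.injEq] at h
      simp [Monitor.core, Monitor.upd, h]
    exact h _ _ _ _ _ ih

theorem core_copiesMonitor (cs : List (List Block)) :
    (copiesMonitor τ R cs).core = (blocksMonitor τ R .init cs.flatten).core := by
  induction cs with
  | nil => rfl
  | cons bs cs ih =>
    rw [show (copiesMonitor τ R (bs :: cs)).core =
      (blocksMonitor τ R (copiesMonitor τ R cs) bs).core from rfl, core_blocksMonitor, ih,
      ← core_blocksMonitor]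
    simp only [blocksMonitor, List.flatten_cons, List.foldr_append]

theorem copiesMonitor_field (f : Monitor → Bool) (hf : ∀ g, f g.core = f g)
    (h0 : f .init = false) {P : Block → Prop}
    (h1 : ∀ b g, f (g.upd b.isStart b.selected (blockMonitor τ R b.nodes)) = true ↔
      P b ∨ f g = true) (cs : List (List Block)) :
    f (copiesMonitor τ R cs) = true ↔ ∃ bs ∈ cs, ∃ b ∈ bs, P b := by
  rw [← hf, core_copiesMonitor, hf]
  have : ∀ l : List Block, f (blocksMonitor τ R .init l) = true ↔ ∃ b ∈ l, P b := by
    intro l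
    induction l with
    | nil => simp [blocksMonitor, h0]
    | cons b bs ih =>
      rw [List.exists_mem_cons_iff, ← ih]
      exact h1 b _
  rw [this]
  simp only [List.mem_flatten]
  constructor
  · rintro ⟨b, ⟨bs, h1, h2⟩, h3⟩
    exact ⟨bs, h1, b, h2, h3⟩
  · rintro ⟨bs, h1, b, h2, h3⟩
    exact ⟨b, ⟨bs, h1, h2⟩, h3⟩

/-- Every copy overwrites `start`. As reading goes from right to left, the leftmost copy, the one
with index `0`, has the last word. -/
theorem copiesMonitor_start (bs : List Block) (cs : List (List Block)) :
    (copiesMonitor τ R (bs :: cs)).start = bs.any fun b => b.isStart && b.selected := by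
  have h0 : ∀ cs, (copiesMonitor τ R cs).startHere = false := by
    intro cs
    cases cs <;> rfl
  have h1 : ∀ (g : Monitor) bs, (blocksMonitor τ R g bs).startHere =
      (g.startHere || bs.any fun b => b.isStart && b.selected) := by
    intro g bs
    induction bs with
    | nil => simp [blocksMonitor]
    | cons b bs ih =>
      change ((blocksMonitor τ R g bs).startHere || _) = _
      rw [ih, List.any_cons, Bool.or_assoc, Bool.or_comm (bs.any _)]
  change (blocksMonitor τ R (copiesMonitor τ R cs) bs).startHere = _
  rw [h1, h0, Bool.false_or]

/-- Two bits suffice to require a partner in a different copy. `seen` records a possible partner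
among the copies read; `need` records an unserved request, and any later selected copy with a
partner serves all earlier requests at once. The statement uses distinct indices because different
copies may be equal as blocks. -/
theorem copiesMonitor_need {ι : Type} (need seen : Monitor → Bool) (here other : Block → Bool)
    (hneed : ∀ g, need g.core = need g)
    (h0 : need .init = false) (h0' : seen .init = false)
    (h1 : ∀ b g, need (g.upd b.isStart b.selected (blockMonitor τ R b.nodes)) =
      if b.selected then (need g && !other b) || (here b && !seen g) else need g)
    (h2 : ∀ b g, seen (g.upd b.isStart b.selected (blockMonitor τ R b.nodes)) =
      (seen g || (b.selected && other b)))
    (l : List ι) (hl : l.Nodup) (B : ι → Block) (cs : List (List Block))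
    (hcs : cs.flatten = l.map B) :
    need (copiesMonitor τ R cs) = false ↔ ∀ i ∈ l, (B i).selected = true → here (B i) = true →
      ∃ j ∈ l, j ≠ i ∧ (B j).selected = true ∧ other (B j) = true := by
  rw [← hneed, core_copiesMonitor, hneed, hcs]
  have hs : ∀ l : List ι, seen (blocksMonitor τ R .init (l.map B)) = true ↔
      ∃ j ∈ l, (B j).selected = true ∧ other (B j) = true := by
    intro l
    induction l with
    | nil => simp [blocksMonitor, h0']
    | cons i l ih =>
      change seen ((blocksMonitor τ R .init (l.map B)).upd _ _ _) = true ↔ _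
      rw [h2, List.exists_mem_cons_iff, ← ih]
      simp [or_comm]
  clear hcs
  induction l with
  | nil => simp [blocksMonitor, h0]
  | cons i l ih =>
    obtain ⟨hi, hl⟩ := List.nodup_cons.1 hl
    replace ih : _ ↔ _ := ih hl
    have hs := hs l
    change need ((blocksMonitor τ R .init (l.map B)).upd _ _ _) = false ↔ _
    rw [h1]
    by_cases hsel : (B i).selected = true
    · rw [if_pos hsel, Bool.or_eq_false_iff, Bool.and_eq_false_iff, Bool.and_eq_false_iff, ih]
      simp only [Bool.not_eq_false', hs, List.mem_cons, forall_eq_or_imp, exists_eq_or_imp, hsel,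
        true_and, ne_eq, not_true_eq_false, false_and, false_or, forall_true_left]
      have hne : ∀ j ∈ l, j ≠ i := fun j hj h => hi (h ▸ hj)
      constructor
      · rintro ⟨ha, hb⟩
        refine ⟨fun hh => ?_, fun j hj hj1 hj2 => ?_⟩
        · rcases hb with hb | ⟨j, hj, hj'⟩
          · simp [hb] at hh
          · exact ⟨j, hj, hne j hj, hj'⟩
        · rcases ha with ha | ha
          · exact .inr (ha j hj hj1 hj2)
          · exact .inl ⟨(hne j hj).symm, ha⟩
      · rintro ⟨ha, hb⟩
        refine ⟨?_, ?_⟩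
        · by_cases ho : other (B i) = true
          · exact .inr ho
          · refine .inl fun j hj hj1 hj2 => ?_
            rcases hb j hj hj1 hj2 with h | h
            · exact absurd h.2 ho
            · exact h
        · by_cases hh : here (B i) = true
          · obtain ⟨j, hj, -, hj'⟩ := ha hh
            exact .inr ⟨j, hj, hj'⟩
          · exact .inl (by simpa using hh)
    · rw [if_neg hsel, ih]
      simp [hsel]

/-- The conditions on a family of clause copies that are checked for the truth values `τ` and the
word `R`. -/
structure Passes {n d : ℕ} (B : Fin n × Fin d → Block) (τ : ℕ → Bool) (single mono : Prop)
    (R : List Cell) : Prop where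
  sameWord : single → ∀ c c', ∀ a ∈ (B c).nodes, ∀ a' ∈ (B c').nodes, a.kind ≠ .var →
    a'.kind ≠ .var → τ a.cls = true → τ a'.cls = true → a.word τ = R → a'.word τ = R
  notLooped : single → ∀ c, ∀ a ∈ (B c).nodes, a.kind ≠ .var → τ a.cls = true → ∀ k ∈ a.args,
    τ k = false
  notInverted : mono → ∀ c, ∀ a ∈ (B c).nodes, a.kind ≠ .var → τ a.cls = false → ∀ k ∈ a.args,
    τ k = false
  sameVar : ∀ c, ∀ a ∈ (B c).nodes, ∀ a' ∈ (B c).nodes, a.kind = .var → a'.kind = .var →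
    a.word τ = R → a'.word τ = R → τ a.cls = true → τ a'.cls = true
  connected : ∀ p c, (B c).selected = true → (∃ a ∈ (B c).nodes, a.kind = .lit p ∧ τ a.cls = true) →
    ∃ c', c' ≠ c ∧ (B c').selected = true ∧ ∃ a ∈ (B c').nodes, a.kind = .lit (!p) ∧ τ a.cls = true
  falsified : ∃ c, (B c).selected = true ∧ ∀ a ∈ (B c).nodes, a.kind ≠ .lit (τ a.cls)
  start : ∃ c, c.2.val = 0 ∧ (B c).isStart = true ∧ (B c).selected = true

/-- The outer list runs over the copy numbers and the inner one over the clauses, which is the order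
of a certificate; every pair of indices occurs exactly once in the concatenation. -/
theorem copiesMonitor_ok {n d : ℕ} (B : Fin n × Fin d → Block) (τ : ℕ → Bool) (single mono : Bool)
    (R : List Cell) :
    (copiesMonitor τ R (List.ofFn fun k : Fin d => List.ofFn fun j : Fin n => B (j, k))).ok
      single mono = true ↔ Passes B τ (single = true) (mono = true) R := by
  have hmem : ∀ P : Block → Prop, (∃ bs ∈ (List.ofFn fun k : Fin d => List.ofFn fun j : Fin n =>
      B (j, k)), ∃ b ∈ bs, P b) ↔ ∃ c, P (B c) := by
    intro P
    simp only [List.mem_ofFn]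
    constructor
    · rintro ⟨-, ⟨k, rfl⟩, b, hb, h⟩
      obtain ⟨j, rfl⟩ := List.mem_ofFn.1 hb
      exact ⟨_, h⟩
    · rintro ⟨⟨j, k⟩, h⟩
      exact ⟨_, ⟨k, rfl⟩, _, List.mem_ofFn.2 ⟨j, rfl⟩, h⟩
  have hflat : (List.ofFn fun k : Fin d => List.ofFn fun j : Fin n => B (j, k)).flatten =
      ((List.finRange d).flatMap fun k => (List.finRange n).map fun j => (j, k)).map B := by
    rw [List.map_flatMap]
    simp only [List.map_map, List.ofFn_eq_map, List.flatMap]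
    rfl
  have hnd : ((List.finRange d).flatMap fun k =>
      (List.finRange n).map fun j : Fin n => (j, k)).Nodup := by
    rw [List.nodup_flatMap]
    refine ⟨fun k _ => (List.nodup_finRange n).map fun a b h => (Prod.ext_iff.1 h).1, ?_⟩
    refine (List.nodup_finRange d).imp fun {a b} hab => ?_
    intro x hx hx'
    simp only [List.mem_map, List.mem_finRange, true_and] at hx hx'
    obtain ⟨j, rfl⟩ := hx
    obtain ⟨j', h⟩ := hx'
    exact hab (Prod.ext_iff.1 h).2.symm
  have hall : ∀ c, c ∈ (List.finRange d).flatMap fun k =>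
      (List.finRange n).map fun j : Fin n => (j, k) := by
    rintro ⟨j, k⟩
    simp
  set cs := List.ofFn fun k : Fin d => List.ofFn fun j : Fin n => B (j, k) with hcs
  have heq := (copiesMonitor_field τ R Monitor.eq (fun _ => rfl) rfl
    (P := fun b => (blockMonitor τ R b.nodes).eq = true)
    (fun b g => by simp [Monitor.upd, or_comm]) cs).trans (hmem _)
  have hneq := (copiesMonitor_field τ R Monitor.neq (fun _ => rfl) rfl
    (P := fun b => (blockMonitor τ R b.nodes).neq = true)
    (fun b g => by simp [Monitor.upd, or_comm]) cs).trans (hmem _)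
  have hinv := (copiesMonitor_field τ R Monitor.inverted (fun _ => rfl) rfl
    (P := fun b => (blockMonitor τ R b.nodes).inverted = true)
    (fun b g => by simp [Monitor.upd, or_comm]) cs).trans (hmem _)
  have hloop := (copiesMonitor_field τ R Monitor.looped (fun _ => rfl) rfl
    (P := fun b => (blockMonitor τ R b.nodes).looped = true)
    (fun b g => by simp [Monitor.upd, or_comm]) cs).trans (hmem _)
  have hviol := (copiesMonitor_field τ R Monitor.viol (fun _ => rfl) rfl
    (P := fun b => (blockMonitor τ R b.nodes).varT = true ∧
      (blockMonitor τ R b.nodes).varF = true)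
    (fun b g => by simp [Monitor.upd, or_comm]) cs).trans (hmem _)
  have hfals := (copiesMonitor_field τ R Monitor.falsified (fun _ => rfl) rfl
    (P := fun b => b.selected = true ∧ ¬ (blockMonitor τ R b.nodes).sat = true)
    (fun b g => by simp [Monitor.upd, or_comm]) cs).trans (hmem _)
  have hnP := copiesMonitor_need τ R Monitor.needP Monitor.seenP
    (fun b => (blockMonitor τ R b.nodes).neg) (fun b => (blockMonitor τ R b.nodes).pos)
    (fun _ => rfl) rfl rfl (fun _ _ => rfl) (fun _ _ => rfl) _ hnd B cs hflat
  have hnN := copiesMonitor_need τ R Monitor.needN Monitor.seenN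
    (fun b => (blockMonitor τ R b.nodes).pos) (fun b => (blockMonitor τ R b.nodes).neg)
    (fun _ => rfl) rfl rfl (fun _ _ => rfl) (fun _ _ => rfl) _ hnd B cs hflat
  have hst : (copiesMonitor τ R cs).start = true ↔
      ∃ c : Fin n × Fin d, c.2.val = 0 ∧ (B c).isStart = true ∧ (B c).selected = true := by
    rcases d with _ | d
    · simp only [hcs, List.ofFn_zero, copiesMonitor, Monitor.init]
      simp
    · simp only [hcs, List.ofFn_succ (n := d), copiesMonitor_start, List.any_eq_true,
        Bool.and_eq_true]
      constructor
      · rintro ⟨b, hb, h⟩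
        obtain ⟨j, rfl⟩ := List.mem_ofFn.1 hb
        exact ⟨(j, 0), rfl, h⟩
      · rintro ⟨⟨j, k⟩, hk, h⟩
        obtain rfl : k = 0 := Fin.ext hk
        exact ⟨_, List.mem_ofFn.2 ⟨j, rfl⟩, h⟩
  clear_value cs
  simp only [blockMonitor_eq, blockMonitor_neq, blockMonitor_inverted, blockMonitor_looped,
    blockMonitor_varT, blockMonitor_varF, blockMonitor_pos, blockMonitor_neg,
    blockMonitor_sat, hall, true_and, forall_true_left] at heq hneq hinv hloop hviol hfals hnP hnN
  simp only [Monitor.ok, Bool.and_eq_true, Bool.not_eq_true', Bool.and_eq_false_imp]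
  rw [hnP, hnN, hst, hfals, ← Bool.not_eq_true, ← Bool.not_eq_true, ← Bool.not_eq_true,
    ← Bool.not_eq_true, hneq, hviol, hloop, hinv, heq]
  constructor
  · rintro ⟨⟨⟨⟨⟨⟨⟨h1, h2⟩, h3⟩, h4⟩, h5⟩, h6⟩, ⟨c, h7, h7'⟩⟩, h8⟩
    refine ⟨?_, ?_, ?_, ?_, ?_, ?_, h8⟩
    · intro hs c c' a ha a' ha' hk hk' ht ht' hw
      by_contra hw'
      exact h1 ⟨hs, c, a, ha, hk, ht, hw⟩ ⟨c', a', ha', hk', ht', hw'⟩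
    · intro hs c a ha hk ht k hkm
      by_contra hc
      exact h2 hs ⟨c, a, ha, hk, ht, k, hkm, by simpa using hc⟩
    · intro hs c a ha hk ht k hkm
      by_contra hc
      exact h3 hs ⟨c, a, ha, hk, ht, k, hkm, by simpa using hc⟩
    · intro c a ha a' ha' hk hk' hw hw' ht
      by_contra hc
      exact h4 ⟨c, ⟨a, ha, hk, hw, ht⟩, ⟨a', ha', hk', hw', by simpa using hc⟩⟩
    · intro p c hs h
      cases p
      · exact h5 c hs h
      · exact h6 c hs h
    · exact ⟨c, h7, fun a ha hk => h7' ⟨a, ha, hk⟩⟩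
  · rintro ⟨h1, h2, h3, h4, h5, ⟨c, h7, h7'⟩, h8⟩
    refine ⟨⟨⟨⟨⟨⟨⟨?_, ?_⟩, ?_⟩, ?_⟩, h5 false⟩, h5 true⟩, ⟨c, h7, ?_⟩⟩, h8⟩
    · rintro ⟨hs, c, a, ha, hk, ht, hw⟩ ⟨c', a', ha', hk', ht', hw'⟩
      exact hw' (h1 hs c c' a ha a' ha' hk hk' ht ht' hw)
    · rintro hs ⟨c, a, ha, hk, ht, k, hkm, hc⟩
      simp [h2 hs c a ha hk ht k hkm] at hc
    · rintro hs ⟨c, a, ha, hk, ht, k, hkm, hc⟩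
      simp [h3 hs c a ha hk ht k hkm] at hc
    · rintro ⟨c, ⟨a, ha, hk, hw, ht⟩, ⟨a', ha', hk', hw', hf⟩⟩
      simp [h4 c a ha a' ha' hk hk' hw hw' ht] at hf
    · rintro ⟨a, ha, hk⟩
      exact h7' a ha hk

end Monitor

/-! ## Terms and literals with lists of arguments -/

theorem func_congr {V : Type} {m n : ℕ} (h : m = n) (f : Name) (a : Fin m → Tm V)
    (b : Fin n → Tm V) (hab : ∀ i, a i = b (Fin.cast h i)) :
    (FirstOrder.Language.Term.func (L := sig) (l := m) f a : Tm V) =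
      FirstOrder.Language.Term.func (L := sig) (l := n) f b := by
  subst h
  congr
  funext i
  exact hab i

theorem mkFn_ofFn {V : Type} {n : ℕ} (f : sig.Functions n) (ts : Fin n → Tm V) :
    mkFn f (List.ofFn ts) = FirstOrder.Language.Term.func (L := sig) f ts :=
  func_congr (List.length_ofFn) f _ _ fun i => by simp; rfl

theorem Literal.congr {V : Type} (p : Bool) {m n : ℕ} (h : m = n) (f : Name) (a : Fin m → Tm V)
    (b : Fin n → Tm V) (hab : ∀ i, a i = b (Fin.cast h i)) :
    (⟨p, (f : sig.Relations m), a⟩ : Literal V) = ⟨p, (f : sig.Relations n), b⟩ := by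
  subst h
  congr
  funext i
  exact hab i

theorem Literal.ofList_ofFn {V : Type} (L : Literal V) :
    Literal.ofList L.positive L.pred (List.ofFn L.args) = L :=
  Literal.congr L.positive (List.length_ofFn) L.pred _ _ fun i => by simp; rfl

/-- Induction with argument lists in place of functions on `Fin n` fits the words, which are
concatenations over lists. -/
theorem Tm.induction {V : Type} {P : Tm V → Prop} (var : ∀ x, P (.var x))
    (fn : ∀ (f : Name) (l : List (Tm V)), (∀ t ∈ l, P t) → P (mkFn f l)) (t : Tm V) : P t := by
  induction t with
  | var x => exact var x
  | func f ts ih =>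
    refine Eq.mp (congrArg P (mkFn_ofFn f ts)) (fn f (List.ofFn ts) fun t ht => ?_)
    obtain ⟨i, rfl⟩ := List.mem_ofFn.1 ht
    exact ih i

theorem Literal.exists_eq_ofList {V : Type} (L : Literal V) :
    ∃ (p : Bool) (f : Name) (l : List (Tm V)), L = Literal.ofList p f l :=
  ⟨_, _, _, L.ofList_ofFn.symm⟩

theorem mkFn_subst {V W : Type} (σ : V → Tm W) (f : Name) (l : List (Tm V)) :
    (mkFn f l).subst σ = mkFn f (l.map fun t => t.subst σ) := by
  refine func_congr (List.length_map _).symm f _ _ fun i => ?_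
  simp

theorem mkFn_relabel {V W : Type} (σ : V → W) (f : Name) (l : List (Tm V)) :
    (mkFn f l).relabel σ = mkFn f (l.map fun t => t.relabel σ) := by
  refine func_congr (List.length_map _).symm f _ _ fun i => ?_
  simp

theorem Literal.subst_ofList {V W : Type} (σ : V → Tm W) (p : Bool) (f : Name)
    (l : List (Tm V)) :
    (Literal.ofList p f l).subst σ = Literal.ofList p f (l.map fun t => t.subst σ) := by
  refine Literal.congr p (List.length_map _).symm f _ _ fun i => ?_
  simp
  rfl

theorem Literal.rename_ofList {V W : Type} (σ : V → W) (p : Bool) (f : Name)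
    (l : List (Tm V)) :
    (Literal.ofList p f l).rename σ = Literal.ofList p f (l.map fun t => t.relabel σ) := by
  refine Literal.congr p (List.length_map _).symm f _ _ fun i => ?_
  simp
  rfl

theorem mkFn_injective {V : Type} {f f' : Name} {l l' : List (Tm V)}
    (h : mkFn f l = mkFn f' l') : f = f' ∧ l = l' := by
  unfold mkFn at h
  injection h with h1 h2 h3
  refine ⟨h2, ?_⟩
  apply List.ext_get h1
  intro i hi hi'
  have : ∀ {m n : ℕ} (a : Fin m → Tm V) (b : Fin n → Tm V), m = n → a ≍ b →
      ∀ (i : ℕ) (hi : i < m) (hi' : i < n), a ⟨i, hi⟩ = b ⟨i, hi'⟩ := by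
    intro m n a b hmn hab i hi hi'
    subst hmn
    rw [eq_of_heq hab]
  exact this _ _ h1 h3 i hi hi'

theorem writeTerm_mkFn (f : Name) (l : List (Tm Name)) :
    writeTerm (mkFn f l) = .fn :: (f.map Sym.bit ++ l.flatMap writeTerm ++ [.close]) := by
  have : (List.ofFn fun i => writeTerm (l.get i)) = l.map writeTerm := by
    apply List.ext_get <;> simp
  rw [List.flatMap, ← this]
  rfl

theorem writeLiteral_ofList (p : Bool) (f : Name) (l : List (Tm Name)) :
    writeLiteral (.ofList p f l) =
      .lit p :: (f.map Sym.bit ++ l.flatMap writeTerm ++ [.close]) := by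
  have : (List.ofFn fun i => writeTerm (l.get i)) = l.map writeTerm := by
    apply List.ext_get <;> simp
  rw [List.flatMap, ← this]
  rfl

/-! ## Clauses are determined by their written form -/

/-- The state of a reader of plain clauses: the bits of a name, the arguments of the open nodes, the
literals of the current clause and the clauses. -/
structure Reader : Type where
  bits : List Bool
  frames : List (List (Tm Name))
  lits : List (Literal Name)
  clauses : List InputClause

def Reader.step (a : Sym) (r : Reader) : Reader :=
  match a with
  | .bit b => { r with bits := b :: r.bits }
  | .close => { r with bits := [], frames := [] :: r.frames }
  | .var => match r.frames with
    | fr :: frs => { r with bits := [], frames := (.var r.bits :: fr) :: frs }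
    | [] => r
  | .fn => match r.frames with
    | args :: fr :: frs => { r with bits := [], frames := (mkFn r.bits args :: fr) :: frs }
    | _ => r
  | .lit p => match r.frames with
    | args :: frs =>
      { r with bits := [], frames := frs, lits := .ofList p r.bits args :: r.lits }
    | _ => r
  | .clause st => { r with lits := [], clauses := ⟨st, r.lits⟩ :: r.clauses }
  | .tick => r

theorem Reader.bits_step (bs : List Bool) (cs : List Bool) (frs lits clauses) :
    (bs.map Sym.bit).foldr Reader.step ⟨cs, frs, lits, clauses⟩ =
      ⟨bs ++ cs, frs, lits, clauses⟩ := by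
  induction bs with
  | nil => rfl
  | cons b bs ih => rw [List.map_cons, List.foldr_cons, ih]; rfl

theorem Reader.term_step (t : Tm Name) : ∀ (fr : List (Tm Name)) (frs lits clauses),
    (writeTerm t).foldr Reader.step ⟨[], fr :: frs, lits, clauses⟩ =
      ⟨[], (t :: fr) :: frs, lits, clauses⟩ := by
  induction t using Tm.induction with
  | var x =>
    intro fr frs lits clauses
    rw [writeTerm, List.foldr_cons, Reader.bits_step]
    simp [Reader.step]
  | fn f l ih =>
    intro fr frs lits clauses
    have h : ∀ (l : List (Tm Name)), (∀ t ∈ l, ∀ (fr : List (Tm Name)) (frs lits clauses),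
        (writeTerm t).foldr Reader.step ⟨[], fr :: frs, lits, clauses⟩ =
        ⟨[], (t :: fr) :: frs, lits, clauses⟩) → ∀ fr frs,
        (l.flatMap writeTerm).foldr Reader.step ⟨[], fr :: frs, lits, clauses⟩ =
        ⟨[], (l ++ fr) :: frs, lits, clauses⟩ := by
      intro l hl fr frs
      induction l with
      | nil => rfl
      | cons t l ihl =>
        rw [List.flatMap_cons, List.foldr_append, ihl fun t ht => hl t (List.mem_cons_of_mem _ ht),
          hl t List.mem_cons_self]
        rfl
    rw [writeTerm_mkFn, List.foldr_cons, List.append_assoc, List.foldr_append,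
      List.foldr_append, List.foldr_cons, List.foldr_nil]
    rw [show Reader.step .close ⟨[], fr :: frs, lits, clauses⟩ =
      ⟨[], [] :: fr :: frs, lits, clauses⟩ from rfl, h l ih, Reader.bits_step]
    simp [Reader.step]

theorem Reader.terms_step (l : List (Tm Name)) (fr : List (Tm Name)) (frs lits clauses) :
    (l.flatMap writeTerm).foldr Reader.step ⟨[], fr :: frs, lits, clauses⟩ =
      ⟨[], (l ++ fr) :: frs, lits, clauses⟩ := by
  induction l with
  | nil => rfl
  | cons t l ihl =>
    rw [List.flatMap_cons, List.foldr_append, ihl, Reader.term_step]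
    rfl

theorem Reader.literals_step (l : List (Literal Name)) (lits clauses) :
    ((l.map writeLiteral).flatten).foldr Reader.step ⟨[], [], lits, clauses⟩ =
      ⟨[], [], l ++ lits, clauses⟩ := by
  induction l with
  | nil => rfl
  | cons L l ih =>
    rw [List.map_cons, List.flatten_cons, List.foldr_append, ih]
    obtain ⟨p, f, ts, rfl⟩ := L.exists_eq_ofList
    rw [writeLiteral_ofList, List.foldr_cons, List.append_assoc, List.foldr_append,
      List.foldr_append, List.foldr_cons, List.foldr_nil]
    rw [show Reader.step .close ⟨[], [], l ++ lits, clauses⟩ =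
      ⟨[], [[]], l ++ lits, clauses⟩ from rfl, Reader.terms_step, Reader.bits_step]
    simp [Reader.step]

theorem Reader.clauses_step (l : List InputClause) :
    ((l.map writeClause).flatten).foldr Reader.step ⟨[], [], [], []⟩ = ⟨[], [], [], l⟩ := by
  induction l with
  | nil => rfl
  | cons C l ih =>
    rw [List.map_cons, List.flatten_cons, List.foldr_append, ih, writeClause, List.foldr_cons,
      Reader.literals_step]
    simp [Reader.step]

/-- The reader recovers the clauses from right to left: `close` opens a frame, and the opening
symbol takes the arguments collected in it. Consequently copies with the same text are copies of the
same clauses. -/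
theorem writeClauses_injective {l l' : List InputClause}
    (h : (l.map writeClause).flatten = (l'.map writeClause).flatten) : l = l' := by
  have h1 := Reader.clauses_step l
  rw [h, Reader.clauses_step] at h1
  exact (congrArg Reader.clauses h1).symm

/-! ## Invariants of the parser -/

/-- The nodes in `ns` say that the term has class `c`. -/
inductive Derives (ns : List Node) : Tm Name → ℕ → Prop
  | var (x : Name) (c : ℕ) : ⟨.var, x, [], c⟩ ∈ ns → Derives ns (.var x) c
  | fn (f : Name) (l : List (Tm Name × ℕ)) (c : ℕ) : ⟨.fn, f, l.map Prod.snd, c⟩ ∈ ns →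
      (∀ q ∈ l, Derives ns q.1 q.2) → Derives ns (mkFn f (l.map Prod.fst)) c

theorem Derives.mono {ns ns' : List Node} (h : ns ⊆ ns') {t : Tm Name} {c : ℕ}
    (ht : Derives ns t c) : Derives ns' t c := by
  induction ht with
  | var x c hx => exact .var x c (h hx)
  | fn f l c hf _ ih => exact .fn f l c (h hf) ih

structure LitDerives (ns : List Node) (q : Literal Name × ℕ) : Prop where
  exists_node : ∃ (p : Bool) (f : Name) (l : List (Tm Name × ℕ)),
    q.1 = Literal.ofList p f (l.map Prod.fst) ∧
    ⟨.lit p, f, l.map Prod.snd, q.2⟩ ∈ ns ∧ ∀ r ∈ l, Derives ns r.1 r.2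

theorem LitDerives.mono {ns ns' : List Node} (h : ns ⊆ ns') {q : Literal Name × ℕ}
    (hq : LitDerives ns q) : LitDerives ns' q := by
  obtain ⟨p, f, l, h1, h2, h3⟩ := hq.exists_node
  exact ⟨p, f, l, h1, h h2, fun r hr => (h3 r hr).mono h⟩

/-- The nodes account for the literals, and their classes and words have size at most `N`. -/
structure WellAnnotated (N : ℕ) (lits : List (Literal Name × ℕ)) (ns : List Node) : Prop where
  lit : ∀ q ∈ lits, LitDerives ns q
  node : ∀ a ∈ ns, ∀ p, a.kind = .lit p → ∃ q ∈ lits, q.1.positive = p ∧ q.2 = a.cls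
  var : ∀ a ∈ ns, a.kind = .var → a.args = []
  cls : ∀ a ∈ ns, a.cls < N
  word : ∀ a ∈ ns, (a.word fun _ => false).length ≤ N

theorem WellAnnotated.mono {N N' : ℕ} (hN : N ≤ N') {lits : List (Literal Name × ℕ)}
    {ns : List Node} (h : WellAnnotated N lits ns) : WellAnnotated N' lits ns :=
  ⟨h.lit, h.node, h.var, fun a ha => (h.cls a ha).trans_le hN,
    fun a ha => (h.word a ha).trans hN⟩

def Ctx.Holds (ns : List Node) : Ctx → Prop
  | top => True
  | frame p _ args => p.Holds ns ∧ ∀ q ∈ args, Derives ns q.1 q.2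

theorem Ctx.Holds.mono {ns ns' : List Node} (h : ns ⊆ ns') {x : Ctx} (hx : x.Holds ns) :
    x.Holds ns' := by
  induction x with
  | top => trivial
  | frame p c args ih => exact ⟨ih hx.1, fun q hq => (hx.2 q hq).mono h⟩

def Phase.write : Phase → List Sym
  | ready _ => []
  | name bs => bs.map Sym.bit
  | vname _ bs => bs.map Sym.bit

def Ctx.write : Ctx → List Sym
  | top => []
  | frame p _ args => (args.map Prod.fst).flatMap writeTerm ++ .close :: p.write

def writeLits (l : List (Literal Name × ℕ)) : List Sym := ((l.map Prod.fst).map writeLiteral).flatten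

def Block.strip (b : Block) : InputClause := ⟨b.isStart, b.lits.map Prod.fst⟩

def writeBlocks (bs : List Block) : List Sym := ((bs.map Block.strip).map writeClause).flatten

def selected (bs : List Block) : ℕ := (bs.map fun b => b.selected.toNat).sum

/-- The invariant of the parser after `N` symbols, when the symbols `a` are still to be compared
with the previous copy. -/
structure Parser.Valid (N : ℕ) (a : List Sym) (g : Parser) : Prop where
  text : a ++ g.text = g.phase.write ++ g.ctx.write ++ writeLits g.lits ++ writeBlocks g.blocks
  rest : ∀ r, g.rest = some r → ∀ bs ∈ g.copies, writeBlocks bs = r.reverse ++ g.text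
  no_rest : g.rest = none → g.copies = []
  ctx : g.ctx.Holds g.nodes
  cur : WellAnnotated N g.lits g.nodes
  blocks : ∀ b ∈ g.blocks, WellAnnotated N b.lits b.nodes
  copies : ∀ bs ∈ g.copies, ∀ b ∈ bs, WellAnnotated N b.lits b.nodes
  len : (g.phase.word fun _ => false).length + (g.ctx.word fun _ => false).length ≤ N
  copyCount : g.copyCount = g.copies.length
  selCount : g.selCount = selected g.blocks + (g.copies.map selected).sum

theorem Parser.valid_init : Parser.init.Valid 0 [] where
  text := rfl
  rest := by simp [init]
  no_rest := by simp [init]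
  ctx := trivial
  cur := ⟨by simp [init], by simp [init], by simp [init], by simp [init], by simp [init]⟩
  blocks := by simp [init]
  copies := by simp [init]
  len := by simp [init, Phase.word, Ctx.word, unitsWord]
  copyCount := rfl
  selCount := by simp [init, selected]

/-- Changes of the position that do not affect the nodes. -/
theorem Parser.Valid.move {N : ℕ} {g : Parser} (h : g.Valid N []) (a : List Sym) (x : Ctx)
    (f : Phase) (hx : x.Holds g.nodes)
    (ht : a ++ (g.phase.write ++ g.ctx.write) = f.write ++ x.write)
    (hl : (f.word fun _ => false).length + (x.word fun _ => false).length ≤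
      (g.phase.word fun _ => false).length + (g.ctx.word fun _ => false).length + 1) :
    ({ g with ctx := x, phase := f } : Parser).Valid (N + 1) a where
  text := by
    have := h.text
    rw [List.nil_append] at this
    simp only [this, ← ht, List.append_assoc]
  rest := h.rest
  no_rest := h.no_rest
  ctx := hx
  cur := h.cur.mono (Nat.le_succ N)
  blocks b hb := (h.blocks b hb).mono (Nat.le_succ N)
  copies bs hbs b hb := (h.copies bs hbs b hb).mono (Nat.le_succ N)
  len := hl.trans (Nat.succ_le_succ h.len)
  copyCount := h.copyCount
  selCount := h.selCount

theorem length_word (τ : ℕ → Bool) (a : Node) :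
    (a.word τ).length = (a.word fun _ => false).length := by
  simp [Node.word, argsWord, unitsWord, List.length_flatMap]

/-- The class of the new node stands in unary below its frame mark, so `len` bounds it. The content
of the frame, together with the opener just read, bounds the word. -/
theorem Parser.Valid.openNode {N : ℕ} {g g' : Parser} {k : NodeKind} (h : g.Valid N [])
    (hg : g.openNode k = some g') : g'.Valid (N + 1) [k.sym] := by
  rcases g with ⟨ctx, phase, lits, nodes, blocks, copies, text, rest, cc, sc⟩
  obtain ⟨h1, h2, h3, h4, h5, h6, h7, h8, h9, h10⟩ := h
  simp only at h1 h2 h3 h4 h5 h6 h7 h8 h9 h10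
  have h6' : ∀ b ∈ blocks, WellAnnotated (N + 1) b.lits b.nodes :=
    fun b hb => (h6 b hb).mono (Nat.le_succ N)
  have h7' : ∀ bs ∈ copies, ∀ b ∈ bs, WellAnnotated (N + 1) b.lits b.nodes :=
    fun bs hbs b hb => (h7 bs hbs b hb).mono (Nat.le_succ N)
  rw [List.nil_append] at h1
  have hname : ∀ nm, phase.name? = some nm → phase.write = nm.map Sym.bit ∧
      (phase.word fun _ => false) = bitsWord nm := by
    intro nm hnm
    rcases phase with (_ | n) | bs | ⟨c, bs⟩ <;> simp [Phase.name?] at hnm <;> subst hnm <;>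
      simp [Phase.write, Phase.word, bitsWord, unitsWord]
  cases k with
  | var =>
    rcases ctx with _ | ⟨p, c', args'⟩
    · simp [Parser.openNode] at hg
    rcases phase with n | bs | ⟨c, bs⟩ <;> simp [Parser.openNode] at hg
    subst hg
    have hsub : nodes ⊆ ⟨.var, bs, [], c⟩ :: nodes := List.subset_cons_self _ _
    simp only [Phase.word, Ctx.word, List.length_append, List.length_cons, bitsWord,
      List.length_map, unitsWord, List.length_replicate] at h8
    refine ⟨?_, h2, h3, ⟨h4.1.mono hsub, ?_⟩, ⟨?_, ?_, ?_, ?_, ?_⟩, h6', h7', ?_, h9, h10⟩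
    · simp [h1, Phase.write, Ctx.write, NodeKind.sym, writeTerm]
    · intro q hq
      rcases List.mem_cons.1 hq with rfl | hq
      · exact .var _ _ List.mem_cons_self
      · exact (h4.2 q hq).mono hsub
    · exact fun q hq => (h5.lit q hq).mono hsub
    · intro a ha p hp
      rcases List.mem_cons.1 ha with rfl | ha
      · simp at hp
      · exact h5.node a ha p hp
    · intro a ha hv
      rcases List.mem_cons.1 ha with rfl | ha
      · rfl
      · exact h5.var a ha hv
    · intro a ha
      rcases List.mem_cons.1 ha with rfl | ha
      · simp only; omega
      · exact (h5.cls a ha).trans (Nat.lt_succ_self N)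
    · intro a ha
      rcases List.mem_cons.1 ha with rfl | ha
      · simp only [Node.word, argsWord, List.length_cons, List.length_append, bitsWord,
          List.length_map, List.flatMap_nil, List.length_nil]
        omega
      · exact (h5.word a ha).trans (Nat.le_succ N)
    · simp only [Phase.word, Ctx.word, List.length_append, List.length_cons,
        unitsWord, List.length_replicate, List.map_cons, argsWord, List.flatMap_cons,
        List.replicate_zero, List.length_nil] at h8 ⊢
      omega
  | fn =>
    rcases ctx with _ | ⟨_ | ⟨p, c', args'⟩, c, args⟩ <;> simp [Parser.openNode] at hg
    obtain ⟨nm, hnm, rfl⟩ := hg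
    obtain ⟨hw1, hw2⟩ := hname nm hnm
    have hsub : nodes ⊆ ⟨.fn, nm, args.map Prod.snd, c⟩ :: nodes := List.subset_cons_self _ _
    simp only [hw2, Ctx.word, List.length_append, List.length_cons, bitsWord,
      List.length_map, unitsWord, List.length_replicate] at h8
    refine ⟨?_, h2, h3, ⟨h4.1.1.mono hsub, ?_⟩, ⟨?_, ?_, ?_, ?_, ?_⟩, h6', h7', ?_, h9, h10⟩
    · rw [hw1] at h1
      simp [h1, Phase.write, Ctx.write, NodeKind.sym, writeTerm_mkFn]
    · intro q hq
      rcases List.mem_cons.1 hq with rfl | hq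
      · exact .fn _ _ _ List.mem_cons_self fun q hq => (h4.2 q hq).mono hsub
      · exact (h4.1.2 q hq).mono hsub
    · exact fun q hq => (h5.lit q hq).mono hsub
    · intro a ha p hp
      rcases List.mem_cons.1 ha with rfl | ha
      · simp at hp
      · exact h5.node a ha p hp
    · intro a ha hv
      rcases List.mem_cons.1 ha with rfl | ha
      · simp at hv
      · exact h5.var a ha hv
    · intro a ha
      rcases List.mem_cons.1 ha with rfl | ha
      · simp only; omega
      · exact (h5.cls a ha).trans (Nat.lt_succ_self N)
    · intro a ha
      rcases List.mem_cons.1 ha with rfl | ha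
      · simp only [Node.word, List.length_cons, List.length_append, bitsWord, List.length_map]
        omega
      · exact (h5.word a ha).trans (Nat.le_succ N)
    · simp only [Phase.word, Ctx.word, List.length_append, List.length_cons,
        unitsWord, List.length_replicate, List.map_cons, argsWord, List.flatMap_cons,
        List.replicate_zero, List.length_nil] at h8 ⊢
      omega
  | lit s =>
    rcases ctx with _ | ⟨_ | ⟨p, c', args'⟩, c, args⟩ <;> simp [Parser.openNode] at hg
    obtain ⟨nm, hnm, rfl⟩ := hg
    obtain ⟨hw1, hw2⟩ := hname nm hnm
    have hsub : nodes ⊆ ⟨.lit s, nm, args.map Prod.snd, c⟩ :: nodes := List.subset_cons_self _ _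
    simp only [hw2, Ctx.word, List.length_append, List.length_cons, bitsWord,
      List.length_map, unitsWord, List.length_replicate] at h8
    refine ⟨?_, h2, h3, trivial, ⟨?_, ?_, ?_, ?_, ?_⟩, h6', h7', ?_, h9, h10⟩
    · rw [hw1] at h1
      simp [h1, Phase.write, Ctx.write, NodeKind.sym, writeLits, writeLiteral_ofList]
    · intro q hq
      rcases List.mem_cons.1 hq with rfl | hq
      · exact ⟨s, nm, args, rfl, List.mem_cons_self, fun q hq => (h4.2 q hq).mono hsub⟩
      · exact (h5.lit q hq).mono hsub
    · intro a ha p hp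
      rcases List.mem_cons.1 ha with rfl | ha
      · simp at hp
        exact ⟨_, List.mem_cons_self, hp, rfl⟩
      · obtain ⟨q, hq, h⟩ := h5.node a ha p hp
        exact ⟨q, List.mem_cons_of_mem _ hq, h⟩
    · intro a ha hv
      rcases List.mem_cons.1 ha with rfl | ha
      · simp at hv
      · exact h5.var a ha hv
    · intro a ha
      rcases List.mem_cons.1 ha with rfl | ha
      · simp only; omega
      · exact (h5.cls a ha).trans (Nat.lt_succ_self N)
    · intro a ha
      rcases List.mem_cons.1 ha with rfl | ha
      · simp only [Node.word, List.length_cons, List.length_append, bitsWord, List.length_map]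
        omega
      · exact (h5.word a ha).trans (Nat.le_succ N)
    · simp [Phase.word, Ctx.word, unitsWord]

theorem Parser.Valid.pre {N : ℕ} {g g' : Parser} {t : Cert} (h : g.Valid N [])
    (hg : g.pre t = some g') : g'.Valid (N + 1) t.text.toList := by
  rcases t with a | _ | _ | ⟨st, sel⟩ | _ | ⟨b, x⟩
  · cases a with
    | tick => simp [Parser.pre] at hg
    | clause => simp [Parser.pre] at hg
    | lit p => exact h.openNode hg
    | fn => exact h.openNode hg
    | var => exact h.openNode hg
    | bit b =>
      have hctx := h.ctx
      have hm := h.move [.bit b]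
      rcases g with ⟨ctx, phase, lits, nodes, blocks, copies, text, rest, cc, sc⟩
      rcases ctx with _ | ⟨p, c, args⟩ <;> rcases phase with (_ | n) | bs | ⟨c', bs⟩ <;>
        simp [Parser.pre] at hg <;> subst hg <;> apply hm _ _ hctx <;>
        simp [Phase.write, Phase.word, bitsWord, unitsWord]
      all_goals omega
    | close =>
      have hctx := h.ctx
      have hm := h.move [.close]
      rcases g with ⟨ctx, phase, lits, nodes, blocks, copies, text, rest, cc, sc⟩
      rcases phase with n | bs | ⟨c', bs⟩ <;> simp [Parser.pre] at hg
      subst hg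
      have hx : (Ctx.frame ctx n []).Holds nodes := ⟨hctx, by simp⟩
      apply hm _ _ hx <;>
        simp [Phase.write, Phase.word, unitsWord, Ctx.write, Ctx.word, argsWord]
  · have hctx := h.ctx
    have hm := h.move []
    rcases g with ⟨ctx, phase, lits, nodes, blocks, copies, text, rest, cc, sc⟩
    rcases phase with n | bs | ⟨c', bs⟩ <;> simp [Parser.pre] at hg
    subst hg
    apply hm _ _ hctx <;> simp [Phase.write, Phase.word, unitsWord]
    all_goals omega
  · have hctx := h.ctx
    have hm := h.move []
    rcases g with ⟨ctx, phase, lits, nodes, blocks, copies, text, rest, cc, sc⟩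
    rcases ctx with _ | ⟨p, c, args⟩ <;> rcases phase with n | bs | ⟨c', bs⟩ <;>
      simp [Parser.pre] at hg
    subst hg
    apply hm _ _ hctx <;> simp [Phase.write, Phase.word, unitsWord, bitsWord]
    all_goals omega
  · rcases g with ⟨ctx, phase, lits, nodes, blocks, copies, text, rest, cc, sc⟩
    rcases ctx with _ | ⟨p, c, args⟩ <;> rcases phase with (_ | n) | bs | ⟨c', bs⟩ <;>
      simp [Parser.pre] at hg
    subst hg
    obtain ⟨h1, h2, h3, h4, h5, h6, h7, h8, h9, h10⟩ := h
    simp only at h1 h2 h3 h4 h5 h6 h7 h8 h9 h10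
    rw [List.nil_append] at h1
    refine ⟨?_, h2, h3, trivial, ⟨by simp, by simp, by simp, by simp, by simp⟩, ?_,
      fun bs hbs b hb => (h7 bs hbs b hb).mono (Nat.le_succ N), ?_, h9, ?_⟩
    · simp [Cert.text, h1, Phase.write, Ctx.write, writeLits, writeBlocks, Block.strip,
        writeClause]
    · intro b hb
      rcases List.mem_cons.1 hb with rfl | hb
      · exact h5.mono (Nat.le_succ N)
      · exact (h6 b hb).mono (Nat.le_succ N)
    · simp [Phase.word, Ctx.word, unitsWord]
    · simp only [h10, selected, List.map_cons, List.sum_cons]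
      omega
  · rcases g with ⟨ctx, phase, lits, nodes, blocks, copies, text, rest, cc, sc⟩
    obtain ⟨h1, h2, h3, h4, h5, h6, h7, h8, h9, h10⟩ := h
    simp only at h1 h2 h3 h4 h5 h6 h7 h8 h9 h10
    have hr : rest.getD [] = [] ∧ ctx = .top ∧ phase = .ready 0 ∧ lits = [] := by
      rcases ctx with _ | ⟨p, c, args⟩ <;> rcases phase with (_ | n) | bs | ⟨c', bs⟩ <;>
        rcases lits with _ | ⟨l, lits⟩ <;> rcases rest with _ | _ | ⟨x, xs⟩ <;>
        simp [Parser.pre] at hg ⊢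
    obtain ⟨hr, rfl, rfl, rfl⟩ := hr
    simp only [Parser.pre, hr, Option.some.injEq] at hg
    subst hg
    have ht : writeBlocks blocks = text := by
      simpa [Phase.write, Ctx.write, writeLits] using h1.symm
    refine ⟨?_, ?_, by simp, trivial, h5.mono (Nat.le_succ N), by simp, ?_, ?_, ?_, ?_⟩
    · simp [Cert.text, Phase.write, Ctx.write, writeLits, writeBlocks]
    · intro r hr' bs hbs
      simp only [Option.some.injEq] at hr'
      subst hr'
      rw [List.reverse_reverse, List.append_nil]
      rcases List.mem_cons.1 hbs with rfl | hbs
      · exact ht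
      · rcases rest with _ | r
        · simp [h3 rfl] at hbs
        · obtain rfl : r = [] := hr
          simpa using h2 _ rfl bs hbs
    · intro bs hbs b hb
      rcases List.mem_cons.1 hbs with rfl | hbs
      · exact (h6 b hb).mono (Nat.le_succ N)
      · exact (h7 bs hbs b hb).mono (Nat.le_succ N)
    · simp [Phase.word, Ctx.word, unitsWord]
    · simp [h9]
    · simp [h10, selected]
  · simp [Parser.pre] at hg

theorem Parser.Valid.compare {N : ℕ} {g g' : Parser} {a : Sym} (h : g.Valid N [a])
    (hg : g.compare a = some g') : g'.Valid N [] := by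
  rcases g with ⟨ctx, phase, lits, nodes, blocks, copies, text, rest, cc, sc⟩
  obtain ⟨h1, h2, h3, h4, h5, h6, h7, h8, h9, h10⟩ := h
  rcases rest with _ | _ | ⟨x, xs⟩
  · simp only [Parser.compare, Option.some.injEq] at hg
    subst hg
    exact ⟨h1, by simp, h3, h4, h5, h6, h7, h8, h9, h10⟩
  · simp [Parser.compare] at hg
  · simp only [Parser.compare, Option.ite_none_right_eq_some, Option.some.injEq] at hg
    obtain ⟨rfl, rfl⟩ := hg
    refine ⟨h1, ?_, by simp, h4, h5, h6, h7, h8, h9, h10⟩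
    intro r hr bs hbs
    simp only [Option.some.injEq] at hr
    subst hr
    have := h2 _ rfl bs hbs
    simpa using this

theorem Parser.Valid.step {N : ℕ} {g g' : Parser} {t : Cert} (h : g.Valid N [])
    (hg : g.step t = some g') : g'.Valid (N + 1) [] := by
  simp only [Parser.step, Option.bind_eq_some_iff] at hg
  obtain ⟨g₁, h1, h2⟩ := hg
  have h3 := h.pre h1
  rcases ht : t.text with _ | a
  · rw [ht] at h2 h3
    simp only [Option.elim_none, Option.some.injEq] at h2
    exact h2 ▸ h3
  · rw [ht] at h2 h3
    exact h3.compare h2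

theorem Parser.valid_read {y : List Cert} {g : Parser} (h : Parser.init.read y = some g) :
    g.Valid y.length [] := by
  induction y generalizing g with
  | nil =>
    simp only [read, List.foldr_nil, Option.some.injEq] at h
    exact h ▸ valid_init
  | cons t y ih =>
    obtain ⟨g₁, h1, h2⟩ := Option.bind_eq_some_iff.1 h
    exact (ih h1).step h2

theorem Parser.stepInput_tick {m : Instance.LimitMode} {g g' : Parser}
    (h : g.stepInput m .tick = some g') :
    g.text = [] ∧ g.rest.getD [] = [] ∧ g.copyCount = g'.copyCount + 1 ∧
      (∃ n s, g' = { g with copyCount := n, selCount := s }) ∧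
      match m with
      | .atMost => g'.selCount = g.selCount - 1
      | .exactly => g.selCount = g'.selCount + 1 := by
  rcases g with ⟨ctx, phase, lits, nodes, blocks, copies, text, rest, cc, sc⟩
  have h0 : text = [] ∧ rest.getD [] = [] := by
    rcases text with _ | ⟨x, text⟩ <;> rcases rest with _ | _ | ⟨y, ys⟩ <;>
      simp [Parser.stepInput] at h ⊢
  obtain ⟨rfl, hr⟩ := h0
  rcases cc with _ | n <;> rcases sc with _ | s <;> cases m <;>
    simp [Parser.stepInput, hr] at h <;> subst h <;> simp [hr]

theorem Parser.stepInput_of_ne {m : Instance.LimitMode} {a : Sym} (ha : a ≠ .tick)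
    {g g' : Parser} (h : g.stepInput m a = some g') :
    ∃ xs, g.text = [] ∧ g.rest = some (a :: xs) ∧ g' = { g with rest := some xs } := by
  rcases g with ⟨ctx, phase, lits, nodes, blocks, copies, text, rest, cc, sc⟩
  rcases text with _ | ⟨x, text⟩ <;> rcases rest with _ | _ | ⟨y, ys⟩ <;>
    cases a <;> simp [Parser.stepInput] at h ha ⊢ <;> exact ⟨h.1, h.2.symm⟩

/-- The effect of reading the input. -/
theorem Parser.readInput_spec (m : Instance.LimitMode) {w : List Sym} {g g' : Parser}
    (h : g.readInput m w = some g') :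
    g'.copies = g.copies ∧ g'.blocks = g.blocks ∧ (w ≠ [] → g.text = []) ∧ g'.text = g.text ∧
    ∃ k u, w = List.replicate k .tick ++ u ∧ u.reverse ++ g'.rest.getD [] = g.rest.getD [] ∧
      (k ≠ 0 → g'.rest.getD [] = []) ∧ g.copyCount = g'.copyCount + k ∧
      match m with
      | .atMost => g'.selCount = g.selCount - k
      | .exactly => g.selCount = g'.selCount + k := by
  induction w generalizing g' with
  | nil =>
    simp only [readInput, List.foldr_nil, Option.some.injEq] at h
    subst h
    refine ⟨rfl, rfl, by simp, rfl, 0, [], rfl, rfl, by simp, rfl, ?_⟩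
    cases m <;> rfl
  | cons a w ih =>
    obtain ⟨g₁, h1, h2⟩ := Option.bind_eq_some_iff.1 h
    obtain ⟨e1, e2, -, e3, k, u, rfl, e4, e5, e6, e7⟩ := ih h1
    by_cases ha : a = .tick
    · subst ha
      obtain ⟨ht, hr, hc, ⟨n, s, rfl⟩, hs⟩ := Parser.stepInput_tick h2
      refine ⟨e1, e2, fun _ => e3 ▸ ht, e3, k + 1, u, by simp [List.replicate_succ], e4,
        fun _ => hr, by simp only at hc ⊢; omega, ?_⟩
      cases m <;> simp only at hs e7 ⊢ <;> omega
    · obtain ⟨xs, ht, hr, rfl⟩ := Parser.stepInput_of_ne ha h2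
      -- If a tick had been read before, nothing would be left to compare, whereas a symbol other
      -- than a tick has just been matched. Hence all ticks precede the clauses in the input.
      obtain rfl : k = 0 := by
        by_contra hk
        simpa [hr] using e5 hk
      refine ⟨e1, e2, fun _ => e3 ▸ ht, e3, 0, a :: u, by simp, ?_, by simp, e6, ?_⟩
      · rw [← e4, hr]
        simp
      · cases m <;> exact e7

/-! ## Soundness -/

/-- Reads the bits and the classes of the children from the word of a node. -/
def decodeCell (x : Cell) (s : ℕ × List ℕ × List Bool) : ℕ × List ℕ × List Bool :=
  match x with
  | .unit => (s.1 + 1, s.2)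
  | .child _ => (0, s.1 :: s.2.1, s.2.2)
  | .sym (.bit b) => (s.1, s.2.1, b :: s.2.2)
  | _ => s

/-- From right to left, each `child` cell closes the unary number just counted and resets the
counter. The truth value in the cell is ignored. -/
theorem decode_word (τ : ℕ → Bool) (bs : List Bool) (cs : List ℕ) :
    (bitsWord bs ++ argsWord τ cs).foldr decodeCell (0, [], []) = (0, cs, bs) := by
  have h1 : ∀ n s, (unitsWord n).foldr decodeCell s = (s.1 + n, s.2) := by
    intro n s
    induction n with
    | zero => rfl
    | succ n ih =>
      rw [unitsWord] at ih
      rw [unitsWord, List.replicate_succ, List.foldr_cons, ih]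
      rfl
  have h2 : (argsWord τ cs).foldr decodeCell (0, [], []) = (0, cs, []) := by
    induction cs with
    | nil => rfl
    | cons c cs ih =>
      rw [argsWord] at ih
      rw [argsWord, List.flatMap_cons, List.foldr_append, ih, List.foldr_cons, h1]
      simp [decodeCell]
  rw [List.foldr_append, h2]
  induction bs with
  | nil => rfl
  | cons b bs ih =>
    rw [bitsWord] at ih
    rw [bitsWord, List.map_cons, List.foldr_cons, ih]
    rfl

theorem word_injective {τ : ℕ → Bool} {a a' : Node} (h : a.word τ = a'.word τ) :
    a.kind.opener = a'.kind.opener ∧ a.name = a'.name ∧ a.args = a'.args := by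
  simp only [Node.word, List.cons.injEq, Cell.sym.injEq] at h
  have := decode_word τ a.name a.args
  rw [h.2, decode_word] at this
  simp only [Prod.mk.injEq, true_and] at this
  exact ⟨h.1, this.2.symm, this.1.symm⟩

theorem truth_range {N : ℕ} (P : ℕ → Bool) {c : ℕ} (hc : c < N) :
    truth ((List.range N).map P) c = P c := by
  simp [truth, List.getD, hc]

theorem count_singleton {N c : ℕ} (hc : c < N) :
    ((List.range N).map fun i => decide (i = c)).count true = 1 := by
  rw [List.count, List.countP_map]
  have : List.countP ((fun x => x == true) ∘ fun i => decide (i = c)) (List.range N) =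
      (List.range N).count c := by
    rw [List.count]
    congr 1
    funext i
    simp [beq_eq_decide]
  rw [this, List.count_eq_one_of_mem List.nodup_range (List.mem_range.2 hc)]

theorem initial_range (N t : ℕ) : initial ((List.range N).map fun i => decide (i < t)) = true := by
  rw [List.range_eq_range']
  generalize 0 = s
  induction N generalizing s with
  | zero => rfl
  | succ N ih =>
    rw [List.range'_succ, List.map_cons, initial, ih, Bool.true_and]
    by_cases hs : s < t
    · simp [hs]
    · simp only [hs, decide_false, Bool.false_or, Bool.not_eq_true', List.any_eq_false,
        List.mem_map, List.mem_range', id_eq]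
      rintro x ⟨i, ⟨j, -, rfl⟩, rfl⟩
      simp
      omega

/-! ### Evaluating classes that pass all checks -/

/-- The clause copies `B` pass all checks. -/
structure Verified {n d : ℕ} (N : ℕ) (B : Fin n × Fin d → Block) : Prop where
  annotated : ∀ c, WellAnnotated N (B c).lits (B c).nodes
  passes : ∀ (zs : List Bool) (R : List Cell), zs.length = N → R.length ≤ N →
    Passes B (truth zs) (zs.count true = 1) (initial zs = true) R


namespace Verified

/-- Use the assignment in which only the class of `a` is true, and take the word of `a` as the
guessed word. -/
theorem same_word {n d N : ℕ} {B : Fin n × Fin d → Block} (h : Verified N B)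
    {c c' : Fin n × Fin d} {a a' : Node} (ha : a ∈ (B c).nodes) (ha' : a' ∈ (B c').nodes)
    (hk : a.kind ≠ .var) (hk' : a'.kind ≠ .var) (hc : a'.cls = a.cls) :
    a'.kind.opener = a.kind.opener ∧ a'.name = a.name ∧ a'.args = a.args := by
  have hN := (h.annotated c).cls a ha
  set τ := truth ((List.range N).map fun i => decide (i = a.cls)) with hτ
  have ht : τ a.cls = true := by rw [hτ, truth_range _ hN]; simp
  have hp := h.passes ((List.range N).map fun i => decide (i = a.cls)) (a.word τ) (by simp)
    (by rw [length_word]; exact (h.annotated c).word a ha)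
  exact word_injective (hp.sameWord (count_singleton hN) c c' a ha a' ha' hk hk' ht
    (by rw [hc]; exact ht) rfl)

/-- The word of a node contains the classes of its children in unary and has length at most `N`. -/
theorem arg_lt {n d N : ℕ} {B : Fin n × Fin d → Block} (h : Verified N B)
    {c : Fin n × Fin d} {a : Node} (ha : a ∈ (B c).nodes) {k : ℕ} (hk : k ∈ a.args) : k < N := by
  have h1 := (h.annotated c).word a ha
  have h2 : k + 1 ≤ (argsWord (fun _ => false) a.args).length := by
    obtain ⟨l₁, l₂, hl⟩ := List.append_of_mem hk
    rw [hl]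
    simp only [argsWord, List.flatMap_append, List.flatMap_cons, List.length_append,
      List.length_cons, unitsWord, List.length_replicate]
    omega
  simp only [Node.word, List.length_cons, List.length_append] at h1
  omega

/-- The initial segment below `a.cls` excludes a smaller child, and the singleton of `a.cls`
excludes an equal one. This acyclicity replaces the occurs check. -/
theorem cls_lt_arg {n d N : ℕ} {B : Fin n × Fin d → Block} (h : Verified N B)
    {c : Fin n × Fin d} {a : Node} (ha : a ∈ (B c).nodes) (hv : a.kind ≠ .var) {k : ℕ}
    (hk : k ∈ a.args) : a.cls < k := by
  have hN := (h.annotated c).cls a ha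
  have hkN := h.arg_lt ha hk
  have h1 : ¬ k < a.cls := by
    intro hlt
    have := (h.passes ((List.range N).map fun i => decide (i < a.cls)) [] (by simp)
      (Nat.zero_le N)).notInverted (initial_range N _) c a ha hv
      (by rw [truth_range _ hN]; simp) k hk
    rw [truth_range _ hkN] at this
    simp [hlt] at this
  have h2 : k ≠ a.cls := by
    intro heq
    have := (h.passes ((List.range N).map fun i => decide (i = a.cls)) [] (by simp)
      (Nat.zero_le N)).notLooped (count_singleton hN) c a ha hv
      (by rw [truth_range _ hN]; simp) k hk
    rw [truth_range _ hkN] at this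
    simp [heq] at this
  omega

/-- Use the singleton of `a.cls` with the word of the variable: another class for the same variable
would be false. -/
theorem same_var {n d N : ℕ} {B : Fin n × Fin d → Block} (h : Verified N B)
    {c : Fin n × Fin d} {a a' : Node} (ha : a ∈ (B c).nodes) (ha' : a' ∈ (B c).nodes)
    (hk : a.kind = .var) (hk' : a'.kind = .var) (hn : a'.name = a.name) : a'.cls = a.cls := by
  have hN := (h.annotated c).cls a ha
  have hN' := (h.annotated c).cls a' ha'
  set τ := truth ((List.range N).map fun i => decide (i = a.cls)) with hτ
  have ht : τ a.cls = true := by rw [hτ, truth_range _ hN]; simp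
  have hp := (h.passes ((List.range N).map fun i => decide (i = a.cls)) (a.word τ) (by simp)
    (by rw [length_word]; exact (h.annotated c).word a ha)).sameVar c a ha a' ha' hk hk' rfl
    (by simp only [Node.word, hk, hk', hn, (h.annotated c).var a ha hk,
      (h.annotated c).var a' ha' hk']; rfl)
    ht
  rw [truth_range _ hN'] at hp
  simpa using hp

/-- The terms that the classes stand for. -/
theorem exists_value {n d N : ℕ} {B : Fin n × Fin d → Block} (h : Verified N B) (V : Type) :
    ∃ val : ℕ → Tm V, ∀ c, ∀ a ∈ (B c).nodes, a.kind = .fn →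
      val a.cls = mkFn a.name (a.args.map val) := by
  classical
  let Fact (k : ℕ) (a : Node) : Prop := ∃ c, a ∈ (B c).nodes ∧ a.kind = .fn ∧ a.cls = k
  -- One round of evaluation. The term `mkFn [] []` is an arbitrary value for classes without a
  -- function node, for instance those of unbound variables.
  let f (v : ℕ → Tm V) (k : ℕ) : Tm V :=
    if hk : ∃ a, Fact k a then mkFn hk.choose.name (hk.choose.args.map v) else mkFn [] []
  let v (i : ℕ) : ℕ → Tm V := f^[i] fun _ => mkFn [] []
  have hv : ∀ i, v (i + 1) = f (v i) := fun i => Function.iterate_succ_apply' f i _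
  have hf : ∀ u c a, a ∈ (B c).nodes → a.kind = .fn → f u a.cls = mkFn a.name (a.args.map u) := by
    intro u c a ha hk
    have hex : ∃ a', Fact a.cls a' := ⟨a, c, ha, hk, rfl⟩
    obtain ⟨c', h1, h2, h3⟩ := hex.choose_spec
    obtain ⟨-, h4, h5⟩ := h.same_word ha h1 (by simp [hk]) (by simp [h2]) h3
    simp only [f, dif_pos hex, h4, h5]
  -- Children have larger classes, so the value of class `k` is final after `N - k` rounds, and `N`
  -- rounds settle all classes.
  have hstable : ∀ i k, N ≤ i + k → v (i + 1) k = v i k := by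
    intro i
    induction i with
    | zero =>
      intro k hk
      rw [hv]
      have : ¬ ∃ a, Fact k a := by
        rintro ⟨a, c, ha, -, rfl⟩
        have := (h.annotated c).cls a ha
        omega
      simp only [f, dif_neg this]
      rfl
    | succ i ih =>
      intro k hk
      rw [hv, hv]
      by_cases hex : ∃ a, Fact k a
      · obtain ⟨a, c, ha, hka, rfl⟩ := hex
        rw [hf _ c a ha hka, hf _ c a ha hka]
        congr 1
        apply List.map_congr_left
        intro k' hk'
        have := h.cls_lt_arg ha (by simp [hka]) hk'
        rw [← ih k' (by omega), hv]
      · simp only [f, dif_neg hex]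
  refine ⟨v N, fun c a ha hk => ?_⟩
  rw [← hstable N a.cls (by omega), hv, hf _ c a ha hk]

/-- Verified clause copies yield a model. -/
theorem solvable {I : Instance} {N : ℕ} {B : I.Copy → Block} (h : Verified N B)
    (hstrip : ∀ c, (B c).strip = I.clauseOf c) (m : Instance.LimitMode)
    (hsize : m.Holds {c | (B c).selected = true}.ncard I.limit) : I.Solvable m := by
  classical
  obtain ⟨val, hval⟩ := h.exists_value I.RigidVar
  -- A variable takes the value of its class, which by `same_var` does not depend on the chosen
  -- node. Variables that do not occur stay fixed.
  let σ : I.RigidVar → Tm I.RigidVar := fun x =>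
    if hx : ∃ a ∈ (B x.1).nodes, a.kind = .var ∧ a.name = x.2 then val hx.choose.cls else .var x
  have hσ : ∀ c, ∀ a ∈ (B c).nodes, a.kind = .var → σ (c, a.name) = val a.cls := by
    intro c a ha hk
    have hx : ∃ a' ∈ (B (c, a.name).1).nodes, a'.kind = .var ∧ a'.name = (c, a.name).2 :=
      ⟨a, ha, hk, rfl⟩
    obtain ⟨h1, h2, h3⟩ := hx.choose_spec
    simp only [σ]
    rw [dif_pos hx, h.same_var ha h1 hk h2 h3]
  have hder : ∀ c t k, Derives (B c).nodes t k →
      (t.relabel fun x => (c, x)).subst σ = val k := by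
    intro c t k ht
    induction ht with
    | var x k hx =>
      exact hσ c _ hx rfl
    | fn f l k hf _ ih =>
      rw [mkFn_relabel, mkFn_subst, hval c _ hf rfl]
      simp only [List.map_map]
      congr 1
      apply List.map_congr_left
      intro q hq
      exact ih q hq
  have hlits : ∀ c, (I.clauseOf c).lits = (B c).lits.map Prod.fst := by
    intro c
    rw [← hstrip c]
    rfl
  have hstart : ∀ c, (I.clauseOf c).isStart = (B c).isStart := by
    intro c
    rw [← hstrip c]
    rfl
  let cls (o : I.Occ) : ℕ := ((B o.1).lits.map Prod.snd).getD o.2.val 0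
  have hocc : ∀ o : I.Occ, ∃ q ∈ (B o.1).lits, (I.clauseOf o.1).lits.get o.2 = q.1 ∧
      cls o = q.2 := by
    rintro ⟨c, i, hi⟩
    have hi' : i < (B c).lits.length := by
      rw [hlits] at hi
      simpa using hi
    refine ⟨(B c).lits[i], List.getElem_mem _, ?_, ?_⟩
    · simp [hlits]
    · simp [cls, List.getD, hi']
  have hocc' : ∀ c, ∀ q ∈ (B c).lits, ∃ i : Fin (I.clauseOf c).lits.length,
      (I.clauseOf c).lits.get i = q.1 ∧ cls ⟨c, i⟩ = q.2 := by
    intro c q hq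
    obtain ⟨i, hi, rfl⟩ := List.getElem_of_mem hq
    refine ⟨⟨i, by rw [hlits]; simpa using hi⟩, ?_, ?_⟩
    · simp [hlits]
    · simp [cls, List.getD, hi]
  have hnode : ∀ o : I.Occ, ∃ (p : Bool) (f : Name) (args : List ℕ),
      (⟨.lit p, f, args, cls o⟩ : Node) ∈ (B o.1).nodes ∧ (I.litAt o).positive = p ∧
      (I.litAt o).subst σ = .ofList p f (args.map val) := by
    intro o
    obtain ⟨q, hq, h1, h2⟩ := hocc o
    obtain ⟨p, f, l, h3, h4, h5⟩ := ((h.annotated o.1).lit q hq).exists_node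
    have hl : I.litAt o = .ofList p f (l.map fun r => r.1.relabel fun x => (o.1, x)) := by
      rw [Instance.litAt, h1, h3, Literal.rename_ofList, List.map_map]
      rfl
    refine ⟨p, f, l.map Prod.snd, h2 ▸ h4, by rw [hl]; rfl, ?_⟩
    rw [hl, Literal.subst_ofList, List.map_map, List.map_map]
    congr 1
    apply List.map_congr_left
    intro r hr
    exact hder _ _ _ (h5 r hr)
  -- All complementary pairs of one class are connected; the evaluation unifies all of them
  -- simultaneously.
  let conn (L K : I.Occ) : Prop :=
    (I.litAt K).positive = !(I.litAt L).positive ∧ cls K = cls L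
  have hsymm : ∀ L K, conn L K → conn K L := by
    rintro L K ⟨h1, h2⟩
    exact ⟨by rw [h1, Bool.not_not], h2.symm⟩
  let v : I.SATVar → Bool
    | .sel c => (B c).selected
    | .conn e => decide (∃ L K, e = s(L, K) ∧ conn L K)
  have hv : ∀ L K, v (.conn s(L, K)) = true ↔ conn L K := by
    intro L K
    simp only [v, decide_eq_true_eq]
    constructor
    · rintro ⟨L', K', he, hc⟩
      rcases Sym2.eq_iff.1 he with ⟨rfl, rfl⟩ | ⟨rfl, rfl⟩
      · exact hc
      · exact hsymm _ _ hc
    · exact fun hc => ⟨L, K, rfl, hc⟩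
  have hunif : ∀ L K, conn L K → ((I.litAt L).subst σ).Connected ((I.litAt K).subst σ) := by
    rintro L K ⟨h1, h2⟩
    obtain ⟨p, f, args, ha, hp, hs⟩ := hnode L
    obtain ⟨p', f', args', ha', hp', hs'⟩ := hnode K
    obtain ⟨-, h3, h4⟩ := h.same_word ha ha' (by simp) (by simp) h2
    simp only at h3 h4
    rw [hs, hs', h3, h4, Literal.Connected]
    rw [hp, hp'] at h1
    rw [h1]
    rfl
  -- nodes of literals come from occurrences
  have hback : ∀ c, ∀ a ∈ (B c).nodes, ∀ p, a.kind = .lit p → ∃ o : I.Occ, o.1 = c ∧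
      (I.litAt o).positive = p ∧ cls o = a.cls := by
    intro c a ha p hk
    obtain ⟨q, hq, h1, h2⟩ := (h.annotated c).node a ha p hk
    obtain ⟨i, h3, h4⟩ := hocc' c q hq
    refine ⟨⟨c, i⟩, rfl, ?_, h4.trans h2⟩
    rw [← h1, ← h3]
    rfl
  have hpass0 := h.passes ((List.range N).map fun _ => false) [] (by simp) (Nat.zero_le N)
  refine ⟨v, ?_, hsize, ?_, ?_, σ, fun L K hc => hunif L K ((hv L K).1 hc)⟩
  · obtain ⟨c, h1, h2, h3⟩ := hpass0.start
    exact ⟨c, (hstart c).trans h2, h1, h3⟩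
  · intro L hL
    obtain ⟨p, f, args, ha, hp, -⟩ := hnode L
    have hN := (h.annotated L.1).cls _ ha
    simp only at hN
    -- When only the class of `L` is true, the partner in another selected copy must have that same
    -- class.
    obtain ⟨c, hc, hsel, a, ha', hk, ht⟩ := (h.passes
      ((List.range N).map fun i => decide (i = cls L)) [] (by simp)
      (Nat.zero_le N)).connected p L.1 hL ⟨_, ha, rfl, by rw [truth_range _ hN]; simp⟩
    rw [truth_range _ ((h.annotated c).cls a ha')] at ht
    obtain ⟨K, rfl, h1, h2⟩ := hback c a ha' _ hk
    have hconn : conn L K := ⟨by rw [h1, hp], by simpa [h2] using ht⟩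
    exact ⟨K, hc, ⟨σ, hunif L K hconn⟩, hsel, (hv L K).2 hconn⟩
  · intro U hU
    -- This assignment makes every positive literal of the path true. The literal of the path in the
    -- falsified copy is therefore negative, and its class is true because of some positive literal
    -- of the path.
    set P : ℕ → Bool := fun k => decide (∃ o ∈ U, (I.litAt o).positive = true ∧ cls o = k) with hP
    obtain ⟨c, hsel, hc⟩ := (h.passes ((List.range N).map P) [] (by simp)
      (Nat.zero_le N)).falsified
    obtain ⟨o, ⟨ho, rfl⟩, -⟩ := hU.2 c hsel
    obtain ⟨p, f, args, ha, hp, -⟩ := hnode o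
    have hne := hc _ ha
    simp only at hne
    have hN := (h.annotated o.1).cls _ ha
    simp only at hN
    rw [truth_range _ hN] at hne
    have hpf : p = false := by
      by_contra hpt
      have hpt : p = true := by simpa using hpt
      apply hne
      rw [hpt]
      have : P (cls o) = true := by
        simp only [hP, decide_eq_true_eq]
        exact ⟨o, ho, hp.trans hpt, rfl⟩
      rw [this]
    subst hpf
    have hPo : P (cls o) = true := by
      by_contra hf
      apply hne
      rw [Bool.not_eq_true] at hf
      rw [hf]
    simp only [hP, decide_eq_true_eq] at hPo
    obtain ⟨o', ho', hpos, hcls⟩ := hPo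
    refine ⟨o, ho, o', ho', ?_, (hv o o').2 ⟨by rw [hpos, hp]; rfl, hcls⟩⟩
    rintro rfl
    rw [hp] at hpos
    simp at hpos

end Verified

/-! ### From an accepted word to a solvable instance -/

theorem ncard_selected {n d : ℕ} (B : Fin n × Fin d → Block) :
    {c | (B c).selected = true}.ncard =
      ((List.ofFn fun k : Fin d => List.ofFn fun j : Fin n => B (j, k)).map selected).sum := by
  classical
  rw [Set.ncard_eq_toFinset_card', Set.toFinset_ofPred, Finset.card_filter]
  rw [List.map_ofFn, List.sum_ofFn, Fintype.sum_prod_type_right]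
  refine Finset.sum_congr rfl fun k _ => ?_
  simp only [Function.comp_apply, selected, List.map_ofFn, List.sum_ofFn]
  refine Finset.sum_congr rfl fun j _ => ?_
  cases (B (j, k)).selected <;> rfl

/-- Certificate entries with given truth values and a given word. -/
def entries : List Bool → List Cell → List Cert
  | [], _ => []
  | b :: zs, R => .entry b R.head? :: entries zs R.tail

theorem length_entries (zs : List Bool) (R : List Cell) : (entries zs R).length = zs.length := by
  induction zs generalizing R with
  | nil => rfl
  | cons b zs ih => simp [entries, ih]

theorem truth_entries (zs : List Bool) (R : List Cell) :
    (entries zs R).filterMap Cert.truth? = zs := by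
  induction zs generalizing R with
  | nil => rfl
  | cons b zs ih => simp [entries, ih, Cert.truth?]

theorem cell_entries (zs : List Bool) (R : List Cell) (h : R.length ≤ zs.length) :
    (entries zs R).filterMap Cert.cell? = R := by
  induction zs generalizing R with
  | nil =>
    obtain rfl : R = [] := by simpa using h
    rfl
  | cons b zs ih =>
    rcases R with _ | ⟨x, R⟩
    · rw [entries, List.filterMap_cons_none (by rfl)]
      exact ih [] (Nat.zero_le _)
    · have := ih R (by simpa using h)
      simp [entries, Cert.cell?, this]

/-- A word that has a universally accepted certificate is in the language. -/
theorem mem_solvingLanguage_of_verifier (m : Instance.LimitMode) {w : List Sym} {y : List Cert}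
    (hV : ∀ z : List Cert, z.length ≤ y.length → verifier m (w, y, z) = true) :
    w ∈ solvingLanguage m := by
  -- The parse result is obtained from one particular `z` and then reused for all truth values and
  -- all words. The length of `y` plays the role of `N`.
  have hV' : ∃ g₀ g, Parser.init.read y = some g₀ ∧ g₀.readInput m w = some g ∧
      ∀ zs R, zs.length = y.length → R.length ≤ y.length → g.accepts zs R := by
    have h : ∀ zs R, zs.length = y.length → R.length ≤ y.length → ∃ g,
        (Parser.init.read y).bind (fun g => g.readInput m w) = some g ∧ g.accepts zs R := by
      intro zs R hz hR
      have := (verifier_eq_true m w y (entries zs R)).1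
        (hV _ (by rw [length_entries, hz]))
      rwa [truth_entries, cell_entries _ _ (hR.trans hz.ge)] at this
    obtain ⟨g, hg, -⟩ := h (List.replicate y.length false) [] (by simp) (Nat.zero_le _)
    obtain ⟨g₀, h0, h1⟩ := Option.bind_eq_some_iff.1 hg
    refine ⟨g₀, g, h0, h1, fun zs R hz hR => ?_⟩
    obtain ⟨g', hg', h2⟩ := h zs R hz hR
    rw [hg, Option.some.injEq] at hg'
    exact hg' ▸ h2
  obtain ⟨g₀, g, h0, hw, hacc⟩ := hV'
  have hval := Parser.valid_read h0
  obtain ⟨e1, e2, e3, e4, k, u, rfl, e5, e6, e7, e8⟩ := Parser.readInput_spec m hw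
  obtain ⟨hc0, hs0, -⟩ := hacc (List.replicate y.length false) [] (by simp) (Nat.zero_le _)
  rw [hc0, Nat.zero_add] at e7
  have hk : g₀.copies.length = k := hval.copyCount.symm.trans e7
  have hblocks_of_text : g₀.text = [] → g₀.blocks = [] := by
    intro ht
    have h1 := hval.text
    rw [ht, List.append_nil] at h1
    have h2 := (List.append_eq_nil_iff.1 h1.symm).2
    rcases hb : g₀.blocks with _ | ⟨b, bs⟩
    · rfl
    · rw [hb] at h2
      simp [writeBlocks, writeClause] at h2
  -- Without copies the flag `start` keeps its initial value `false`, because only `Monitor.copy`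
  -- changes it.
  have hk0 : k ≠ 0 := by
    intro hk0
    have hnil : g₀.copies = [] := List.length_eq_zero_iff.1 (hk.trans hk0)
    have hfals := (hacc (List.replicate y.length false) [] (by simp) (Nat.zero_le _)).2.2
    simp only [Monitor.ok, Bool.and_eq_true] at hfals
    have hst := hfals.2
    have hst' : (blocksMonitor (truth (List.replicate y.length false)) []
        (copiesMonitor (truth (List.replicate y.length false)) [] g.copies) g.blocks).start =
        true := hst
    have : ∀ τ R G bs, (blocksMonitor τ R G bs).start = G.start := by
      intro τ R G bs
      induction bs with
      | nil => rfl
      | cons b bs ih => exact ih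
    rw [this, e1, hnil] at hst'
    simp [copiesMonitor, Monitor.init] at hst'
  have htext : g₀.text = [] := e3 (by
    obtain ⟨k, rfl⟩ := Nat.exists_eq_succ_of_ne_zero hk0
    simp [List.replicate_succ])
  have hblocks : g.blocks = [] := e2.trans (hblocks_of_text htext)
  -- All copies were compared with one another, and the last one read was compared with the input;
  -- since a tick was read, nothing of its text is left over.
  have hu : ∀ bs ∈ g₀.copies, writeBlocks bs = u := by
    intro bs hbs
    rw [e6 hk0, List.append_nil] at e5
    rcases hr : g₀.rest with _ | r
    · rw [hval.no_rest hr] at hbs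
      simp at hbs
    · rw [hr] at e5
      rw [hval.rest r hr bs hbs, htext, List.append_nil, ← Option.getD_some (a := r) (b := []),
        ← e5, List.reverse_reverse]
  obtain ⟨bs₀, cs, hcs⟩ := List.exists_cons_of_length_pos
    (l := g₀.copies) (by omega)
  set cl : List InputClause := bs₀.map Block.strip with hcl
  have hstrip : ∀ bs ∈ g₀.copies, bs.map Block.strip = cl := by
    intro bs hbs
    apply writeClauses_injective
    exact (hu bs hbs).trans (hu bs₀ (by rw [hcs]; exact List.mem_cons_self)).symm
  have hlen : ∀ bs ∈ g₀.copies, bs.length = cl.length := by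
    intro bs hbs
    rw [← hstrip bs hbs, List.length_map]
  let I : Instance := ⟨cl, k⟩
  let B : I.Copy → Block := fun c =>
    (g₀.copies[c.2.val]'(by rw [hk]; exact c.2.isLt))[c.1.val]'(by
      rw [hlen _ (List.getElem_mem _)]; exact c.1.isLt)
  have hB : (List.ofFn fun k' : Fin k => List.ofFn fun j : Fin cl.length => B (j, k')) =
      g₀.copies := by
    apply List.ext_getElem
    · simp [hk]
    · intro i hi hi'
      simp only [List.getElem_ofFn]
      apply List.ext_getElem
      · simp [hlen _ (List.getElem_mem hi')]
      · intro j hj hj'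
        simp [B]
  have hsel : g₀.selCount = {c : I.Copy | (B c).selected = true}.ncard := by
    have h1 := ncard_selected B
    rw [show (List.ofFn fun k' : Fin I.limit => List.ofFn fun j : Fin I.clauses.length =>
      B (j, k')) = g₀.copies from hB] at h1
    rw [h1, hval.selCount, hblocks_of_text htext]
    simp [selected]
  refine ⟨I, ?_, Verified.solvable (N := y.length) (B := B) ⟨?_, ?_⟩ ?_ m ?_⟩
  · rw [writeInstance]
    congr 1
    exact hu bs₀ (by rw [hcs]; exact List.mem_cons_self)
  · intro c
    exact hval.copies _ (List.getElem_mem _) _ (List.getElem_mem _)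
  · intro zs R hz hR
    have h1 := (hacc zs R hz hR).2.2
    have h2 : (g.ctl zs R).glb = copiesMonitor (truth zs) R g₀.copies := by
      simp [Parser.ctl, hblocks, blocksMonitor, e1]
    rw [h2, ← hB] at h1
    have h3 := (copiesMonitor_ok B (truth zs) _ _ R).1 h1
    simpa using h3
  · rintro ⟨j, k'⟩
    have h1 := hstrip _ (List.getElem_mem (l := g₀.copies) (n := k'.val)
      (by rw [hk]; exact k'.isLt))
    have h2 : j.val < cl.length := j.isLt
    have h3 : (List.map Block.strip (g₀.copies[k'.val]'(by rw [hk]; exact k'.isLt)))[j.val]? =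
      cl[j.val]? := by rw [h1]
    rw [List.getElem?_map, List.getElem?_eq_getElem h2,
      List.getElem?_eq_getElem (by rw [hlen _ (List.getElem_mem _)]; exact h2)] at h3
    rw [Option.map_some, Option.some.injEq] at h3
    exact h3
  · rw [← hsel]
    cases m
    · simp only at e8
      change g₀.selCount ≤ k
      omega
    · simp only at e8
      change g₀.selCount = k
      omega

/-! ## Certificates for given classes -/

def subterms {V : Type} : Tm V → List (Tm V)
  | .var x => [.var x]
  | @FirstOrder.Language.Term.func _ _ _ f ts =>
      .func f ts :: (List.ofFn fun i => subterms (ts i)).flatten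

theorem subterms_mkFn {V : Type} (f : Name) (l : List (Tm V)) :
    subterms (mkFn f l) = mkFn f l :: l.flatMap subterms := by
  have : (List.ofFn fun i => subterms (l.get i)) = l.map subterms := by
    apply List.ext_get <;> simp
  rw [List.flatMap, ← this]
  rfl

theorem self_mem_subterms {V : Type} (t : Tm V) : t ∈ subterms t := by
  cases t <;> simp [subterms]

theorem arg_mem_subterms {V : Type} {f : Name} {l : List (Tm V)} {t : Tm V}
    (h : mkFn f l ∈ subterms t) {u : Tm V} (hu : u ∈ l) : u ∈ subterms t := by
  induction t using Tm.induction with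
  | var x => simp [subterms, mkFn] at h
  | fn g l' ih =>
    rw [subterms_mkFn] at h ⊢
    rcases List.mem_cons.1 h with h | h
    · obtain ⟨rfl, rfl⟩ := mkFn_injective h
      exact List.mem_cons_of_mem _ (List.mem_flatMap.2 ⟨u, hu, self_mem_subterms u⟩)
    · obtain ⟨t, ht, h⟩ := List.mem_flatMap.1 h
      exact List.mem_cons_of_mem _ (List.mem_flatMap.2 ⟨t, ht, ih t ht h⟩)

def certBits (bs : List Bool) : List Cert := bs.map fun b => .sym (.bit b)

section Annotation

variable (k : Tm Name → ℕ) (kl : Literal Name → ℕ)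

/-- The annotation of a term with classes. -/
def annTerm : Tm Name → List Cert
  | .var x => .sym .var :: (certBits x ++ .vclose :: List.replicate (k (.var x)) .unit)
  | @FirstOrder.Language.Term.func _ _ _ f ts =>
      .sym .fn :: (certBits f ++ ((List.ofFn fun i => annTerm (ts i)).flatten ++
        .sym .close :: List.replicate (k (.func f ts)) .unit))

theorem annTerm_mkFn (f : Name) (l : List (Tm Name)) :
    annTerm k (mkFn f l) = .sym .fn :: (certBits f ++ (l.flatMap (annTerm k) ++
        .sym .close :: List.replicate (k (mkFn f l)) .unit)) := by
  have : (List.ofFn fun i => annTerm k (l.get i)) = l.map (annTerm k) := by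
    apply List.ext_get <;> simp
  rw [List.flatMap, ← this]
  rfl

def nodeOf : Tm Name → Node
  | .var x => ⟨.var, x, [], k (.var x)⟩
  | @FirstOrder.Language.Term.func _ _ _ f ts =>
      ⟨.fn, f, (List.ofFn ts).map k, k (.func f ts)⟩

theorem nodeOf_mkFn (f : Name) (l : List (Tm Name)) :
    nodeOf k (mkFn f l) = ⟨.fn, f, l.map k, k (mkFn f l)⟩ := by
  have : List.ofFn l.get = l := by
    apply List.ext_get <;> simp
  have h : nodeOf k (mkFn f l) =
    ⟨.fn, f, (List.ofFn l.get).map k, k (mkFn f l)⟩ := rfl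
  rw [h, this]

def termNodes (t : Tm Name) : List Node := (subterms t).map (nodeOf k)

theorem termNodes_mkFn (f : Name) (l : List (Tm Name)) :
    termNodes k (mkFn f l) = ⟨.fn, f, l.map k, k (mkFn f l)⟩ :: l.flatMap (termNodes k) := by
  rw [termNodes, subterms_mkFn, List.map_cons, nodeOf_mkFn, List.map_flatMap]
  rfl

def annLit (L : Literal Name) : List Cert :=
  .sym (.lit L.positive) :: (certBits L.pred ++ ((List.ofFn L.args).flatMap (annTerm k) ++
    .sym .close :: List.replicate (kl L) .unit))

def litNode (L : Literal Name) : Node :=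
  ⟨.lit L.positive, L.pred, (List.ofFn L.args).map k, kl L⟩

def litNodes (L : Literal Name) : List Node :=
  litNode k kl L :: (List.ofFn L.args).flatMap (termNodes k)

def annClause (C : InputClause) (sel : Bool) : List Cert :=
  .clause C.isStart sel :: C.lits.flatMap (annLit k kl)

def annBlock (C : InputClause) (sel : Bool) : Block :=
  ⟨C.isStart, sel, C.lits.map fun L => (L, kl L), C.lits.flatMap (litNodes k kl)⟩

end Annotation

/-! ### Reading certificates -/

/-- The part of a parser state that does not concern the comparison of copies. -/
structure Position : Type where
  ctx : Ctx
  phase : Phase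
  lits : List (Literal Name × ℕ)
  nodes : List Node
  blocks : List Block
  selCount : ℕ

def Position.parser (a : Position) (copies : List (List Block)) (text : List Sym)
    (rest : Option (List Sym)) (cc : ℕ) : Parser :=
  ⟨a.ctx, a.phase, a.lits, a.nodes, a.blocks, copies, text, rest, cc, a.selCount⟩

/-- Reading `u` leads from `a` to `b`, and `T` is the text of `u`. -/
def Reads (u : List Cert) (T : List Sym) (a b : Position) : Prop :=
  ∀ copies text rest cc,
    (a.parser copies text (rest.map fun r => T.reverse ++ r) cc).read u =
      some (b.parser copies (T ++ text) rest cc)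

theorem Parser.read_append (u u' : List Cert) (g : Parser) :
    g.read (u ++ u') = (g.read u').bind fun g => g.read u := by
  induction u with
  | nil => simp [read]
  | cons t u ih =>
    have h : ∀ u (g : Parser), g.read (t :: u) = (g.read u).bind fun g => g.step t :=
      fun _ _ => rfl
    simp only [List.cons_append, h, ih, Option.bind_assoc]

theorem Reads.refl (a : Position) : Reads [] [] a a := by
  intro copies text rest cc
  cases rest <;> simp [Parser.read]

/-- The right-hand part `u'` is read first. -/
theorem Reads.trans {u u' : List Cert} {T T' : List Sym} {a b c : Position}
    (h' : Reads u' T' a b) (h : Reads u T b c) : Reads (u ++ u') (T ++ T') a c := by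
  intro copies text rest cc
  have h1 := h' copies text (rest.map fun r => T.reverse ++ r) cc
  have h2 := h copies (T' ++ text) rest cc
  rw [Parser.read_append, List.append_assoc, ← h2]
  rw [Option.map_map] at h1
  rw [show (fun r => (T ++ T').reverse ++ r) =
    (fun r => T'.reverse ++ r) ∘ fun r => T.reverse ++ r by funext r; simp, h1, Option.bind_some]

theorem Reads.single {t : Cert} {a b : Position}
    (h : ∀ copies text rest cc, (a.parser copies text rest cc).pre t =
      some (b.parser copies text rest cc)) : Reads [t] t.text.toList a b := by
  intro copies text rest cc
  simp only [Parser.read, List.foldr_cons, List.foldr_nil, Option.bind_some, Parser.step, h]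
  rcases t.text with _ | x
  · rcases rest with _ | r <;> simp
  · rcases rest with _ | r <;> simp [Parser.compare, Position.parser]

theorem Reads.cons {t : Cert} {u : List Cert} {T : List Sym} {a b c : Position}
    (h' : Reads u T a b)
    (h : ∀ copies text rest cc, (b.parser copies text rest cc).pre t =
      some (c.parser copies text rest cc)) :
    Reads (t :: u) (t.text.toList ++ T) a c :=
  h'.trans (Reads.single h)

theorem reads_units (n m : ℕ) (x : Ctx) (lits nodes blocks sc) :
    Reads (List.replicate m .unit) [] ⟨x, .ready n, lits, nodes, blocks, sc⟩
      ⟨x, .ready (n + m), lits, nodes, blocks, sc⟩ := by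
  induction m with
  | zero => exact Reads.refl _
  | succ m ih =>
    rw [List.replicate_succ]
    exact ih.cons fun _ _ _ _ => rfl

theorem reads_vname (bs cs : List Bool) (p : Ctx) (c args n lits nodes blocks sc) :
    Reads (certBits bs) (bs.map .bit) ⟨.frame p c args, .vname n cs, lits, nodes, blocks, sc⟩
      ⟨.frame p c args, .vname n (bs ++ cs), lits, nodes, blocks, sc⟩ := by
  induction bs with
  | nil => exact Reads.refl _
  | cons b bs ih => exact ih.cons fun _ _ _ _ => rfl

def Phase.ofName : List Bool → Phase
  | [] => .ready 0
  | b :: bs => .name (b :: bs)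

theorem Phase.name?_ofName (bs : List Bool) : (Phase.ofName bs).name? = some bs := by
  cases bs <;> rfl

theorem reads_name (bs : List Bool) (p : Ctx) (c args lits nodes blocks sc) :
    Reads (certBits bs) (bs.map .bit) ⟨.frame p c args, .ready 0, lits, nodes, blocks, sc⟩
      ⟨.frame p c args, .ofName bs, lits, nodes, blocks, sc⟩ := by
  induction bs with
  | nil => exact Reads.refl _
  | cons b bs ih =>
    refine ih.cons fun _ _ _ _ => ?_
    cases bs <;> rfl

theorem reads_close (n : ℕ) (x : Ctx) (lits nodes blocks sc) :
    Reads (.sym .close :: List.replicate n .unit) [.close]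
      ⟨x, .ready 0, lits, nodes, blocks, sc⟩
      ⟨.frame x n [], .ready 0, lits, nodes, blocks, sc⟩ := by
  have h := reads_units 0 n x lits nodes blocks sc
  rw [Nat.zero_add] at h
  exact h.cons fun _ _ _ _ => rfl

theorem reads_flatMap_terms (k : Tm Name → ℕ) (l : List (Tm Name))
    (hl : ∀ t ∈ l, ∀ (p : Ctx) (c args lits nodes blocks sc),
      Reads (annTerm k t) (writeTerm t) ⟨.frame p c args, .ready 0, lits, nodes, blocks, sc⟩
        ⟨.frame p c ((t, k t) :: args), .ready 0, lits, termNodes k t ++ nodes, blocks, sc⟩)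
    (p : Ctx) (c args lits nodes blocks sc) :
    Reads (l.flatMap (annTerm k)) (l.flatMap writeTerm)
      ⟨.frame p c args, .ready 0, lits, nodes, blocks, sc⟩
      ⟨.frame p c (l.map (fun t => (t, k t)) ++ args), .ready 0, lits,
        l.flatMap (termNodes k) ++ nodes, blocks, sc⟩ := by
  induction l with
  | nil => exact Reads.refl _
  | cons t l ih =>
    have h1 := ih fun t ht => hl t (List.mem_cons_of_mem _ ht)
    have h2 := h1.trans (hl t List.mem_cons_self _ _ _ _ _ _ _)
    simpa using h2

theorem reads_term (k : Tm Name → ℕ) (t : Tm Name) : ∀ (p : Ctx) (c args lits nodes blocks sc),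
    Reads (annTerm k t) (writeTerm t) ⟨.frame p c args, .ready 0, lits, nodes, blocks, sc⟩
      ⟨.frame p c ((t, k t) :: args), .ready 0, lits, termNodes k t ++ nodes, blocks, sc⟩ := by
  induction t using Tm.induction with
  | var x =>
    intro p c args lits nodes blocks sc
    have h1 := reads_units 0 (k (.var x)) (.frame p c args) lits nodes blocks sc
    rw [Nat.zero_add] at h1
    have h2 := h1.cons (t := .vclose)
      (c := ⟨.frame p c args, .vname (k (.var x)) [], lits, nodes, blocks, sc⟩)
      fun _ _ _ _ => rfl
    have h3 := h2.trans (reads_vname x [] p c args _ lits nodes blocks sc)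
    rw [List.append_nil x] at h3
    have h4 := h3.cons (t := .sym .var)
      (c := ⟨.frame p c ((.var x, k (.var x)) :: args), .ready 0, lits,
        ⟨.var, x, [], k (.var x)⟩ :: nodes, blocks, sc⟩)
      fun _ _ _ _ => rfl
    simpa [annTerm, writeTerm, Cert.text, termNodes, subterms, nodeOf] using h4
  | fn f l ih =>
    intro p c args lits nodes blocks sc
    have h1 := reads_close (k (mkFn f l)) (.frame p c args) lits nodes blocks sc
    have h2 := h1.trans (reads_flatMap_terms k l ih _ _ _ _ _ _ _)
    have h3 := h2.trans (reads_name f _ _ _ _ _ _ _)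
    have h4 := h3.cons (t := .sym .fn)
      (c := ⟨.frame p c ((mkFn f l, k (mkFn f l)) :: args), .ready 0, lits,
        ⟨.fn, f, l.map k, k (mkFn f l)⟩ :: (l.flatMap (termNodes k) ++ nodes), blocks, sc⟩)
      fun _ _ _ _ => by
        simp [Parser.pre, Parser.openNode, Position.parser, Phase.name?_ofName,
          Function.comp_def]
    rw [annTerm_mkFn, writeTerm_mkFn, termNodes_mkFn]
    simpa [Cert.text] using h4

theorem annLit_ofList (k : Tm Name → ℕ) (kl : Literal Name → ℕ) (p : Bool) (f : Name)
    (l : List (Tm Name)) :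
    annLit k kl (.ofList p f l) = .sym (.lit p) :: (certBits f ++ (l.flatMap (annTerm k) ++
      .sym .close :: List.replicate (kl (.ofList p f l)) .unit)) := by
  have : List.ofFn l.get = l := by
    apply List.ext_get <;> simp
  have h : annLit k kl (.ofList p f l) = .sym (.lit p) :: (certBits f ++
    ((List.ofFn l.get).flatMap (annTerm k) ++
      .sym .close :: List.replicate (kl (.ofList p f l)) .unit)) := rfl
  rw [h, this]

theorem litNodes_ofList (k : Tm Name → ℕ) (kl : Literal Name → ℕ) (p : Bool) (f : Name)
    (l : List (Tm Name)) :
    litNodes k kl (.ofList p f l) =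
      ⟨.lit p, f, l.map k, kl (.ofList p f l)⟩ :: l.flatMap (termNodes k) := by
  have : List.ofFn l.get = l := by
    apply List.ext_get <;> simp
  have h : litNodes k kl (.ofList p f l) =
    ⟨.lit p, f, (List.ofFn l.get).map k, kl (.ofList p f l)⟩ ::
      (List.ofFn l.get).flatMap (termNodes k) := rfl
  rw [h, this]

theorem reads_lit (k : Tm Name → ℕ) (kl : Literal Name → ℕ) (L : Literal Name)
    (lits nodes blocks sc) :
    Reads (annLit k kl L) (writeLiteral L) ⟨.top, .ready 0, lits, nodes, blocks, sc⟩
      ⟨.top, .ready 0, (L, kl L) :: lits, litNodes k kl L ++ nodes, blocks, sc⟩ := by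
  obtain ⟨p, f, l, rfl⟩ := L.exists_eq_ofList
  have h1 := reads_close (kl (.ofList p f l)) .top lits nodes blocks sc
  have h2 := h1.trans (reads_flatMap_terms k l (fun t _ => reads_term k t) _ _ _ _ _ _ _)
  have h3 := h2.trans (reads_name f _ _ _ _ _ _ _)
  have h4 := h3.cons (t := .sym (.lit p))
    (c := ⟨.top, .ready 0, (.ofList p f l, kl (.ofList p f l)) :: lits,
      ⟨.lit p, f, l.map k, kl (.ofList p f l)⟩ :: (l.flatMap (termNodes k) ++ nodes), blocks, sc⟩)
    fun _ _ _ _ => by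
      simp [Parser.pre, Parser.openNode, Position.parser, Phase.name?_ofName,
        Function.comp_def]
  rw [annLit_ofList, writeLiteral_ofList, litNodes_ofList]
  simpa [Cert.text] using h4

theorem reads_clause (k : Tm Name → ℕ) (kl : Literal Name → ℕ) (C : InputClause) (sel : Bool)
    (blocks sc) :
    Reads (annClause k kl C sel) (writeClause C) ⟨.top, .ready 0, [], [], blocks, sc⟩
      ⟨.top, .ready 0, [], [], annBlock k kl C sel :: blocks, sc + sel.toNat⟩ := by
  have h : ∀ ls : List (Literal Name), Reads (ls.flatMap (annLit k kl))
      ((ls.map writeLiteral).flatten) ⟨.top, .ready 0, [], [], blocks, sc⟩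
      ⟨.top, .ready 0, ls.map fun L => (L, kl L), ls.flatMap (litNodes k kl), blocks, sc⟩ := by
    intro ls
    induction ls with
    | nil => exact Reads.refl _
    | cons L ls ih => exact ih.trans (reads_lit k kl L _ _ _ _)
  exact (h C.lits).cons fun _ _ _ _ => rfl

theorem reads_clauses {ι : Type} (u : ι → List Cert) (T : ι → List Sym) (b : ι → Block)
    (h : ∀ i blocks sc, Reads (u i) (T i) ⟨.top, .ready 0, [], [], blocks, sc⟩
      ⟨.top, .ready 0, [], [], b i :: blocks, sc + (b i).selected.toNat⟩) (l : List ι) (sc : ℕ) :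
    Reads (l.flatMap u) (l.flatMap T) ⟨.top, .ready 0, [], [], [], sc⟩
      ⟨.top, .ready 0, [], [], l.map b, sc + selected (l.map b)⟩ := by
  induction l with
  | nil => exact Reads.refl _
  | cons i l ih =>
    have h2 := ih.trans (h i _ _)
    simpa [selected, Nat.add_comm, Nat.add_left_comm] using h2

/-- Reading all copies. -/
theorem read_copies {ι κ : Type} (u : ι → κ → List Cert) (T : ι → List Sym) (b : ι → κ → Block)
    (h : ∀ i c blocks sc, Reads (u i c) (T i) ⟨.top, .ready 0, [], [], blocks, sc⟩
      ⟨.top, .ready 0, [], [], b i c :: blocks, sc + (b i c).selected.toNat⟩)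
    (l : List ι) (cs : List κ) :
    Parser.init.read (cs.flatMap fun c => .copy :: l.flatMap fun i => u i c) =
      some ⟨.top, .ready 0, [], [], [], cs.map fun c => l.map fun i => b i c, [],
        if cs = [] then none else some (l.flatMap T).reverse, cs.length,
        ((cs.map fun c => l.map fun i => b i c).map selected).sum⟩ := by
  induction cs with
  | nil => rfl
  | cons c cs ih =>
    rw [List.flatMap_cons, Parser.read_append, ih, Option.bind_some]
    have hcons : ∀ (t : Cert) u (g : Parser),
        g.read (t :: u) = (g.read u).bind fun g => g.step t := fun _ _ _ => rfl
    rw [hcons]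
    have h1 := reads_clauses (fun i => u i c) T (fun i => b i c) (fun i => h i c) l
      ((cs.map fun c => l.map fun i => b i c).map selected).sum
      (cs.map fun c => l.map fun i => b i c) [] (if cs = [] then none else some []) cs.length
    -- The first copy has no text to match. For every later one the expected text is consumed
    -- exactly, and the empty rest lets the next `copy` succeed.
    have h2 : (if cs = [] then none else some (l.flatMap T).reverse) =
        (if cs = [] then none else some []).map fun r => (l.flatMap T).reverse ++ r := by
      split <;> simp
    rw [h2]
    simp only [Position.parser] at h1
    rw [h1, Option.bind_some]
    have h3 : (if cs = [] then none else some ([] : List Sym)).getD [] = [] := by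
      split <;> rfl
    simp [Parser.step, Parser.pre, h3, Cert.text, Nat.add_comm]

/-! ### The length of certificates -/

/-- Each node adds at most `K` units and at most one `vclose` to its text, which contains at least
one symbol of its own; hence the factor `K + 2`. -/
theorem length_annTerm_le {k : Tm Name → ℕ} {K : ℕ} (hk : ∀ t, k t ≤ K) (t : Tm Name) :
    (annTerm k t).length ≤ (writeTerm t).length * (K + 2) := by
  induction t using Tm.induction with
  | var x =>
    have := hk (.var x)
    simp only [annTerm, writeTerm, certBits, List.length_cons, List.length_append,
      List.length_map, List.length_replicate]
    nlinarith [Nat.zero_le (x.length * (K + 1))]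
  | fn f l ih =>
    have h1 := hk (mkFn f l)
    have h2 : (l.flatMap (annTerm k)).length ≤ (l.flatMap writeTerm).length * (K + 2) := by
      induction l with
      | nil => simp
      | cons t l ihl =>
        have h3 := ih t List.mem_cons_self
        have h4 := ihl (fun t ht => ih t (List.mem_cons_of_mem _ ht)) (hk _)
        simp only [List.flatMap_cons, List.length_append]
        linarith
    rw [annTerm_mkFn, writeTerm_mkFn]
    simp only [certBits, List.length_cons, List.length_append,
      List.length_map, List.length_replicate, List.length_nil]
    nlinarith [Nat.zero_le (f.length * (K + 1))]

theorem length_flatMap_le {α β γ : Type} {f : α → List β} {g : α → List γ} {K : ℕ}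
    (l : List α) (h : ∀ a ∈ l, (f a).length ≤ (g a).length * K) :
    (l.flatMap f).length ≤ (l.flatMap g).length * K := by
  induction l with
  | nil => simp
  | cons a l ih =>
    have h1 := h a List.mem_cons_self
    have h2 := ih fun a ha => h a (List.mem_cons_of_mem _ ha)
    simp only [List.flatMap_cons, List.length_append]
    linarith

theorem length_annLit_le {k : Tm Name → ℕ} {kl : Literal Name → ℕ} {K : ℕ} (hk : ∀ t, k t ≤ K)
    (hkl : ∀ L, kl L ≤ K) (L : Literal Name) :
    (annLit k kl L).length ≤ (writeLiteral L).length * (K + 2) := by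
  obtain ⟨p, f, l, rfl⟩ := L.exists_eq_ofList
  have h1 := hkl (.ofList p f l)
  have h2 := length_flatMap_le l fun t _ => length_annTerm_le hk t
  rw [annLit_ofList, writeLiteral_ofList]
  simp only [certBits, List.length_cons, List.length_append,
    List.length_map, List.length_replicate, List.length_nil]
  nlinarith [Nat.zero_le (f.length * (K + 1))]

theorem length_annClause_le {k : Tm Name → ℕ} {kl : Literal Name → ℕ} {K : ℕ} (hk : ∀ t, k t ≤ K)
    (hkl : ∀ L, kl L ≤ K) (C : InputClause) (sel : Bool) :
    (annClause k kl C sel).length ≤ (writeClause C).length * (K + 2) := by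
  have h2 := length_flatMap_le C.lits fun L _ => length_annLit_le hk hkl L
  rw [List.flatMap, List.flatMap] at h2
  simp only [annClause, writeClause, List.length_cons, List.flatMap]
  nlinarith

theorem length_subterms_le (t : Tm Name) : (subterms t).length ≤ (writeTerm t).length := by
  induction t using Tm.induction with
  | var x => simp [subterms, writeTerm]
  | fn f l ih =>
    have h := length_flatMap_le (K := 1) l fun t ht => by simpa using ih t ht
    rw [subterms_mkFn, writeTerm_mkFn]
    simp only [List.length_cons, List.length_append, List.length_map, List.length_nil]
    omega

theorem tick_notMem_writeTerm (t : Tm Name) : Sym.tick ∉ writeTerm t := by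
  induction t using Tm.induction with
  | var x => simp [writeTerm]
  | fn f l ih =>
    rw [writeTerm_mkFn]
    simp only [List.mem_cons, List.mem_append, List.mem_map, List.mem_flatMap, reduceCtorEq,
      and_false, exists_false, false_or, or_false, List.not_mem_nil, not_exists, not_and]
    exact ih

theorem tick_notMem_writeClause (C : InputClause) : Sym.tick ∉ writeClause C := by
  simp only [writeClause, List.mem_cons, reduceCtorEq, false_or, List.mem_flatten, List.mem_map,
    not_exists, not_and]
  rintro _ ⟨L, -, rfl⟩
  obtain ⟨p, f, l, rfl⟩ := L.exists_eq_ofList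
  rw [writeLiteral_ofList]
  simp only [List.mem_cons, List.mem_append, List.mem_map, List.mem_flatMap, reduceCtorEq,
    and_false, exists_false, false_or, or_false, List.not_mem_nil, not_exists, not_and]
  exact fun t _ => tick_notMem_writeTerm t

/-- Reading the input after copies with the right text. -/
theorem readInput_eq (m : Instance.LimitMode) {T : List Sym} (hT : Sym.tick ∉ T)
    (x : Ctx) (f : Phase) (lits nodes blocks copies) (d sc : ℕ) (hsc : m.Holds sc d) :
    (⟨x, f, lits, nodes, blocks, copies, [], some T.reverse, d, sc⟩ : Parser).readInput m
      (List.replicate d .tick ++ T) =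
      some ⟨x, f, lits, nodes, blocks, copies, [], some [], 0, 0⟩ := by
  have h1 : ∀ (T : List Sym), Sym.tick ∉ T → ∀ r,
      (⟨x, f, lits, nodes, blocks, copies, [], some (T.reverse ++ r), d, sc⟩ : Parser).readInput m T =
      some ⟨x, f, lits, nodes, blocks, copies, [], some r, d, sc⟩ := by
    intro T
    induction T with
    | nil => intro _ r; rfl
    | cons a T ih =>
      intro hT r
      rw [List.mem_cons, not_or] at hT
      have h2 := ih hT.2 (a :: r)
      have hcons : ∀ g : Parser, g.readInput m (a :: T) =
          (g.readInput m T).bind fun g => g.stepInput m a := fun _ => rfl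
      rw [hcons, List.reverse_cons, List.append_assoc, List.singleton_append, h2,
        Option.bind_some]
      cases a <;> first
      | exact absurd rfl hT.1
      | simp [Parser.stepInput]
  have h2 := h1 T hT []
  rw [List.append_nil] at h2
  have happ : ∀ (u : List Sym) (g : Parser), g.readInput m (u ++ T) =
      (g.readInput m T).bind fun g => g.readInput m u := by
    intro u g
    induction u with
    | nil => simp [Parser.readInput]
    | cons t u ih =>
      have h : ∀ u (g : Parser), g.readInput m (t :: u) =
          (g.readInput m u).bind fun g => g.stepInput m t := fun _ _ => rfl
      simp only [List.cons_append, h, ih, Option.bind_assoc]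
  rw [happ, h2, Option.bind_some]
  -- The counter of copies starts at `d + j`, and `j` ticks lower it to `d`. The truncated
  -- difference `sc - j` covers ticks that find no selection left.
  have h3 : ∀ j d sc, (match m with
      | .atMost => sc ≤ d + j
      | .exactly => sc = d + j) →
      (⟨x, f, lits, nodes, blocks, copies, [], some [], d + j, sc⟩ : Parser).readInput m
        (List.replicate j .tick) =
      some ⟨x, f, lits, nodes, blocks, copies, [], some [], d, sc - j⟩ := by
    intro j
    induction j with
    | zero => intro d sc _; rfl
    | succ j ih =>
      intro d sc h
      have hcons : ∀ g : Parser, g.readInput m (List.replicate (j + 1) .tick) =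
          (g.readInput m (List.replicate j .tick)).bind fun g => g.stepInput m .tick :=
        fun _ => rfl
      rw [hcons]
      rw [show d + (j + 1) = (d + 1) + j by omega, ih (d + 1) sc (by
        cases m <;> simp only at h ⊢ <;> omega), Option.bind_some]
      rcases hs : sc - j with _ | s
      · cases m
        · have : sc - (j + 1) = 0 := by omega
          simp [Parser.stepInput, this]
        · simp only at h
          omega
      · have : sc - (j + 1) = s := by omega
        simp [Parser.stepInput, this]
  have h4 := h3 d 0 sc (by cases m <;> simpa [Instance.LimitMode.Holds] using hsc)
  rw [Nat.zero_add] at h4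
  rw [h4]
  have : sc - d = 0 := by
    cases m
    · have : sc ≤ d := hsc
      omega
    · have : sc = d := hsc
      omega
  rw [this]

/-! ## Completeness -/

def tmSize {V : Type} : Tm V → ℕ
  | .var _ => 1
  | @FirstOrder.Language.Term.func _ _ _ _ ts => 1 + (List.ofFn fun i => tmSize (ts i)).sum

theorem tmSize_mkFn {V : Type} (f : Name) (l : List (Tm V)) :
    tmSize (mkFn f l) = 1 + (l.map tmSize).sum := by
  have : (List.ofFn fun i => tmSize (l.get i)) = l.map tmSize := by
    apply List.ext_get <;> simp
  rw [← this]
  rfl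

theorem tmSize_lt_mkFn {V : Type} (f : Name) {l : List (Tm V)} {t : Tm V} (h : t ∈ l) :
    tmSize t < tmSize (mkFn f l) := by
  rw [tmSize_mkFn]
  have := List.single_le_sum (l := l.map tmSize) (by simp) _ (List.mem_map_of_mem h)
  omega

/-- The elements of a list can be numbered injectively by decreasing size. -/
theorem exists_numbering {α : Type} (l : List α) (size : α → ℕ) :
    ∃ κ : α → ℕ, (∀ a, κ a ≤ l.length) ∧ (∀ a ∈ l, ∀ b, κ a = κ b → a = b) ∧
      ∀ a ∈ l, ∀ b ∈ l, size b < size a → κ a < κ b := by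
  classical
  -- Sorting by decreasing size puts a term before its arguments. The number of an element is its
  -- first position in the sorted list; for an element outside the list `idxOf` returns the length,
  -- which no member has.
  let r : α → α → Prop := fun a b => size b ≤ size a
  have : Std.Total r := ⟨fun a b => le_total (size b) (size a)⟩
  have : IsTrans α r := ⟨fun a b c h1 h2 => le_trans (α := ℕ) h2 h1⟩
  set s := l.insertionSort r with hs
  have hmem : ∀ a, a ∈ l → a ∈ s := fun a ha => (List.perm_insertionSort r l).mem_iff.2 ha
  have hinj : ∀ a ∈ l, ∀ b, s.idxOf a = s.idxOf b → a = b :=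
    fun a ha b hab => (List.idxOf_inj (hmem a ha)).1 hab
  refine ⟨fun a => s.idxOf a, fun a => ?_, hinj, fun a ha b hb hab => ?_⟩
  · have h1 : s.idxOf a ≤ s.length := List.idxOf_le_length
    rwa [hs, List.length_insertionSort] at h1
  · by_contra hlt
    rcases (not_lt.1 hlt).lt_or_eq with h | h
    · have hp := List.pairwise_iff_getElem.1 (List.pairwise_insertionSort r l) _ _
        (List.idxOf_lt_length_of_mem (hmem b hb)) (List.idxOf_lt_length_of_mem (hmem a ha)) h
      rw [List.getElem_idxOf, List.getElem_idxOf] at hp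
      exact absurd hab (not_lt.2 hp)
    · rw [hinj b hb a h] at hab
      exact lt_irrefl _ hab

theorem eq_of_truth {zs : List Bool} (h : zs.count true = 1) {c c' : ℕ}
    (hc : truth zs c = true) (hc' : truth zs c' = true) : c = c' := by
  have h1 : ∀ (zs : List Bool) c, truth zs c = true → zs.count true ≠ 0 := by
    intro zs c hc h0
    have hlt : c < zs.length := by
      by_contra hge
      simp [truth, List.getD, not_lt.1 hge] at hc
    simp only [truth, List.getD, List.getElem?_eq_getElem hlt, Option.getD_some] at hc
    exact List.count_eq_zero.1 h0 (hc ▸ List.getElem_mem hlt)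
  induction zs generalizing c c' with
  | nil => simp at h
  | cons b zs ih =>
    cases b
    · rw [List.count_cons_of_ne (by simp)] at h
      rcases c with _ | c <;> rcases c' with _ | c' <;> simp [truth] at hc hc'
      rw [ih h (c := c) (c' := c') (by simpa [truth] using hc) (by simpa [truth] using hc')]
    · rw [List.count_cons_self, Nat.add_eq_right] at h
      have h2 : ∀ c, truth (true :: zs) c = true → c = 0 := by
        intro c hc
        rcases c with _ | c
        · rfl
        · exact absurd h (h1 zs c (by simpa [truth] using hc))
      rw [h2 c hc, h2 c' hc']

theorem truth_of_initial {zs : List Bool} (h : initial zs = true) {c c' : ℕ} (hle : c ≤ c')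
    (hc' : truth zs c' = true) : truth zs c = true := by
  induction zs generalizing c c' with
  | nil => simp [truth] at hc'
  | cons b zs ih =>
    simp only [initial, Bool.and_eq_true, Bool.or_eq_true, id_eq,
      Bool.not_eq_true', List.any_eq_false] at h
    rcases c' with _ | c'
    · rw [Nat.le_zero.1 hle]
      exact hc'
    · have hc2 : truth zs c' = true := by simpa [truth] using hc'
      rcases c with _ | c
      · rcases h.2 with h2 | h2
        · simp [truth, h2]
        · exfalso
          have hlt : c' < zs.length := by
            by_contra hge
            simp [truth, List.getD, not_lt.1 hge] at hc2
          simp only [truth, List.getD, List.getElem?_eq_getElem hlt, Option.getD_some] at hc2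
          exact h2 _ (List.getElem_mem hlt) hc2
      · have := ih h.1 (Nat.le_of_succ_le_succ hle) hc2
        simpa [truth] using this

/-- The atom of a literal as a term. -/
def Literal.atom {V : Type} (L : Literal V) : Tm V :=
  FirstOrder.Language.Term.func (L := sig) (l := L.arity) L.pred L.args

/-! ### The annotation obtained from a model -/

section Model

variable {I : Instance} (σ : I.RigidVar → Tm I.RigidVar) (κ : Bool × Tm I.RigidVar → ℕ)

/-- The instance of a term of a clause copy. -/
def image (c : I.Copy) (t : Tm Name) : Tm I.RigidVar :=
  (t.relabel fun x => (c, x)).subst σ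

theorem image_mkFn (c : I.Copy) (f : Name) (l : List (Tm Name)) :
    image σ c (mkFn f l) = mkFn f (l.map (image σ c)) := by
  rw [image, mkFn_relabel, mkFn_subst, List.map_map]
  rfl

/-- The instance of the atom of a literal of a clause copy. -/
def atomImage (c : I.Copy) (L : Literal Name) : Tm I.RigidVar :=
  ((L.rename fun x => (c, x)).subst σ).atom

theorem atomImage_ofList (c : I.Copy) (p : Bool) (f : Name) (l : List (Tm Name)) :
    atomImage σ c (.ofList p f l) = mkFn f (l.map (image σ c)) := by
  rw [atomImage, Literal.rename_ofList, Literal.subst_ofList, List.map_map]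
  rfl

/-- The values of the atoms and terms of a clause copy. -/
def values (c : I.Copy) : List (Bool × Tm I.RigidVar) :=
  (I.clauseOf c).lits.flatMap fun L => (true, atomImage σ c L) ::
    ((List.ofFn L.args).flatMap subterms).map fun t => (false, image σ c t)

theorem length_values_le (c : I.Copy) :
    (values σ c).length ≤ (writeClause (I.clauseOf c)).length := by
  have h := length_flatMap_le (f := fun L => (true, atomImage σ c L) ::
    ((List.ofFn L.args).flatMap subterms).map fun t => (false, image σ c t)) (g := writeLiteral)
    (K := 1) (I.clauseOf c).lits (by
      intro L _
      obtain ⟨p, f, l, rfl⟩ := L.exists_eq_ofList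
      have h := length_flatMap_le (K := 1) l fun t _ => by simpa using length_subterms_le t
      have hl : List.ofFn (Literal.ofList p f l).args = l := by
        have : List.ofFn l.get = l := by
          apply List.ext_get <;> simp
        exact this
      rw [hl, writeLiteral_ofList]
      simp only [List.length_cons, List.length_append, List.length_map, List.length_nil]
      omega)
  rw [values, writeClause, List.length_cons, ← List.flatMap]
  omega

/-- The Boolean keeps terms apart from atoms. A predicate and a function may have the same name, and
a shared class would then contain words with different openers. -/
def termClass (c : I.Copy) (t : Tm Name) : ℕ := κ (false, image σ c t)

def atomClass (c : I.Copy) (L : Literal Name) : ℕ := κ (true, atomImage σ c L)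

def modelBlock (v : I.SATVar → Bool) (c : I.Copy) : Block :=
  annBlock (termClass σ κ c) (atomClass σ κ c) (I.clauseOf c) (v (.sel c))

theorem kind_lit_of_mem {v : I.SATVar → Bool} {c : I.Copy} {a : Node}
    (ha : a ∈ (modelBlock σ κ v c).nodes) {p : Bool} (hp : a.kind = .lit p) :
    ∃ o : I.Occ, o.1 = c ∧ (I.litAt o).positive = p ∧
      a.cls = κ (true, ((I.litAt o).subst σ).atom) := by
  obtain ⟨L, hL, ha⟩ := List.mem_flatMap.1 ha
  rcases List.mem_cons.1 ha with rfl | ha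
  · obtain ⟨i, rfl⟩ := List.get_of_mem hL
    simp only [litNode, NodeKind.lit.injEq] at hp
    exact ⟨⟨c, i⟩, rfl, hp, rfl⟩
  · obtain ⟨t, -, ha⟩ := List.mem_flatMap.1 ha
    obtain ⟨u, -, rfl⟩ := List.mem_map.1 ha
    cases u <;> simp [nodeOf] at hp

theorem exists_lit_node (v : I.SATVar → Bool) (o : I.Occ) :
    ∃ a ∈ (modelBlock σ κ v o.1).nodes, a.kind = .lit (I.litAt o).positive ∧
      a.cls = κ (true, ((I.litAt o).subst σ).atom) :=
  ⟨litNode _ _ _, List.mem_flatMap.2 ⟨_, List.get_mem _ o.2, List.mem_cons_self⟩, rfl, rfl⟩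

theorem kind_var_of_mem {v : I.SATVar → Bool} {c : I.Copy} {a : Node}
    (ha : a ∈ (modelBlock σ κ v c).nodes) (hp : a.kind = .var) :
    a.cls = termClass σ κ c (.var a.name) := by
  obtain ⟨L, hL, ha⟩ := List.mem_flatMap.1 ha
  rcases List.mem_cons.1 ha with rfl | ha
  · simp [litNode] at hp
  · obtain ⟨t, -, ha⟩ := List.mem_flatMap.1 ha
    obtain ⟨u, -, rfl⟩ := List.mem_map.1 ha
    cases u
    · rfl
    · simp [nodeOf] at hp

/-- The nodes that are not variables stand for values `f(t₁, …, tₙ)`. -/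
theorem exists_value_of_mem {v : I.SATVar → Bool} {c : I.Copy} {a : Node}
    (ha : a ∈ (modelBlock σ κ v c).nodes) (hp : a.kind ≠ .var) :
    ∃ (b : Bool) (l : List (Tm I.RigidVar)),
      a.kind.opener = (if b then .lit true else .fn) ∧ a.cls = κ (b, mkFn a.name l) ∧
      a.args = l.map (fun t => κ (false, t)) ∧ (b, mkFn a.name l) ∈ values σ c ∧
      ∀ t ∈ l, (false, t) ∈ values σ c := by
  obtain ⟨L, hL, ha⟩ := List.mem_flatMap.1 ha
  obtain ⟨p, f, l, rfl⟩ := L.exists_eq_ofList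
  have hl : List.ofFn (Literal.ofList p f l).args = l := by
    have : List.ofFn l.get = l := by
      apply List.ext_get <;> simp
    exact this
  have hsub : ∀ t ∈ l, ∀ u ∈ subterms t, (false, image σ c u) ∈ values σ c := by
    intro t ht u hu
    refine List.mem_flatMap.2 ⟨_, hL, List.mem_cons_of_mem _ ?_⟩
    rw [hl]
    exact List.mem_map.2 ⟨u, List.mem_flatMap.2 ⟨t, ht, hu⟩, rfl⟩
  rw [litNodes_ofList] at ha
  rcases List.mem_cons.1 ha with rfl | ha
  · refine ⟨true, l.map (image σ c), rfl, ?_, ?_, ?_, ?_⟩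
    · simp only [atomClass, atomImage_ofList]
    · simp only [List.map_map]
      rfl
    · rw [← atomImage_ofList σ c p]
      exact List.mem_flatMap.2 ⟨_, hL, List.mem_cons_self⟩
    · intro t ht
      obtain ⟨t₀, ht₀, rfl⟩ := List.mem_map.1 ht
      exact hsub t₀ ht₀ t₀ (self_mem_subterms t₀)
  · obtain ⟨t, ht, ha⟩ := List.mem_flatMap.1 ha
    obtain ⟨u, hu, rfl⟩ := List.mem_map.1 ha
    have hu' : (∃ x, u = .var x) ∨ ∃ (g : Name) (l' : List (Tm Name)), u = mkFn g l' := by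
      induction u using Tm.induction with
      | var x => exact .inl ⟨x, rfl⟩
      | fn g l' => exact .inr ⟨g, l', rfl⟩
    rcases hu' with ⟨x, rfl⟩ | ⟨g, l', rfl⟩
    · exact absurd rfl hp
    · rw [nodeOf_mkFn]
      refine ⟨false, l'.map (image σ c), rfl, ?_, ?_, ?_, ?_⟩
      · simp only [termClass, image_mkFn]
      · simp only [List.map_map]
        rfl
      · rw [← image_mkFn]
        exact hsub t ht _ hu
      · intro t' ht'
        obtain ⟨t₀, ht₀, rfl⟩ := List.mem_map.1 ht'
        exact hsub t ht _ (arg_mem_subterms hu ht₀)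

/-- Classes are numbers of instances, so equal classes mean equal instances, and connected literals
have the same class. Each check then reflects a property of the model, whatever the truth values and
the word are. -/
theorem passes_of_model {m : Instance.LimitMode} {v : I.SATVar → Bool} (hv : I.IsModel m v)
    (hσ : ∀ L K : I.Occ, v (.conn s(L, K)) = true →
      ((I.litAt L).subst σ).Connected ((I.litAt K).subst σ))
    (hinj : ∀ c, ∀ a ∈ values σ c, ∀ b, κ a = κ b → a = b)
    (hlt : ∀ c, ∀ a ∈ values σ c, ∀ b ∈ values σ c, tmSize b.2 < tmSize a.2 → κ a < κ b)
    (zs : List Bool) (R : List Cell) :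
    Passes (modelBlock σ κ v) (truth zs) (zs.count true = 1) (initial zs = true) R := by
  have harg : ∀ c, ∀ a ∈ (modelBlock σ κ v c).nodes, a.kind ≠ .var → ∀ k ∈ a.args,
      a.cls < k := by
    intro c a ha hk k hka
    obtain ⟨b, l, -, h2, h3, h4, h5⟩ := exists_value_of_mem σ κ ha hk
    rw [h3] at hka
    obtain ⟨t, ht, rfl⟩ := List.mem_map.1 hka
    rw [h2]
    exact hlt c _ h4 _ (h5 t ht) (tmSize_lt_mkFn _ ht)
  have hconn : ∀ L K : I.Occ, v (.conn s(L, K)) = true →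
      (I.litAt K).positive = !(I.litAt L).positive ∧
      ((I.litAt K).subst σ).atom = ((I.litAt L).subst σ).atom := by
    intro L K h
    have h1 : (I.litAt K).subst σ = ((I.litAt L).subst σ).compl := hσ L K h
    refine ⟨?_, by rw [h1]; rfl⟩
    have h2 : ((I.litAt K).subst σ).positive = (((I.litAt L).subst σ).compl).positive := by
      rw [h1]
    exact h2
  refine ⟨?_, ?_, ?_, ?_, ?_, ?_, ?_⟩
  -- Both nodes have the only true class, hence the same instance, and the instance determines the
  -- symbol and the classes of the arguments.
  · intro hs c c' a ha a' ha' hk hk' ht ht' hw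
    have hcls := eq_of_truth hs ht ht'
    obtain ⟨b, l, h1, h2, h3, h4, -⟩ := exists_value_of_mem σ κ ha hk
    obtain ⟨b', l', h1', h2', h3', -, -⟩ := exists_value_of_mem σ κ ha' hk'
    rw [h2, h2'] at hcls
    have heq := hinj c _ h4 _ hcls
    rw [Prod.mk.injEq] at heq
    obtain ⟨rfl, heq⟩ := heq
    obtain ⟨hn, rfl⟩ := mkFn_injective heq
    rw [← hw, Node.word, Node.word, h1, h1', h3, h3', hn]
  · intro hs c a ha hk ht k hka
    by_contra hkt
    rw [Bool.not_eq_false] at hkt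
    exact (harg c a ha hk k hka).ne (eq_of_truth hs ht hkt)
  · intro hm c a ha hk ht k hka
    by_contra hkt
    rw [Bool.not_eq_false] at hkt
    rw [truth_of_initial hm (harg c a ha hk k hka).le hkt] at ht
    simp at ht
  · intro c a ha a' ha' hk hk' hw hw' ht
    have hn := (word_injective (hw.trans hw'.symm)).2.1
    rw [kind_var_of_mem σ κ ha' hk', ← hn, ← kind_var_of_mem σ κ ha hk]
    exact ht
  · rintro p c hsel ⟨a, ha, hk, ht⟩
    obtain ⟨o, rfl, hp, hcls⟩ := kind_lit_of_mem σ κ ha hk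
    obtain ⟨K, hne, -, hK, hKv⟩ := hv.fullyConnected o hsel
    obtain ⟨h1, h2⟩ := hconn o K hKv
    obtain ⟨a', ha', hk', hcls'⟩ := exists_lit_node σ κ v K
    exact ⟨K.1, hne, hK, a', ha', by rw [hk', h1, hp], by rw [hcls', h2, ← hcls]; exact ht⟩
  · by_contra hcon
    push Not at hcon
    have h1 : ∀ c : I.Copy, v (.sel c) = true → ∃ o : I.Occ, o.1 = c ∧
        (I.litAt o).positive = truth zs (κ (true, ((I.litAt o).subst σ).atom)) := by
      intro c hc
      obtain ⟨a, ha, hk⟩ := hcon c hc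
      obtain ⟨o, ho, hp, hcls⟩ := kind_lit_of_mem σ κ ha hk
      exact ⟨o, ho, by rw [hp, hcls]⟩
    -- If no selected copy is falsified, one true literal from each forms a path. The connected pair
    -- that it contains has one class and opposite polarities, so its literals cannot both be true.
    choose f hf1 hf2 using h1
    have hpath : I.IsPath (I.matrix v)
        {o | ∃ (c : I.Copy) (hc : v (.sel c) = true), f c hc = o} := by
      refine ⟨?_, fun c hc => ⟨f c hc, ⟨⟨c, hc, rfl⟩, hf1 c hc⟩, ?_⟩⟩
      · rintro _ ⟨c, hc, rfl⟩
        rw [hf1]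
        exact hc
      · rintro _ ⟨⟨c', hc', rfl⟩, h⟩
        rw [hf1] at h
        subst h
        rfl
    obtain ⟨L, ⟨c, hc, rfl⟩, K, ⟨c', hc', rfl⟩, -, hLK⟩ := hv.spanning _ hpath
    obtain ⟨h2, h3⟩ := hconn _ _ hLK
    rw [hf2 c hc, hf2 c' hc', h3] at h2
    simp at h2
  · obtain ⟨c, h1, h2, h3⟩ := hv.start
    exact ⟨c, h2, h1, h3⟩

end Model

/-- A word in the language has a short universally accepted certificate. -/
theorem exists_certificate (m : Instance.LimitMode) {w : List Sym} (hw : w ∈ solvingLanguage m) :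
    ∃ y : List Cert, y.length ≤ w.length + 2 * w.length ^ 2 + w.length ^ 4 ∧
      ∀ z : List Cert, verifier m (w, y, z) = true := by
  obtain ⟨I, rfl, v, hv⟩ := hw
  obtain ⟨σ, hσ⟩ := hv.unification
  -- One numbering serves all copies, because literals of different copies have to share classes.
  obtain ⟨κ, hκ1, hκ2, hκ3⟩ := exists_numbering
    ((List.finRange I.limit).flatMap fun k =>
      (List.finRange I.clauses.length).flatMap fun j => values σ (j, k)) fun a => tmSize a.2
  have hmem : ∀ c, ∀ a ∈ values σ c, a ∈ (List.finRange I.limit).flatMap fun k =>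
      (List.finRange I.clauses.length).flatMap fun j => values σ (j, k) := by
    rintro ⟨j, k⟩ a ha
    simp only [List.mem_flatMap, List.mem_finRange, true_and]
    exact ⟨k, j, ha⟩
  have hpass := passes_of_model σ κ hv hσ (fun c a ha => hκ2 a (hmem c a ha))
    (fun c a ha b hb => hκ3 a (hmem c a ha) b (hmem c b hb))
  set T : List Sym := (I.clauses.map writeClause).flatten with hT
  have hTf : (List.finRange I.clauses.length).flatMap
      (fun j => writeClause (I.clauses.get j)) = T := by
    rw [hT, List.flatMap]
    congr 1
    apply List.ext_get <;> simp
  have hK : ∀ x, κ x ≤ I.limit * T.length := by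
    intro x
    refine (hκ1 x).trans ?_
    have h1 : ∀ k : Fin I.limit, ((List.finRange I.clauses.length).flatMap
        fun j => values σ (j, k)).length ≤ T.length := by
      intro k
      rw [← hTf]
      have := length_flatMap_le (K := 1) (f := fun j => values σ (j, k))
        (g := fun j => writeClause (I.clauses.get j)) (List.finRange I.clauses.length)
        (fun j _ => by rw [Nat.mul_one]; exact length_values_le σ (j, k))
      omega
    -- The constant function `[()]` contributes one cell for each copy, so its concatenation has
    -- length `I.limit`.
    have h2 := length_flatMap_le (K := T.length) (f := fun k => (List.finRange
      I.clauses.length).flatMap fun j => values σ (j, k)) (g := fun _ => [()])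
      (List.finRange I.limit) (fun k _ => by simpa using h1 k)
    simpa using h2
  set u : Fin I.clauses.length → Fin I.limit → List Cert := fun j k =>
    annClause (termClass σ κ (j, k)) (atomClass σ κ (j, k)) (I.clauses.get j)
      (v (.sel (j, k))) with hu
  refine ⟨(List.finRange I.limit).flatMap fun k => .copy ::
    (List.finRange I.clauses.length).flatMap fun j => u j k, ?_, fun z => ?_⟩
  · have h1 : ∀ k : Fin I.limit, (Cert.copy :: (List.finRange I.clauses.length).flatMap
        fun j => u j k).length ≤ 1 + T.length * (I.limit * T.length + 2) := by
      intro k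
      rw [← hTf]
      have := length_flatMap_le (f := fun j => u j k)
        (g := fun j => writeClause (I.clauses.get j)) (List.finRange I.clauses.length)
        (fun j _ => length_annClause_le (k := termClass σ κ (j, k)) (kl := atomClass σ κ (j, k))
          (fun t => hK _) (fun L => hK _) (I.clauses.get j) (v (.sel (j, k))))
      rw [hTf] at this ⊢
      rw [List.length_cons]
      omega
    have h2 := length_flatMap_le (f := fun k => Cert.copy ::
      (List.finRange I.clauses.length).flatMap fun j => u j k) (g := fun _ => [()])
      (List.finRange I.limit) (fun k _ => by
        rw [List.length_singleton, Nat.one_mul]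
        exact h1 k)
    have h3 : ((List.finRange I.limit).flatMap fun _ => [()]).length = I.limit := by simp
    rw [h3] at h2
    refine h2.trans ?_
    have h4 : (writeInstance I).length = I.limit + T.length := by
      simp [writeInstance, hT]
    rw [h4]
    generalize I.limit = d
    generalize T.length = t
    -- There are `d` copies of text length `t`, with classes at most `d * t`. The input has length
    -- `d + t`, so `d * t` is at most its square.
    have h5 : d * (1 + t * (d * t + 2)) = d + 2 * (d * t) + (d * t) * (d * t) := by ring
    have h6 : d * t ≤ (d + t) ^ 2 := by nlinarith [Nat.zero_le (d * t), Nat.zero_le (d * d)]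
    have h7 : (d * t) * (d * t) ≤ (d + t) ^ 4 := by
      calc (d * t) * (d * t) ≤ (d + t) ^ 2 * (d + t) ^ 2 := Nat.mul_le_mul h6 h6
        _ = (d + t) ^ 4 := by ring
    omega
  · have hsum := ncard_selected (modelBlock σ κ v)
    have hcopies : (List.ofFn fun k : Fin I.limit => List.ofFn fun j : Fin I.clauses.length =>
        modelBlock σ κ v (j, k)) = (List.finRange I.limit).map fun k =>
          (List.finRange I.clauses.length).map fun j => modelBlock σ κ v (j, k) := by
      simp only [List.ofFn_eq_map]
    have hread := read_copies u (fun j => writeClause (I.clauses.get j))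
      (fun j k => modelBlock σ κ v (j, k)) (fun j k blocks sc => reads_clause _ _ _ _ _ _)
      (List.finRange I.clauses.length) (List.finRange I.limit)
    rw [hTf, ← hcopies, ← hsum] at hread
    -- The selected start clause forces a positive limit; hence at least one copy is read and its
    -- text is available for comparison with the input.
    have hd : List.finRange I.limit ≠ [] := by
      obtain ⟨c, -⟩ := hv.start
      exact List.ne_nil_of_mem (List.mem_finRange c.2)
    rw [if_neg hd, List.length_finRange] at hread
    have hTt : Sym.tick ∉ T := by
      simp only [hT, List.mem_flatten, List.mem_map, not_exists, not_and]
      rintro _ ⟨C, -, rfl⟩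
      exact tick_notMem_writeClause C
    have hinput := readInput_eq m hTt .top (.ready 0) [] [] []
      (List.ofFn fun k : Fin I.limit => List.ofFn fun j : Fin I.clauses.length =>
        modelBlock σ κ v (j, k)) I.limit _ hv.size
    refine (verifier_eq_true _ _ _ _).2 ⟨_, (congrArg (fun o : Option Parser =>
      o.bind fun g => g.readInput m (writeInstance I)) hread).trans hinput, rfl, rfl, ?_⟩
    exact (copiesMonitor_ok (modelBlock σ κ v) _ _ _ _).2 (by simpa using hpass _ _)

end

end MatrixEncoding

theorem theorem4 :
    ∀ m : MatrixEncoding.Instance.LimitMode,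
      MatrixEncoding.SigmaTwoP (MatrixEncoding.solvingLanguage m) := by
  intro m
  refine ⟨MatrixEncoding.Cert, inferInstance,
    Polynomial.X + 2 * Polynomial.X ^ 2 + Polynomial.X ^ 4, MatrixEncoding.verifier m,
    MatrixEncoding.verifier_polyTime m, fun w => ⟨fun hw => ?_, ?_⟩⟩
  · obtain ⟨y, hy, hV⟩ := MatrixEncoding.exists_certificate m hw
    exact ⟨y, by simpa using hy, fun z _ => hV z⟩
  · rintro ⟨y, hy, hV⟩
    -- The same polynomial bounds both certificates, so the universal one ranges over all words at
    -- least up to the length of `y`, which is what soundness uses.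
    exact MatrixEncoding.mem_solvingLanguage_of_verifier m fun z hz => hV z (hz.trans hy)
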